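/- Let $k$ be a commutative ring and let $A$ and $B$ be (associative, unital) $k$-algebras such that $B$ is projective as a $k$-module. For a ring $R$, let $\mathcal D(R)$ be the unbounded derived category of $R$-modules (left modules throughout; right modules are covered by passing to opposite algebras). Call an object of $\mathcal D(R)$ perfect if it is isomorphic in $\mathcal D(R)$ to a bounded complex of finitely generated projective $R$-modules. An object $T\in\mathcal D(R)$ is a tilting complex if $\operatorname{Hom}_{\mathcal D(R)}(T,T[r])=0$ for all integers $r\neq 0$, and the smallest triangulated subcategory of $\mathcal D(R)$ that contains $T$ and is closed under isomorphisms and direct summands is the subcategory of perfect objects. For a complex $X$ of $A$-modules and a complex $Y$ of $B$-modules, $X\otimes_k Y$ is the complex of $A\otimes_k B$-modules with terms $(X\otimes_k Y)^m=\bigoplus_{p+q=m}X^p\otimes_k Y^q$ and differential $d(x\otimes y)=dx\otimes y+(-1)^p x\otimes dy$ for $x\in X^p$. Let $U_1,\dots,U_n$ be bounded above complexes of $B$-modules, and put $U=U_1\oplus\dots\oplus U_n$. Assume that (i) $U$ is a tilting complex in $\mathcal D(B)$; (ii) every term $U^r$ of $U$ is projective as a $k$-module; (iii) $\operatorname{End}_{\mathcal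 D(B)}(U)$ is projective as a $k$-module. Let $T_1,\dots,T_n$ be complexes of $A$-modules, each of which is a tilting complex in $\mathcal D(A)$, such that for all $1\le i,j\le n$ with $\operatorname{Hom}_{\mathcal D(B)}(U_i,U_j)\neq 0$ one has $\operatorname{Hom}_{\mathcal D(A)}(T_i,T_j[r])=0$ for all $r\neq 0$. Then $$V=(T_1\otimes_k U_1)\oplus\dots\oplus(T_n\otimes_k U_n)$$ is a tilting complex in $\mathcal D(A\otimes_k B)$. Moreover, $\operatorname{End}_{\mathcal D(A\otimes_k B)}(V)$ is isomorphic as a $k$-algebra to the algebra of matrices $(m_{ij})_{1\le i,j\le n}$ with entries $$m_{ij}\in M_{ij}=\operatorname{Hom}_{\mathcal D(A)}(T_j,T_i)\otimes_k\operatorname{Hom}_{\mathcal D(B)}(U_j,U_i),$$ with matrix multiplication given by the compositions $M_{ij}\otimes_k M_{jl}\to M_{il}$, $(f\otimes g)(f'\otimes g')=(f\circ f')\otimes(g\circ g')$. The isomorphism can be chosen to send, for each $i$, the projection of $V$ onto its summand $T_i\otimes_k U_i$ to the matrix with $(i,i)$-entry $1\otimes 1$ and all other entries $0$. -/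

import Mathlib

open CategoryTheory CategoryTheory.Limits
open scoped TensorProduct ModuleCat.Algebra

universe u w₁ w₂ w₃

namespace TensorTilting

instance (R : Type u) [Ring R] :
    HasFiniteBiproducts (CochainComplex (ModuleCat.{u} R) ℤ) :=
  Abelian.hasFiniteBiproducts

/-! ### Perfect complexes and tilting complexes -/

section Tilting

/-- An object of the derived category `D(R)` is perfect if it is isomorphic in `D(R)` to a bounded
complex whose terms are finitely generated projective `R`-modules. -/
def IsPerfect {R : Type u} [Ring R] [HasDerivedCategory.{w₁} (ModuleCat.{u} R)]
    (X : DerivedCategory (ModuleCat.{u} R)) : Prop :=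
  ∃ P : CochainComplex (ModuleCat.{u} R) ℤ,
    (∃ a : ℤ, P.IsStrictlyGE a) ∧ (∃ b : ℤ, P.IsStrictlyLE b) ∧
    (∀ m : ℤ, Module.Finite R (P.X m) ∧ Module.Projective R (P.X m)) ∧
    Nonempty (X ≅ DerivedCategory.Q.obj P)

/-- A tilting complex over `R`: an object `T` of `D(R)` with no nonzero morphisms to its nonzero
shifts, such that the smallest triangulated subcategory of `D(R)` which contains `T` and is closed
under isomorphisms and direct summands consists exactly of the perfect complexes. -/
structure IsTilting {R : Type u} [Ring R] [HasDerivedCategory.{w₁} (ModuleCat.{u} R)]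
    (T : DerivedCategory (ModuleCat.{u} R)) : Prop where
  exceptional : ∀ r : ℤ, r ≠ 0 → ∀ f : T ⟶ T⟦r⟧, f = 0
  generates : ∀ X : DerivedCategory (ModuleCat.{u} R),
    (ObjectProperty.singleton T).triangEnvelope X ↔ IsPerfect X

end Tilting

/-! ### The tensor product over `k` of an `A`-module and a `B`-module -/

section TensorModule

variable (k A B : Type u) [CommRing k] [Ring A] [Algebra k A] [Ring B] [Algebra k B]

/-- The `A ⊗[k] B`-module structure on `M ⊗[k] N`, given by
`(a ⊗ b) • (x ⊗ y) = (a • x) ⊗ (b • y)`. -/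
@[reducible]
noncomputable def tensorModule (M : ModuleCat.{u} A) (N : ModuleCat.{u} B) :
    Module (A ⊗[k] B) (M ⊗[k] N) :=
  Module.compHom (M ⊗[k] N)
    ((Module.endTensorEndAlgHom (R := k) (S := k) (A := k) (M := M) (N := N)).comp
      (Algebra.TensorProduct.map (Algebra.lsmul k k M) (Algebra.lsmul k k N))).toRingHom

theorem tmul_smul_tmul (M : ModuleCat.{u} A) (N : ModuleCat.{u} B) (a : A) (b : B)
    (x : M) (y : N) :
    letI := tensorModule k A B M N
    (a ⊗ₜ[k] b : A ⊗[k] B) • (x ⊗ₜ[k] y : M ⊗[k] N) = (a • x) ⊗ₜ[k] (b • y) := rfl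

/-- The tensor product `M ⊗[k] N` as an `A ⊗[k] B`-module. -/
noncomputable def tensorObj (M : ModuleCat.{u} A) (N : ModuleCat.{u} B) :
    ModuleCat.{u} (A ⊗[k] B) :=
  letI := tensorModule k A B M N
  ModuleCat.of (A ⊗[k] B) (M ⊗[k] N)

variable {A B}

/-- The morphism `f ⊗ g : M ⊗[k] N ⟶ M' ⊗[k] N'` of `A ⊗[k] B`-modules. -/
noncomputable def tensorHom {M M' : ModuleCat.{u} A} {N N' : ModuleCat.{u} B}
    (f : M ⟶ M') (g : N ⟶ N') : tensorObj k A B M N ⟶ tensorObj k A B M' N' :=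
  letI := tensorModule k A B M N
  letI := tensorModule k A B M' N'
  ModuleCat.ofHom (X := M ⊗[k] N) (Y := M' ⊗[k] N')
    { TensorProduct.map (f.hom.restrictScalars k) (g.hom.restrictScalars k) with
      map_smul' := by
        intro s t
        induction s with
        | zero => simp
        | add s₁ s₂ h₁ h₂ =>
          simp only [AddHom.toFun_eq_coe, LinearMap.coe_toAddHom, RingHom.id_apply] at h₁ h₂ ⊢
          rw [add_smul, add_smul, map_add, h₁, h₂]
        | tmul a b =>
          induction t with
          | zero => simp
          | add t₁ t₂ h₁ h₂ =>
            simp only [AddHom.toFun_eq_coe, LinearMap.coe_toAddHom, RingHom.id_apply] at h₁ h₂ ⊢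
            rw [smul_add, map_add, map_add, smul_add, h₁, h₂]
          | tmul x y =>
            change (f.hom (a • x)) ⊗ₜ[k] (g.hom (b • y)) = (a • f.hom x) ⊗ₜ[k] (b • g.hom y)
            rw [map_smul, map_smul] }

theorem tensorHom_tmul {M M' : ModuleCat.{u} A} {N N' : ModuleCat.{u} B}
    (f : M ⟶ M') (g : N ⟶ N') (x : M) (y : N) :
    (tensorHom k f g).hom (x ⊗ₜ[k] y : M ⊗[k] N) = (f.hom x ⊗ₜ[k] g.hom y : M' ⊗[k] N') := rfl

theorem tensorObj_hom_ext {M : ModuleCat.{u} A} {N : ModuleCat.{u} B}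
    {Z : ModuleCat.{u} (A ⊗[k] B)} {f g : tensorObj k A B M N ⟶ Z}
    (h : ∀ (x : M) (y : N), f.hom (x ⊗ₜ[k] y : M ⊗[k] N) = g.hom (x ⊗ₜ[k] y : M ⊗[k] N)) :
    f = g := by
  ext t
  change M ⊗[k] N at t
  induction t with
  | zero => exact (map_zero f.hom).trans (map_zero g.hom).symm
  | add t₁ t₂ h₁ h₂ =>
    exact (map_add f.hom t₁ t₂).trans ((congrArg₂ (· + ·) h₁ h₂).trans (map_add g.hom t₁ t₂).symm)
  | tmul x y => exact h x y

theorem tensorHom_id (M : ModuleCat.{u} A) (N : ModuleCat.{u} B) :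
    tensorHom k (𝟙 M) (𝟙 N) = 𝟙 (tensorObj k A B M N) :=
  tensorObj_hom_ext k fun _ _ => rfl

theorem tensorHom_comp {M M' M'' : ModuleCat.{u} A} {N N' N'' : ModuleCat.{u} B}
    (f : M ⟶ M') (f' : M' ⟶ M'') (g : N ⟶ N') (g' : N' ⟶ N'') :
    tensorHom k (f ≫ f') (g ≫ g') = tensorHom k f g ≫ tensorHom k f' g' :=
  tensorObj_hom_ext k fun _ _ => rfl

theorem tensorHom_zero_left {M M' : ModuleCat.{u} A} {N N' : ModuleCat.{u} B} (g : N ⟶ N') :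
    tensorHom k (0 : M ⟶ M') g = 0 :=
  tensorObj_hom_ext k fun _ y => TensorProduct.zero_tmul _ (g.hom y)

theorem tensorHom_zero_right {M M' : ModuleCat.{u} A} {N N' : ModuleCat.{u} B} (f : M ⟶ M') :
    tensorHom k f (0 : N ⟶ N') = 0 :=
  tensorObj_hom_ext k fun x _ => TensorProduct.tmul_zero _ (f.hom x)

variable (A B)

/-- The bifunctor `(M, N) ↦ M ⊗[k] N` from `A`-modules and `B`-modules to `A ⊗[k] B`-modules. -/
noncomputable def tensorBifunctor :
    ModuleCat.{u} A ⥤ ModuleCat.{u} B ⥤ ModuleCat.{u} (A ⊗[k] B) where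
  obj M :=
    { obj := fun N => tensorObj k A B M N
      map := fun g => tensorHom k (𝟙 M) g
      map_id := fun N => tensorHom_id k M N
      map_comp := fun g g' => by rw [← tensorHom_comp, Category.id_comp] }
  map f :=
    { app := fun N => tensorHom k f (𝟙 N)
      naturality := fun N N' g => by
        dsimp only
        rw [← tensorHom_comp, ← tensorHom_comp, Category.id_comp, Category.comp_id,
          Category.id_comp, Category.comp_id] }
  map_id M := by
    ext N : 2
    exact tensorHom_id k M N
  map_comp f f' := by
    ext N : 2
    dsimp only [NatTrans.comp_app]
    rw [← tensorHom_comp, Category.id_comp]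

instance : (tensorBifunctor k A B).PreservesZeroMorphisms where
  map_zero M M' := by
    ext N : 2
    exact tensorHom_zero_left k (𝟙 N)

instance (M : ModuleCat.{u} A) : ((tensorBifunctor k A B).obj M).PreservesZeroMorphisms where
  map_zero _ _ := tensorHom_zero_right k (𝟙 M)

variable {A B}

/-- The tensor product over `k` of a complex `X` of `A`-modules and a complex `Y` of `B`-modules:
the complex of `A ⊗[k] B`-modules with terms `(X ⊗ Y)ⁿ = ⨁_{p + q = n} Xᵖ ⊗[k] Y^q` and
differential `d (x ⊗ y) = d x ⊗ y + (-1)ᵖ • x ⊗ d y` for `x ∈ Xᵖ`. -/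
noncomputable def tensorComplex (X : CochainComplex (ModuleCat.{u} A) ℤ)
    (Y : CochainComplex (ModuleCat.{u} B) ℤ) : CochainComplex (ModuleCat.{u} (A ⊗[k] B)) ℤ :=
  CochainComplex.mapBifunctor X Y (tensorBifunctor k A B)

end TensorModule

/-! ### The componentwise tensor product matrix algebra -/

section CompTensor

variable (k : Type*) [CommRing k] {C D : Type*} [Category* C] [Category* D]
  [Preadditive C] [Preadditive D] [Linear k C] [Linear k D] {ι : Type*}

/-- Matrices whose `(i, j)`-entry lies in `Hom(X j, X i) ⊗[k] Hom(Y j, Y i)`. -/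
def CompTensorMatrix (X : ι → C) (Y : ι → D) : Type _ :=
  ∀ i j : ι, (X j ⟶ X i) ⊗[k] (Y j ⟶ Y i)

/-- The multiplication of entries given by composition,
`(f ⊗ g) · (f' ⊗ g') = (f ∘ f') ⊗ (g ∘ g')`. -/
noncomputable def compTensorMul {X₁ X₂ X₃ : C} {Y₁ Y₂ Y₃ : D} :
    (X₂ ⟶ X₁) ⊗[k] (Y₂ ⟶ Y₁) →ₗ[k] (X₃ ⟶ X₂) ⊗[k] (Y₃ ⟶ Y₂) →ₗ[k] (X₃ ⟶ X₁) ⊗[k] (Y₃ ⟶ Y₁) :=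
  TensorProduct.map₂ (Linear.comp X₃ X₂ X₁).flip (Linear.comp Y₃ Y₂ Y₁).flip

theorem compTensorMul_tmul {X₁ X₂ X₃ : C} {Y₁ Y₂ Y₃ : D} (f : X₂ ⟶ X₁) (g : Y₂ ⟶ Y₁)
    (f' : X₃ ⟶ X₂) (g' : Y₃ ⟶ Y₂) :
    compTensorMul k (f ⊗ₜ[k] g) (f' ⊗ₜ[k] g') = (f' ≫ f) ⊗ₜ[k] (g' ≫ g) := rfl

theorem compTensorMul_assoc {X₁ X₂ X₃ X₄ : C} {Y₁ Y₂ Y₃ Y₄ : D}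
    (a : (X₂ ⟶ X₁) ⊗[k] (Y₂ ⟶ Y₁)) (b : (X₃ ⟶ X₂) ⊗[k] (Y₃ ⟶ Y₂))
    (c : (X₄ ⟶ X₃) ⊗[k] (Y₄ ⟶ Y₃)) :
    compTensorMul k (compTensorMul k a b) c = compTensorMul k a (compTensorMul k b c) := by
  induction a with
  | zero => simp
  | add a₁ a₂ h₁ h₂ => simp only [map_add, LinearMap.add_apply, h₁, h₂]
  | tmul f g =>
    induction b with
    | zero => simp
    | add b₁ b₂ h₁ h₂ => simp only [map_add, LinearMap.add_apply, h₁, h₂]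
    | tmul f' g' =>
      induction c with
      | zero => simp
      | add c₁ c₂ h₁ h₂ => simp only [map_add, h₁, h₂]
      | tmul f'' g'' => simp only [compTensorMul_tmul, Category.assoc]

theorem one_compTensorMul {X₁ X₂ : C} {Y₁ Y₂ : D} (a : (X₂ ⟶ X₁) ⊗[k] (Y₂ ⟶ Y₁)) :
    compTensorMul k (𝟙 X₁ ⊗ₜ[k] 𝟙 Y₁) a = a := by
  induction a with
  | zero => simp
  | add a₁ a₂ h₁ h₂ => rw [map_add, h₁, h₂]
  | tmul f g => simp only [compTensorMul_tmul, Category.comp_id]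

theorem compTensorMul_one {X₁ X₂ : C} {Y₁ Y₂ : D} (a : (X₂ ⟶ X₁) ⊗[k] (Y₂ ⟶ Y₁)) :
    compTensorMul k a (𝟙 X₂ ⊗ₜ[k] 𝟙 Y₂) = a := by
  induction a with
  | zero => simp
  | add a₁ a₂ h₁ h₂ => rw [map_add, LinearMap.add_apply, h₁, h₂]
  | tmul f g => simp only [compTensorMul_tmul, Category.id_comp]

namespace CompTensorMatrix

variable (X : ι → C) (Y : ι → D)

noncomputable instance : AddCommGroup (CompTensorMatrix k X Y) :=
  inferInstanceAs (AddCommGroup (∀ i j : ι, (X j ⟶ X i) ⊗[k] (Y j ⟶ Y i)))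

noncomputable instance : Module k (CompTensorMatrix k X Y) :=
  inferInstanceAs (Module k (∀ i j : ι, (X j ⟶ X i) ⊗[k] (Y j ⟶ Y i)))

/-- The matrix whose `(i, i)`-entry is `1 ⊗ 1` and whose other entries are zero. -/
noncomputable def diagUnit [DecidableEq ι] (i : ι) : CompTensorMatrix k X Y :=
  Pi.single i (Pi.single i (𝟙 (X i) ⊗ₜ[k] 𝟙 (Y i)))

/-- Matrix multiplication `(a * b) i l = ∑ j, (a i j) · (b j l)`. -/
noncomputable instance [Fintype ι] : Mul (CompTensorMatrix k X Y) where
  mul a b := fun i l => ∑ j, compTensorMul k (a i j) (b j l)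

/-- The identity matrix, with diagonal entries `1 ⊗ 1`. -/
noncomputable instance [DecidableEq ι] : One (CompTensorMatrix k X Y) where
  one := fun i => Pi.single i (𝟙 (X i) ⊗ₜ[k] 𝟙 (Y i))

theorem mul_apply [Fintype ι] (a b : CompTensorMatrix k X Y) (i l : ι) :
    (a * b) i l = ∑ j, compTensorMul k (a i j) (b j l) := rfl

theorem one_apply_same [DecidableEq ι] (i : ι) :
    (1 : CompTensorMatrix k X Y) i i = 𝟙 (X i) ⊗ₜ[k] 𝟙 (Y i) := Pi.single_eq_same _ _

theorem one_apply_ne [DecidableEq ι] {i j : ι} (h : j ≠ i) : (1 : CompTensorMatrix k X Y) i j = 0 :=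
  Pi.single_eq_of_ne h _

theorem add_apply (a b : CompTensorMatrix k X Y) (i j : ι) : (a + b) i j = a i j + b i j := rfl

theorem zero_apply (i j : ι) : (0 : CompTensorMatrix k X Y) i j = 0 := rfl

theorem smul_apply (s : k) (a : CompTensorMatrix k X Y) (i j : ι) : (s • a) i j = s • a i j := rfl

noncomputable instance [Fintype ι] [DecidableEq ι] : Ring (CompTensorMatrix k X Y) :=
  { (inferInstance : AddCommGroup (CompTensorMatrix k X Y)),
    (inferInstance : Mul (CompTensorMatrix k X Y)),
    (inferInstance : One (CompTensorMatrix k X Y)) with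
    left_distrib := fun a b c => by
      funext i l
      simp only [mul_apply, add_apply, map_add, Finset.sum_add_distrib]
    right_distrib := fun a b c => by
      funext i l
      simp only [mul_apply, add_apply, map_add, LinearMap.add_apply, Finset.sum_add_distrib]
    zero_mul := fun a => by
      funext i l
      simp only [mul_apply, zero_apply, map_zero, LinearMap.zero_apply, Finset.sum_const_zero]
    mul_zero := fun a => by
      funext i l
      simp only [mul_apply, zero_apply, map_zero, Finset.sum_const_zero]
    mul_assoc := fun a b c => by
      funext i l
      simp only [mul_apply, map_sum, LinearMap.sum_apply]
      rw [Finset.sum_comm]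
      simp only [compTensorMul_assoc]
    one_mul := fun a => by
      funext i l
      rw [mul_apply, Finset.sum_eq_single i, one_apply_same, one_compTensorMul]
      · intro j _ h
        rw [one_apply_ne k X Y h, map_zero, LinearMap.zero_apply]
      · intro h
        exact absurd (Finset.mem_univ i) h
    mul_one := fun a => by
      funext i l
      rw [mul_apply, Finset.sum_eq_single l, one_apply_same, compTensorMul_one]
      · intro j _ h
        rw [one_apply_ne k X Y h.symm, map_zero]
      · intro h
        exact absurd (Finset.mem_univ l) h
    zsmul := fun n a => n • a
    neg_add_cancel := fun a => neg_add_cancel a }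

noncomputable instance [Fintype ι] [DecidableEq ι] : Algebra k (CompTensorMatrix k X Y) :=
  Algebra.ofModule
    (fun s a b => by
      funext i l
      simp only [mul_apply, smul_apply, map_smul, LinearMap.smul_apply, Finset.smul_sum])
    (fun s a b => by
      funext i l
      simp only [mul_apply, smul_apply, map_smul, Finset.smul_sum])

end CompTensorMatrix

end CompTensor

end TensorTilting

/-! Each `U i` is a direct summand of a perfect object, hence isomorphic in `D(B)` to a bounded
complex `P i` of finitely generated projective `B`-modules. Replacing `U i` by `P i` does not change
`T i ⊗ U i` in `D(A ⊗ B)`: the cone of a quasi-isomorphism `P i ⟶ U i` is acyclic, bounded above and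
has `k`-projective terms, so it is contractible over `k`, and its tensor product with any complex is
acyclic (`isIso_Q_map_tensor`). One may therefore work with the triangulated functors `- ⊗ P i :
D(A) ⥤ D(A ⊗ B)` (`mapDerivedCategory₁`).

The heart is a Künneth formula (`compareHom_tensorTrans_bijective`). Let `P`, `L` be bounded
complexes of finitely generated projectives with `Hom(P, L[r]) = 0` for `r ≠ 0` and `Hom(P, L)`
projective over `k`. Then `Hom(X, W) ⊗ Hom(P, L) ⟶ Hom(X ⊗ P, W ⊗ L)` is bijective for perfect `X`,
`W`. Since `Hom(P, L)` is flat, the five lemma makes the locus of bijectivity thick in either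
variable, which reduces to `X = W = A` (`compareHom_bijective`). There the Hom complex from `A ⊗ P`
to `A ⊗ L` is `End(A) ⊗ Hom•(P, L)`. The algebra `A` need not be flat over `k`, so flatness cannot
be used to compute its cohomology. Instead, `Hom•(P, L)` is bounded above with `k`-projective terms
and cohomology, so by descending induction every differential `d` admits `t` with `d t d = d`
(`exists_quasiInverse`), and then cohomology commutes with any tensor product
(`tensor_cohomology_bijective`).

Consequently `Hom(V j, V i[r])` is `Hom(T j, T i[r]) ⊗ Hom(U j, U i)`, where `V i = T i ⊗ U i`. For
`r ≠ 0` one of the factors vanishes by hypothesis. For `r = 0` these are the matrix entries, and the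
comparison maps respect composition, which gives the endomorphism algebra.

For generation, the perfect objects of `D(R)` are the thick subcategory generated by `R`
(`isPerfect_iff_triangEnvelope`); this uses that direct summands of perfect objects are perfect
(`isPerfect_of_retract`). The objects `X` with `X ⊗ P i` in the thick subcategory of `V` form a
thick subcategory containing the tilting complex `T i`, hence `A`. So `A ⊗ P i` lies there for all
`i`. The perfect `Y` with `A ⊗ Y` there form a thick subcategory containing all `P i`, hence `U`,
hence `B`. Thus `A ⊗ B` is reached (`isTilting_of_bicone`). -/

namespace TensorTilting

/-! ### Cones and retracts in a triangulated category. -/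

section RetractCone

open Pretriangulated

variable {C : Type*} [Category* C] [HasZeroObject C] [HasShift C ℤ] [Preadditive C]
  [∀ n : ℤ, (shiftFunctor C n).Additive] [Pretriangulated C] [IsTriangulated C]

/-- If `X` is a retract of an extension `P` of `P'` by `E`, then the cone of the induced map
`E ⟶ X` is a retract of the cone of some map `E ⟶ P'`. -/
theorem exists_retract_cone {E P P' : C} {j : E ⟶ P} {q : P ⟶ P'} {w : P' ⟶ E⟦(1 : ℤ)⟧}
    (hT : Triangle.mk j q w ∈ distTriang C) {X : C} (r : Retract X P) :
    ∃ (v : E ⟶ P') (D : C) (f : P' ⟶ D) (g : D ⟶ E⟦(1 : ℤ)⟧)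
      (Z : C) (f' : X ⟶ Z) (g' : Z ⟶ E⟦(1 : ℤ)⟧),
      Triangle.mk v f g ∈ distTriang C ∧ Triangle.mk (j ≫ r.r) f' g' ∈ distTriang C ∧
      Nonempty (Retract Z D) := by
  have : HasBinaryBiproducts C := hasBinaryBiproducts_of_finite_biproducts C
  -- With `e = r.r ≫ r.i`, the second component `j ≫ (1 - e)` is killed by `r.r`, so `W` restricts
  -- to `j ≫ r.r` under `r.r`. The octahedron on `inl ≫ W = j` shows that the cone of `W` is also
  -- the cone of a map `E ⟶ P'`.
  let W : E ⊞ E ⟶ P := biprod.desc j (j ≫ (𝟙 P - r.r ≫ r.i))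
  obtain ⟨D, a, b, hD⟩ := distinguished_cocone_triangle W
  obtain ⟨Z, f', g', hZ⟩ := distinguished_cocone_triangle (j ≫ r.r)
  let O := Triangulated.someOctahedron (show biprod.inl ≫ W = j by simp [W])
    (binaryBiproductTriangle_distinguished E E) hD hT
  refine ⟨O.m₁, D, O.m₃, _, Z, f', g', O.mem, hZ, ?_⟩
  obtain ⟨c₁, hc₁, hc₁'⟩ : ∃ c₁ : Z ⟶ D, f' ≫ c₁ = r.i ≫ a ∧
      g' ≫ (biprod.lift (𝟙 E) (-𝟙 E))⟦(1 : ℤ)⟧' = c₁ ≫ b :=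
    complete_distinguished_triangle_morphism _ _ hZ hD (biprod.lift (𝟙 E) (-𝟙 E)) r.i
      (by
        change (j ≫ r.r) ≫ r.i = biprod.lift (𝟙 E) (-𝟙 E) ≫ W
        simp [W, biprod.lift_desc])
  obtain ⟨c₂, hc₂, hc₂'⟩ : ∃ c₂ : D ⟶ Z, a ≫ c₂ = r.r ≫ f' ∧
      b ≫ (biprod.fst : E ⊞ E ⟶ E)⟦(1 : ℤ)⟧' = c₂ ≫ g' :=
    complete_distinguished_triangle_morphism _ _ hD hZ (biprod.fst : E ⊞ E ⟶ E) r.r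
      (by
        change W ≫ r.r = biprod.fst ≫ j ≫ r.r
        ext <;> simp [W])
  -- Fill-ins of triangles are not unique, so `c₁ ≫ c₂` need not be the identity. It is an
  -- isomorphism because it is part of an endomorphism of a triangle which is the identity on the
  -- other two vertices; `c₂` is then corrected by its inverse.
  have : IsIso (c₁ ≫ c₂) := by
    let φ : Triangle.mk (j ≫ r.r) f' g' ⟶ Triangle.mk (j ≫ r.r) f' g' :=
      { hom₁ := 𝟙 _
        hom₂ := 𝟙 _
        hom₃ := c₁ ≫ c₂
        comm₁ := by
          change (j ≫ r.r) ≫ 𝟙 _ = 𝟙 _ ≫ j ≫ r.r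
          simp
        comm₂ := by
          change f' ≫ c₁ ≫ c₂ = 𝟙 _ ≫ f'
          rw [reassoc_of% hc₁, hc₂, r.retract_assoc, Category.id_comp]
        comm₃ := by
          change g' ≫ (𝟙 _)⟦(1 : ℤ)⟧' = (c₁ ≫ c₂) ≫ g'
          rw [Category.assoc, ← hc₂', ← reassoc_of% hc₁', ← Functor.map_comp, biprod.lift_fst] }
    exact isIso₃_of_isIso₁₂ φ hZ hZ (inferInstanceAs (IsIso (𝟙 _))) (inferInstanceAs (IsIso (𝟙 _)))
  exact ⟨{
    i := c₁
    r := c₂ ≫ inv (c₁ ≫ c₂)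
    retract := by rw [← Category.assoc, IsIso.hom_inv_id] }⟩

end RetractCone

/-! ### Splitting off the top term of a complex. -/

section BrutalTruncation

variable {R : Type u} [Ring R] (K : CochainComplex (ModuleCat.{u} R) ℤ) (b : ℤ)

/-- The quotient complex of `K` obtained by discarding the terms of degree `≥ b`. -/
noncomputable def truncLT : CochainComplex (ModuleCat.{u} R) ℤ where
  -- Functions on a proposition: a copy of `K.X n` if `n < b` and a zero module otherwise, without a
  -- case distinction between types.
  X n := ModuleCat.of R (PLift (n < b) → K.X n)
  d m n := ModuleCat.ofHom
    { toFun := fun f h => if h' : m + 1 = n then K.d m n (f ⟨by have := h.down; lia⟩) else 0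
      map_add' := fun f g => by ext h; dsimp; split_ifs <;> simp
      map_smul' := fun f g => by ext h; dsimp; split_ifs <;> simp }
  shape m n h := ModuleCat.hom_ext (LinearMap.ext fun _ => funext fun _ => dif_neg h)
  d_comp_d' i j l hij hjl := by
    obtain rfl : i + 1 = j := hij
    obtain rfl : i + 1 + 1 = l := hjl
    refine ModuleCat.hom_ext (LinearMap.ext fun f => funext fun h => ?_)
    refine (dif_pos rfl).trans ((congrArg (K.d _ _) (dif_pos rfl)).trans ?_)
    rw [← ConcreteCategory.comp_apply, K.d_comp_d]
    rfl

/-- The projection onto the brutal truncation. -/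
noncomputable def πTruncLT : K ⟶ truncLT K b where
  f _ := ModuleCat.ofHom
    { toFun := fun x _ => x
      map_add' := fun _ _ => rfl
      map_smul' := fun _ _ => rfl }
  comm' _ _ h := ModuleCat.hom_ext (LinearMap.ext fun _ => funext fun _ => dif_pos h)

/-- The section of `πTruncLT` in a given degree. -/
noncomputable def sTruncLT (n : ℤ) : (truncLT K b).X n ⟶ K.X n :=
  ModuleCat.ofHom (X := PLift (n < b) → K.X n)
    { toFun := fun f => if h : n < b then f ⟨h⟩ else 0
      map_add' := fun f g => by
        by_cases h : n < b <;> simp [h]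
      map_smul' := fun c f => by
        by_cases h : n < b <;> simp [h] }

/-- The inclusion of the term of degree `b` in a complex with no terms of degree `> b`. -/
noncomputable def singleToSelf [K.IsStrictlyLE b] :
    (HomologicalComplex.single (ModuleCat.{u} R) (ComplexShape.up ℤ) b).obj (K.X b) ⟶ K :=
  HomologicalComplex.mkHomFromSingle (𝟙 _) fun k hk =>
    (K.isZero_of_isStrictlyLE b k (by obtain rfl : b + 1 = k := hk; lia)).eq_of_tgt _ _

/-- The short complex `K^b[-b] ⟶ K ⟶ K^{< b}`. -/
noncomputable def truncShortComplex [K.IsStrictlyLE b] :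
    ShortComplex (CochainComplex (ModuleCat.{u} R) ℤ) where
  f := singleToSelf K b
  g := πTruncLT K b
  zero := by
    refine HomologicalComplex.hom_ext _ _ fun n => ?_
    by_cases h : n = b
    · exact ModuleCat.hom_ext (LinearMap.ext fun _ => funext fun h' => absurd h'.down (by lia))
    · exact (HomologicalComplex.isZero_single_obj_X _ _ _ _ h).eq_of_src _ _

theorem subsingleton_truncLT_X {n : ℤ} (h : b ≤ n) : Subsingleton ((truncLT K b).X n) :=
  ⟨fun f g => funext fun h' => absurd h'.down (by lia)⟩

/-- The retraction of `singleToSelf` in a given degree. -/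
noncomputable def rTruncLT (n : ℤ) : K.X n ⟶
    ((HomologicalComplex.single (ModuleCat.{u} R) (ComplexShape.up ℤ) b).obj (K.X b)).X n :=
  if h : n = b then (K.XIsoOfEq h).hom ≫
    (HomologicalComplex.singleObjXIsoOfEq (ComplexShape.up ℤ) b (K.X b) n h).inv else 0

theorem singleToSelf_f_rTruncLT [K.IsStrictlyLE b] (n : ℤ) :
    (singleToSelf K b).f n ≫ rTruncLT K b n = 𝟙 _ := by
  by_cases h : n = b
  · subst h
    simp [singleToSelf, HomologicalComplex.singleObjXSelf, rTruncLT]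
  · exact (HomologicalComplex.isZero_single_obj_X _ _ _ _ h).eq_of_src _ _

theorem rTruncLT_add_sTruncLT [K.IsStrictlyLE b] (n : ℤ) :
    rTruncLT K b n ≫ (singleToSelf K b).f n + (πTruncLT K b).f n ≫ sTruncLT K b n = 𝟙 _ := by
  rcases lt_trichotomy n b with h | h | h
  · rw [rTruncLT, dif_neg h.ne, zero_comp, zero_add]
    exact ModuleCat.hom_ext (LinearMap.ext fun x => dif_pos h)
  · subst h
    have h2 : (πTruncLT K n).f n = 0 :=
      ModuleCat.hom_ext (LinearMap.ext fun x => (subsingleton_truncLT_X K n le_rfl).elim _ _)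
    rw [h2, zero_comp, add_zero]
    simp [singleToSelf, HomologicalComplex.singleObjXSelf, rTruncLT]
  · exact (K.isZero_of_isStrictlyLE b n h).eq_of_src _ _

/-- The sequence `K^b[-b] ⟶ K ⟶ K^{< b}` is degreewise split. -/
noncomputable def truncShortComplexSplitting [K.IsStrictlyLE b] (n : ℤ) :
    ((truncShortComplex K b).map (HomologicalComplex.eval _ _ n)).Splitting where
  r := rTruncLT K b n
  s := sTruncLT K b n
  f_r := singleToSelf_f_rTruncLT K b n
  s_g := ModuleCat.hom_ext (LinearMap.ext fun _ => funext fun h => dif_pos h.down)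
  id := rTruncLT_add_sTruncLT K b n

theorem nonempty_iso_truncLT_X {i : ℤ} (hi : i < b) : Nonempty (K.X i ≅ (truncLT K b).X i) :=
  ⟨{  hom := (πTruncLT K b).f i
      inv := sTruncLT K b i
      hom_inv_id := ModuleCat.hom_ext (LinearMap.ext fun _ => dif_pos hi)
      inv_hom_id := ModuleCat.hom_ext
        (LinearMap.ext fun _ => funext fun h => dif_pos h.down) }⟩

theorem isStrictlyLE_truncLT {c : ℤ} (hc : b ≤ c + 1) : (truncLT K b).IsStrictlyLE c := by
  rw [CochainComplex.isStrictlyLE_iff]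
  intro i hi
  have := subsingleton_truncLT_X K b (n := i) (by lia)
  exact ModuleCat.isZero_of_subsingleton _

theorem isStrictlyGE_truncLT (c : ℤ) [K.IsStrictlyGE c] : (truncLT K b).IsStrictlyGE c := by
  rw [CochainComplex.isStrictlyGE_iff]
  intro i hi
  by_cases hi' : i < b
  · exact (K.isZero_of_isStrictlyGE c i).of_iso (nonempty_iso_truncLT_X K b hi').some.symm
  · have := subsingleton_truncLT_X K b (n := i) (by lia)
    exact ModuleCat.isZero_of_subsingleton _

open Pretriangulated in
theorem truncTriangle_distinguished [K.IsStrictlyLE b] :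
    CochainComplex.trianglehOfDegreewiseSplit _ (truncShortComplexSplitting K b) ∈
      distTriang (HomotopyCategory (ModuleCat.{u} R) (ComplexShape.up ℤ)) :=
  (HomotopyCategory.distinguished_iff_iso_trianglehOfDegreewiseSplit _).2
    ⟨_, _, ⟨Iso.refl _⟩⟩

end BrutalTruncation

/-! ### Dévissage of bounded complexes to single modules. -/

section Devissage

open Pretriangulated

variable {R : Type u} [Ring R]

theorem single_mem_of_single_zero_mem
    (S : ObjectProperty (HomotopyCategory (ModuleCat.{u} R) (ComplexShape.up ℤ)))
    [S.IsStableUnderShift ℤ] [S.IsClosedUnderIsomorphisms] (M : ModuleCat.{u} R)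
    (hM : S ((HomotopyCategory.singleFunctor (ModuleCat.{u} R) 0).obj M)) (b : ℤ) :
    S ((HomotopyCategory.singleFunctor (ModuleCat.{u} R) b).obj M) :=
  S.prop_of_iso (((HomotopyCategory.singleFunctors (ModuleCat.{u} R)).shiftIso (-b) b 0
    (neg_add_cancel b)).app M) (S.le_shift (-b) _ hM)

/-- A bounded complex is an iterated extension of its terms: split off the top one and induct on the
length. The conditions on isomorphisms and zero objects are needed because the terms of the
truncation are only isomorphic to those of `K`, or zero. -/
theorem quotient_obj_mem_of_forall_single_mem
    (S : ObjectProperty (HomotopyCategory (ModuleCat.{u} R) (ComplexShape.up ℤ)))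
    [S.IsTriangulated] [S.IsClosedUnderIsomorphisms] (Φ : ModuleCat.{u} R → Prop)
    (hΦ : ∀ M, Φ M → S ((HomotopyCategory.singleFunctor (ModuleCat.{u} R) 0).obj M))
    (hΦ₀ : ∀ M N : ModuleCat.{u} R, (M ≅ N) → Φ M → Φ N) (h0 : ∀ M, IsZero M → Φ M)
    (K : CochainComplex (ModuleCat.{u} R) ℤ) (a b : ℤ) [K.IsStrictlyGE a] [K.IsStrictlyLE b]
    (hK : ∀ n, Φ (K.X n)) :
    S ((HomotopyCategory.quotient _ _).obj K) := by
  -- The number `n` bounds the length: the complex lives in degrees `[b + 1 - n, b]`, which is empty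
  -- for `n = 0`.
  obtain ⟨n, hn⟩ : ∃ n : ℕ, b + 1 - n ≤ a := ⟨(b + 1 - a).toNat, by lia⟩
  have := K.isStrictlyGE_of_ge _ _ hn
  clear hn
  induction n generalizing K b with
  | zero =>
    refine S.prop_of_isZero ?_
    rw [HomotopyCategory.isZero_quotient_obj_iff]
    refine ⟨Homotopy.ofEq (HomologicalComplex.hom_ext _ _ fun i => ?_)⟩
    by_cases hi : b < i
    · exact (K.isZero_of_isStrictlyLE b i).eq_of_src _ _
    · exact (K.isZero_of_isStrictlyGE (b + 1 - (0 : ℕ)) i (by push_cast; lia)).eq_of_src _ _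
  | succ n ih =>
    have := isStrictlyLE_truncLT K b (c := b - 1) (by lia)
    have := isStrictlyGE_truncLT K b a
    have h1 : b - 1 + 1 - n = b + 1 - (n + 1 : ℕ) := by push_cast; lia
    have h2 := h1 ▸ isStrictlyGE_truncLT K b (b + 1 - (n + 1 : ℕ))
    refine S.ext_of_isTriangulatedClosed₂ _ (truncTriangle_distinguished K b) ?_ ?_
    · exact single_mem_of_single_zero_mem S _ (hΦ _ (hK b)) b
    · refine ih (truncLT K b) (b - 1) (fun i => ?_) h2
      by_cases hi' : i < b
      · exact hΦ₀ _ _ (nonempty_iso_truncLT_X K b hi').some (hK i)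
      · have := subsingleton_truncLT_X K b (n := i) (by lia)
        exact h0 _ (ModuleCat.isZero_of_subsingleton _)

end Devissage

/-! ### Perfect objects form a triangulated subcategory. -/

section Perfect

open Pretriangulated

variable {R : Type u} [Ring R]

/-- A complex of finitely generated projective modules concentrated in degrees `[a, b]`. -/
structure IsFGProjIcc (P : CochainComplex (ModuleCat.{u} R) ℤ) (a b : ℤ) : Prop where
  ge : P.IsStrictlyGE a
  le : P.IsStrictlyLE b
  finite (m : ℤ) : Module.Finite R (P.X m)
  projective (m : ℤ) : Module.Projective R (P.X m)

theorem IsFGProjIcc.isKProjective {P : CochainComplex (ModuleCat.{u} R) ℤ} {a b : ℤ}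
    (h : IsFGProjIcc P a b) : P.IsKProjective := by
  have := h.le
  have (n : ℤ) : Projective (P.X n) := by
    have := h.projective n
    exact (IsProjective.iff_projective (P.X n)).1 this
  exact CochainComplex.isKProjective_of_projective P b

theorem IsFGProjIcc.mappingCone {P Q : CochainComplex (ModuleCat.{u} R) ℤ} {a b a' b' c d : ℤ}
    (hP : IsFGProjIcc P a b) (hQ : IsFGProjIcc Q a' b') (f : P ⟶ Q)
    (h₁ : c ≤ a - 1) (h₂ : c ≤ a') (h₃ : b - 1 ≤ d) (h₄ : b' ≤ d) :
    IsFGProjIcc (CochainComplex.mappingCone f) c d := by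
  have := hP.ge
  have := hP.le
  have := hQ.ge
  have := hQ.le
  -- In each degree the cone is a direct summand of `P.X (m + 1) × Q.X m`, so it inherits finiteness
  -- and projectivity.
  have hsplit (m : ℤ) : ∃ (s : (CochainComplex.mappingCone f).X m →ₗ[R] P.X (m + 1) × Q.X m)
      (p : (P.X (m + 1) × Q.X m) →ₗ[R] (CochainComplex.mappingCone f).X m), p ∘ₗ s = .id := by
    refine ⟨((CochainComplex.mappingCone.fst f).1.v m (m + 1) rfl).hom.prod
      ((CochainComplex.mappingCone.snd f).v m m (add_zero m)).hom,
      ((CochainComplex.mappingCone.inl f).v (m + 1) m (by lia)).hom.coprod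
      ((CochainComplex.mappingCone.inr f).f m).hom, ?_⟩
    have := congrArg ModuleCat.Hom.hom (CochainComplex.mappingCone.id_X f m (m + 1) rfl)
    ext x
    exact LinearMap.congr_fun this x
  refine ⟨?_, ?_, fun m => ?_, fun m => ?_⟩
  · rw [CochainComplex.isStrictlyGE_iff]
    intro i hi
    rw [CochainComplex.mappingCone.isZero_X_iff]
    exact ⟨P.isZero_of_isStrictlyGE a _, Q.isZero_of_isStrictlyGE a' _⟩
  · rw [CochainComplex.isStrictlyLE_iff]
    intro i hi
    rw [CochainComplex.mappingCone.isZero_X_iff]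
    exact ⟨P.isZero_of_isStrictlyLE b _, Q.isZero_of_isStrictlyLE b' _⟩
  · obtain ⟨s, p, h⟩ := hsplit m
    have := hP.finite (m + 1)
    have := hQ.finite m
    exact Module.Finite.of_surjective p (LinearMap.surjective_of_comp_eq_id _ _ h)
  · obtain ⟨s, p, h⟩ := hsplit m
    have := hP.projective (m + 1)
    have := hQ.projective m
    exact Module.Projective.of_split s p h

theorem IsFGProjIcc.shift {P : CochainComplex (ModuleCat.{u} R) ℤ} {a b : ℤ}
    (hP : IsFGProjIcc P a b) (n : ℤ) : IsFGProjIcc (P⟦n⟧) (a - n) (b - n) := by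
  have := hP.ge
  have := hP.le
  exact ⟨P.isStrictlyGE_shift a n _ (by lia), P.isStrictlyLE_shift b n _ (by lia),
    fun m => hP.finite (m + n), fun m => hP.projective (m + n)⟩

theorem IsFGProjIcc.of_linearEquiv_X {P Q : CochainComplex (ModuleCat.{u} R) ℤ} {a b a' b' : ℤ}
    (hP : IsFGProjIcc P a b) (hge : Q.IsStrictlyGE a') (hle : Q.IsStrictlyLE b')
    (h : ∀ i, IsZero (Q.X i) ∨ Nonempty (P.X i ≅ Q.X i)) :
    IsFGProjIcc Q a' b' := by
  refine ⟨hge, hle, fun m => ?_, fun m => ?_⟩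
  · obtain h | ⟨⟨e⟩⟩ := h m
    · have := ModuleCat.subsingleton_of_isZero h
      infer_instance
    · have := hP.finite m
      exact Module.Finite.equiv e.toLinearEquiv
  · obtain h | ⟨⟨e⟩⟩ := h m
    · have := ModuleCat.subsingleton_of_isZero h
      infer_instance
    · have := hP.projective m
      exact Module.Projective.of_equiv e.toLinearEquiv

theorem isFGProjIcc_single (M : ModuleCat.{u} R) [Module.Finite R M] [Module.Projective R M]
    (b : ℤ) : IsFGProjIcc
      ((HomologicalComplex.single (ModuleCat.{u} R) (ComplexShape.up ℤ) b).obj M) b b := by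
  refine ⟨?_, ?_, fun m => ?_, fun m => ?_⟩
  · rw [CochainComplex.isStrictlyGE_iff]
    intro i hi
    exact HomologicalComplex.isZero_single_obj_X _ _ _ _ (by lia)
  · rw [CochainComplex.isStrictlyLE_iff]
    intro i hi
    exact HomologicalComplex.isZero_single_obj_X _ _ _ _ (by lia)
  · by_cases h : m = b
    · exact Module.Finite.equiv
        (HomologicalComplex.singleObjXIsoOfEq (ComplexShape.up ℤ) b M m h).symm.toLinearEquiv
    · have := ModuleCat.subsingleton_of_isZero
        (HomologicalComplex.isZero_single_obj_X (ComplexShape.up ℤ) b M m h)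
      infer_instance
  · by_cases h : m = b
    · exact Module.Projective.of_equiv
        (HomologicalComplex.singleObjXIsoOfEq (ComplexShape.up ℤ) b M m h).symm.toLinearEquiv
    · have := ModuleCat.subsingleton_of_isZero
        (HomologicalComplex.isZero_single_obj_X (ComplexShape.up ℤ) b M m h)
      infer_instance

variable [HasDerivedCategory.{w₁} (ModuleCat.{u} R)]

/-- Morphisms in the derived category out of a K-projective complex are homotopy classes of chain
maps. This and `homotopy_of_Q_map_eq` are the two halves used to lift morphisms and relations to
complexes. -/
theorem Q_map_surjective (P L : CochainComplex (ModuleCat.{u} R) ℤ) [P.IsKProjective]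
    (f : DerivedCategory.Q.obj P ⟶ DerivedCategory.Q.obj L) :
    ∃ g : P ⟶ L, DerivedCategory.Q.map g = f := by
  obtain ⟨g, rfl⟩ := (CochainComplex.IsKProjective.Qh_map_bijective P
    ((HomotopyCategory.quotient _ _).obj L)).2 f
  obtain ⟨g, rfl⟩ := (HomotopyCategory.quotient _ _).map_surjective g
  exact ⟨g, rfl⟩

theorem homotopy_of_Q_map_eq {P L : CochainComplex (ModuleCat.{u} R) ℤ} [P.IsKProjective]
    {f g : P ⟶ L} (h : DerivedCategory.Q.map f = DerivedCategory.Q.map g) :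
    Nonempty (Homotopy f g) :=
  ⟨HomotopyCategory.homotopyOfEq _ _ ((CochainComplex.IsKProjective.Qh_map_bijective P
    ((HomotopyCategory.quotient _ _).obj L)).1 h)⟩

/-- Being isomorphic to a complex of finitely generated projective modules in degrees `[a, b]`. -/
def IsPerfectIcc (X : DerivedCategory (ModuleCat.{u} R)) (a b : ℤ) : Prop :=
  ∃ P, IsFGProjIcc P a b ∧ Nonempty (X ≅ DerivedCategory.Q.obj P)

theorem isPerfect_iff {X : DerivedCategory (ModuleCat.{u} R)} :
    IsPerfect X ↔ ∃ a b, IsPerfectIcc X a b := by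
  constructor
  · rintro ⟨P, ⟨a, ha⟩, ⟨b, hb⟩, h, e⟩
    exact ⟨a, b, P, ⟨ha, hb, fun m => (h m).1, fun m => (h m).2⟩, e⟩
  · rintro ⟨a, b, P, h, e⟩
    exact ⟨P, ⟨a, h.ge⟩, ⟨b, h.le⟩, fun m => ⟨h.finite m, h.projective m⟩, e⟩

theorem IsPerfectIcc.of_iso {X Y : DerivedCategory (ModuleCat.{u} R)} {a b : ℤ}
    (h : IsPerfectIcc X a b) (e : X ≅ Y) : IsPerfectIcc Y a b := by
  obtain ⟨P, hP, ⟨e'⟩⟩ := h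
  exact ⟨P, hP, ⟨e.symm ≪≫ e'⟩⟩

/-- The first morphism lifts to a chain map because `P` is K-projective, and the third vertex of a
triangle is determined by the first morphism up to isomorphism. -/
theorem exists_iso_mappingCone (T : Triangle (DerivedCategory (ModuleCat.{u} R)))
    (hT : T ∈ distTriang _) {P L : CochainComplex (ModuleCat.{u} R) ℤ} [P.IsKProjective]
    (e₁ : T.obj₁ ≅ DerivedCategory.Q.obj P) (e₂ : T.obj₂ ≅ DerivedCategory.Q.obj L) :
    ∃ f : P ⟶ L, Nonempty (T.obj₃ ≅ DerivedCategory.Q.obj (CochainComplex.mappingCone f)) := by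
  obtain ⟨f, hf⟩ := Q_map_surjective P L (e₁.inv ≫ T.mor₁ ≫ e₂.hom)
  exact ⟨f, ⟨Triangle.π₃.mapIso (isoTriangleOfIso₁₂ _ _ hT
    (DerivedCategory.mappingCone_triangle_distinguished f) e₁ e₂ (by
      change _ = e₁.hom ≫ DerivedCategory.Q.map f
      rw [hf, e₁.hom_inv_id_assoc]
      rfl))⟩⟩

/-- The bounds are left free: stability under cones uses generous ones, whereas the induction on
amplitude for direct summands needs the sharp ones. -/
theorem IsPerfectIcc.cone {T : Triangle (DerivedCategory (ModuleCat.{u} R))}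
    (hT : T ∈ distTriang _) {a b a' b' c d : ℤ} (h : IsPerfectIcc T.obj₁ a b)
    (h' : IsPerfectIcc T.obj₂ a' b')
    (h₁ : c ≤ a - 1) (h₂ : c ≤ a') (h₃ : b - 1 ≤ d) (h₄ : b' ≤ d) :
    IsPerfectIcc T.obj₃ c d := by
  obtain ⟨P, hP, ⟨e⟩⟩ := h
  obtain ⟨P', hP', ⟨e'⟩⟩ := h'
  have := hP.isKProjective
  obtain ⟨f, hf⟩ := exists_iso_mappingCone T hT e e'
  exact ⟨_, hP.mappingCone hP' f h₁ h₂ h₃ h₄, hf⟩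

theorem IsPerfectIcc.shift {X : DerivedCategory (ModuleCat.{u} R)} {a b : ℤ}
    (h : IsPerfectIcc X a b) (n : ℤ) : IsPerfectIcc (X⟦n⟧) (a - n) (b - n) := by
  obtain ⟨P, hP, ⟨e⟩⟩ := h
  exact ⟨P⟦n⟧, hP.shift n, ⟨(shiftFunctor _ n).mapIso e ≪≫
    ((DerivedCategory.Q.commShiftIso n).app P).symm⟩⟩

/-- The perfect objects, as an object property. -/
abbrev perfect (R : Type u) [Ring R] [HasDerivedCategory.{w₁} (ModuleCat.{u} R)] :
    ObjectProperty (DerivedCategory (ModuleCat.{u} R)) := IsPerfect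

instance : (perfect R).IsClosedUnderIsomorphisms where
  of_iso e h := by
    obtain ⟨a, b, h⟩ := isPerfect_iff.1 h
    exact isPerfect_iff.2 ⟨a, b, h.of_iso e⟩

theorem isPerfect_singleFunctor (M : ModuleCat.{u} R) [Module.Finite R M] [Module.Projective R M]
    (b : ℤ) : IsPerfect ((DerivedCategory.singleFunctor _ b).obj M) :=
  isPerfect_iff.2 ⟨b, b, _, isFGProjIcc_single M b, ⟨Iso.refl _⟩⟩

instance : (perfect R).IsTriangulated := by
  have h0 : (perfect R).ContainsZero := ⟨_, (DerivedCategory.singleFunctor _ 0).map_isZero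
    (ModuleCat.isZero_of_subsingleton (ModuleCat.of R PUnit.{u + 1})),
      isPerfect_singleFunctor _ 0⟩
  have h1 : (perfect R).IsStableUnderShift ℤ := ⟨fun n => ⟨fun X hX => by
    obtain ⟨a, b, h⟩ := isPerfect_iff.1 hX
    exact isPerfect_iff.2 ⟨_, _, h.shift n⟩⟩⟩
  have h3 : (perfect R).IsTriangulatedClosed₃ := .mk' fun T hT h h' => by
    obtain ⟨a, b, h⟩ := isPerfect_iff.1 h
    obtain ⟨a', b', h'⟩ := isPerfect_iff.1 h'
    exact isPerfect_iff.2 ⟨min (a - 1) a', max (b - 1) b', h.cone hT h'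
      (min_le_left _ _) (min_le_right _ _) (le_max_left _ _) (le_max_right _ _)⟩
  have h2 : (perfect R).IsTriangulatedClosed₂ := .of_isTriangulatedClosed₃
  exact {}

end Perfect

/-! ### Direct summands of perfect objects; the thick subcategory generated by the ring. -/

section PerfectRetract

open Pretriangulated

variable {R : Type u} [Ring R] [HasDerivedCategory.{w₁} (ModuleCat.{u} R)]

/-- The embedding of modules in a fixed degree is fully faithful, so the idempotent cutting out `X`
comes from an idempotent `e` of `M`. The image of `e` is a finitely generated projective module
representing `X`. -/
theorem isPerfect_of_retract_singleFunctor {X : DerivedCategory (ModuleCat.{u} R)}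
    {M : ModuleCat.{u} R} [Module.Finite R M] [Module.Projective R M] {b : ℤ}
    (r : Retract X ((DerivedCategory.singleFunctor _ b).obj M)) : IsPerfect X := by
  obtain ⟨e, he⟩ := (DerivedCategory.singleFunctor (ModuleCat.{u} R) b).map_surjective (r.r ≫ r.i)
  have hee : e ≫ e = e := by
    apply (DerivedCategory.singleFunctor (ModuleCat.{u} R) b).map_injective
    rw [Functor.map_comp, he]
    simp
  let N := ModuleCat.of R (LinearMap.range e.hom)
  let p : M ⟶ N := ModuleCat.ofHom (LinearMap.rangeRestrict e.hom)
  let i : N ⟶ M := ModuleCat.ofHom (LinearMap.range e.hom).subtype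
  have hpi : p ≫ i = e := rfl
  have hip : i ≫ p = 𝟙 N := by
    refine ModuleCat.hom_ext (LinearMap.ext ?_)
    rintro ⟨_, x, rfl⟩
    exact Subtype.ext (ConcreteCategory.congr_hom hee x)
  have : Module.Finite R N := Module.Finite.of_surjective p.hom
    (LinearMap.surjective_rangeRestrict _)
  have : Module.Projective R N := Module.Projective.of_split i.hom p.hom
    (congrArg ModuleCat.Hom.hom hip)
  let F := DerivedCategory.singleFunctor (ModuleCat.{u} R) b
  have h1 : r.i ≫ F.map p ≫ F.map i ≫ r.r = 𝟙 X := by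
    rw [← F.map_comp_assoc, hpi, he]
    simp
  have h2 : (F.map i ≫ r.r) ≫ r.i ≫ F.map p = 𝟙 (F.obj N) := by
    rw [Category.assoc, ← Category.assoc r.r, ← he, ← F.map_comp, ← F.map_comp, ← hpi,
      Category.assoc, reassoc_of% hip, hip, F.map_id]
  exact (perfect R).prop_of_iso (X := F.obj N)
    { hom := F.map i ≫ r.r, inv := r.i ≫ F.map p, hom_inv_id := h2, inv_hom_id := by
        rw [Category.assoc, h1] } (isPerfect_singleFunctor N b)

/-- Induction on the amplitude. If `E` is the top term of `P`, the cone `Z` of `E ⟶ X` is by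
`exists_retract_cone` a direct summand of a perfect object of smaller amplitude, so `Z` is perfect,
and `X` is an extension of `Z` by `E`. -/
theorem isPerfect_of_retract (n : ℕ) : ∀ (b : ℤ) (X : DerivedCategory (ModuleCat.{u} R))
    (P : CochainComplex (ModuleCat.{u} R) ℤ), IsFGProjIcc P (b - n) b →
    Retract X (DerivedCategory.Q.obj P) → IsPerfect X := by
  induction n with
  | zero =>
    intro b X P hP r
    have := hP.le
    have : P.IsStrictlyGE b := by simpa using hP.ge
    obtain ⟨M, ⟨e⟩⟩ := P.exists_iso_single b
    have e' : P.X b ≅ M := (HomologicalComplex.eval _ (ComplexShape.up ℤ) b).mapIso e ≪≫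
      HomologicalComplex.singleObjXIsoOfEq (ComplexShape.up ℤ) _ _ _ rfl
    have := hP.finite b
    have := hP.projective b
    have : Module.Finite R M := Module.Finite.equiv e'.toLinearEquiv
    have : Module.Projective R M := Module.Projective.of_equiv e'.toLinearEquiv
    exact isPerfect_of_retract_singleFunctor (M := M) (b := b)
      (r.trans (Retract.ofIso (DerivedCategory.Q.mapIso e)))
  | succ n ih =>
    intro b X P hP r
    have := hP.le
    have := hP.ge
    have hT := DerivedCategory.Qh.map_distinguished _ (truncTriangle_distinguished P b)
    obtain ⟨v, D, f, g, Z, f', g', h₁, h₂, ⟨ρ⟩⟩ := exists_retract_cone (X := X) hT r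
    have := hP.finite b
    have := hP.projective b
    have hE : IsPerfectIcc ((DerivedCategory.singleFunctor _ b).obj (P.X b)) b b :=
      ⟨_, isFGProjIcc_single (P.X b) b, ⟨Iso.refl _⟩⟩
    have hP' : IsFGProjIcc (truncLT P b) (b - 1 - n) (b - 1) := by
      refine hP.of_linearEquiv_X ?_ (isStrictlyLE_truncLT P b (by lia)) fun i => ?_
      · have h1 : b - 1 - n = b - (n + 1 : ℕ) := by push_cast; lia
        exact h1 ▸ isStrictlyGE_truncLT P b (b - (n + 1 : ℕ))
      · by_cases hi' : i < b
        · exact Or.inr (nonempty_iso_truncLT_X P b hi')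
        · have := subsingleton_truncLT_X P b (n := i) (by lia)
          exact Or.inl (ModuleCat.isZero_of_subsingleton _)
    -- Taking the cone moves `E` from degree `b` to degree `b - 1`, where `truncLT P b` also ends.
    -- The amplitude therefore drops by one.
    obtain ⟨L, hL, ⟨eL⟩⟩ : IsPerfectIcc D (b - 1 - n) (b - 1) :=
      IsPerfectIcc.cone h₁ hE ⟨_, hP', ⟨Iso.refl _⟩⟩ (by lia) le_rfl le_rfl le_rfl
    exact (perfect R).ext_of_isTriangulatedClosed₂ _ h₂ (isPerfect_iff.2 ⟨_, _, hE⟩)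
      (ih _ Z L hL (ρ.trans (Retract.ofIso eL)))

instance : (perfect R).IsStableUnderRetracts where
  of_retract {X Y} r h := by
    obtain ⟨a, b, P, hP, ⟨e⟩⟩ := isPerfect_iff.1 h
    obtain ⟨n, hn⟩ : ∃ n : ℕ, b - n ≤ a := ⟨(b - a).toNat, by lia⟩
    have := hP.ge
    exact isPerfect_of_retract n b X P
      ⟨P.isStrictlyGE_of_ge _ _ hn, hP.le, hP.finite, hP.projective⟩
      (r.trans (Retract.ofIso e))

/-- The free module of rank one, as an object of the derived category. -/
noncomputable abbrev unitObj (R : Type u) [Ring R] [HasDerivedCategory.{w₁} (ModuleCat.{u} R)] :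
    DerivedCategory (ModuleCat.{u} R) :=
  (DerivedCategory.singleFunctor _ 0).obj (ModuleCat.of R R)

/-- The criterion `∑ π ≫ ι = 1` survives additive functors, so this applies to images of biproducts
as they stand. -/
theorem mem_of_bicone {C : Type*} [Category* C] [HasZeroObject C] [HasShift C ℤ] [Preadditive C]
    [∀ n : ℤ, (shiftFunctor C n).Additive] [Pretriangulated C]
    (S : ObjectProperty C) [S.IsTriangulated] [S.IsClosedUnderIsomorphisms] {J : Type}
    [Finite J] [Fintype J] {f : J → C} (b : Bicone f) (hb : ∑ j, b.π j ≫ b.ι j = 𝟙 b.pt)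
    (h : ∀ j, S (f j)) : S b.pt :=
  S.prop_of_isLimit_fan (isBilimitOfTotal b hb).isLimit h

/-- A finitely generated projective module is a direct summand of some `Rⁿ`, and the embedding in
degree zero respects finite sums. -/
theorem singleFunctor_mem_of_unitObj_mem (S : ObjectProperty (DerivedCategory (ModuleCat.{u} R)))
    [S.IsTriangulated] [S.IsStableUnderRetracts] (h : S (unitObj R)) (M : ModuleCat.{u} R)
    [Module.Finite R M] [Module.Projective R M] :
    S ((DerivedCategory.singleFunctor _ 0).obj M) := by
  obtain ⟨n, f, g, hf, hg, hfg⟩ := Module.Finite.exists_comp_eq_id_of_projective R M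
  let F := DerivedCategory.singleFunctor (ModuleCat.{u} R) 0
  let c : Bicone fun _ : Fin n => unitObj R :=
    { pt := F.obj (ModuleCat.of R (Fin n → R))
      π := fun j => F.map (ModuleCat.ofHom (LinearMap.proj j))
      ι := fun j => F.map (ModuleCat.ofHom (LinearMap.single R (fun _ => R) j))
      ι_π := fun i j => by
        rw [← F.map_comp]
        split_ifs with hij
        · subst hij
          refine (congrArg F.map (ModuleCat.hom_ext (LinearMap.ext fun x => ?_))).trans
            (F.map_id _)
          exact Pi.single_eq_same (M := fun _ => R) i x
        · refine (congrArg F.map (ModuleCat.hom_ext (LinearMap.ext fun x => ?_))).trans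
            (F.map_zero _ _)
          exact Pi.single_eq_of_ne (M := fun _ => R) (Ne.symm hij) x }
  have hc : ∑ j, c.π j ≫ c.ι j = 𝟙 c.pt := by
    simp only [c, ← F.map_comp, ← F.map_sum]
    refine (congrArg F.map (ModuleCat.hom_ext (LinearMap.ext fun x => ?_))).trans (F.map_id _)
    rw [ModuleCat.hom_sum, LinearMap.sum_apply]
    exact Finset.univ_sum_single (M := fun _ : Fin n => R) x
  refine S.prop_of_retract (Y := c.pt)
    { i := F.map (ModuleCat.ofHom g)
      r := F.map (ModuleCat.ofHom f)
      retract := ?_ } (mem_of_bicone S c hc fun _ => h)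
  rw [← F.map_comp, ← F.map_id]
  exact congrArg F.map (ModuleCat.hom_ext hfg)

/-- Forward, dévissage reduces to a single finitely generated projective module. Backward, the
perfect objects are themselves a thick subcategory containing `R`. -/
theorem isPerfect_iff_triangEnvelope (X : DerivedCategory (ModuleCat.{u} R)) :
    IsPerfect X ↔ (ObjectProperty.singleton (unitObj R)).triangEnvelope X := by
  constructor
  · rintro h
    obtain ⟨a, b, P, hP, ⟨e⟩⟩ := isPerfect_iff.1 h
    refine ObjectProperty.prop_of_iso _ e.symm ?_
    have := hP.le
    have := hP.ge
    let S := (ObjectProperty.singleton (unitObj R)).triangEnvelope.inverseImage DerivedCategory.Qh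
    refine quotient_obj_mem_of_forall_single_mem S
      (fun M => Module.Finite R M ∧ Module.Projective R M) ?_ ?_ ?_ P a b
        fun n => ⟨hP.finite n, hP.projective n⟩
    · intro M hM
      have := hM.1
      have := hM.2
      exact singleFunctor_mem_of_unitObj_mem _
        (ObjectProperty.le_triangEnvelope _ _ ((ObjectProperty.singleton_iff _ _).2 rfl)) M
    · intro M N e hM
      have := hM.1
      have := hM.2
      exact ⟨Module.Finite.equiv e.toLinearEquiv, Module.Projective.of_equiv e.toLinearEquiv⟩
    · intro M hM
      have := ModuleCat.subsingleton_of_isZero hM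
      have := Module.Free.of_subsingleton R M
      exact ⟨inferInstance, Module.Projective.of_free⟩
  · refine (ObjectProperty.triangEnvelope_le_iff _ (Q := perfect R)).2 ?_ X
    rintro _ ⟨⟩
    exact isPerfect_singleFunctor (ModuleCat.of R R) 0

theorem mem_of_isPerfect (S : ObjectProperty (DerivedCategory (ModuleCat.{u} R)))
    [S.IsTriangulated] [S.IsStableUnderRetracts] (h : S (unitObj R))
    {X : DerivedCategory (ModuleCat.{u} R)} (hX : IsPerfect X) : S X := by
  refine (ObjectProperty.triangEnvelope_le_iff _ (Q := S)).2 ?_ X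
    ((isPerfect_iff_triangEnvelope X).1 hX)
  rintro _ ⟨⟩
  exact h

/-- A thick subcategory which contains a tilting complex contains all perfect complexes. -/
theorem IsTilting.mem_of_isPerfect {T : DerivedCategory (ModuleCat.{u} R)} (hT : IsTilting T)
    (S : ObjectProperty (DerivedCategory (ModuleCat.{u} R)))
    [S.IsTriangulated] [S.IsStableUnderRetracts] (h : S T)
    {X : DerivedCategory (ModuleCat.{u} R)} (hX : IsPerfect X) : S X := by
  refine (ObjectProperty.triangEnvelope_le_iff _ (Q := S)).2 ?_ X ((hT.generates X).2 hX)
  rintro _ ⟨⟩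
  exact h

theorem IsTilting.isPerfect {T : DerivedCategory (ModuleCat.{u} R)} (hT : IsTilting T) :
    IsPerfect T :=
  (hT.generates T).1 (ObjectProperty.le_triangEnvelope _ _
    ((ObjectProperty.singleton_iff _ _).2 rfl))

end PerfectRetract

/-! ### Tensoring with a fixed complex on homotopy categories. -/

section Bifunctor

open Pretriangulated CochainComplex

variable {C₁ C₂ D : Type*} [Category* C₁] [Category* C₂] [Category* D]
  [Preadditive C₁] [Preadditive C₂] [Preadditive D]
  (F : C₁ ⥤ C₂ ⥤ D) [F.Additive] [∀ X, (F.obj X).Additive]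
  [∀ (K₁ : CochainComplex C₁ ℤ) (K₂ : CochainComplex C₂ ℤ), HasMapBifunctor K₁ K₂ F]

theorem ι_mapBifunctor_d (K₁ : CochainComplex C₁ ℤ) (K₂ : CochainComplex C₂ ℤ) (p q n : ℤ)
    (h : p + q = n) :
    ιMapBifunctor K₁ K₂ F p q n h ≫ (mapBifunctor K₁ K₂ F).d n (n + 1) =
      (F.map (K₁.d p (p + 1))).app _ ≫ ιMapBifunctor K₁ K₂ F (p + 1) q (n + 1) (by lia) +
      p.negOnePow • (F.obj _).map (K₂.d q (q + 1)) ≫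
        ιMapBifunctor K₁ K₂ F p (q + 1) (n + 1) (by lia) := by
  rw [HomologicalComplex.mapBifunctor.d_eq, Preadditive.comp_add,
    HomologicalComplex.mapBifunctor.ι_D₁, HomologicalComplex.mapBifunctor.ι_D₂,
    HomologicalComplex.mapBifunctor.d₁_eq K₁ K₂ F (.up ℤ) (i₁ := p) (i₁' := p + 1) rfl q (n + 1)
      (show p + 1 + q = n + 1 by lia),
    HomologicalComplex.mapBifunctor.d₂_eq K₁ K₂ F (.up ℤ) p (i₂ := q) (i₂' := q + 1) rfl (n + 1)
      (show p + (q + 1) = n + 1 by lia)]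
  congr 1
  exact one_smul _ _

theorem mapBifunctor_hom_ext {K₁ : CochainComplex C₁ ℤ} {K₂ : CochainComplex C₂ ℤ} {n : ℤ} {Y : D}
    {f g : (mapBifunctor K₁ K₂ F).X n ⟶ Y}
    (h : ∀ (p q : ℤ) (h : p + q = n),
      ιMapBifunctor K₁ K₂ F p q n h ≫ f = ιMapBifunctor K₁ K₂ F p q n h ≫ g) : f = g :=
  HomologicalComplex.mapBifunctor.hom_ext h

/-- The map on total complexes induced by a family of morphisms in the first variable. -/
noncomputable def gradedMap₁ {K L : CochainComplex C₁ ℤ} (φ : ∀ p, K.X p ⟶ L.X p)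
    (Y : CochainComplex C₂ ℤ) (n : ℤ) : (mapBifunctor K Y F).X n ⟶ (mapBifunctor L Y F).X n :=
  HomologicalComplex.mapBifunctorDesc fun p q h =>
    (F.map (φ p)).app (Y.X q) ≫ ιMapBifunctor L Y F p q n h

theorem ι_gradedMap₁ {K L : CochainComplex C₁ ℤ} (φ : ∀ p, K.X p ⟶ L.X p)
    (Y : CochainComplex C₂ ℤ) (n p q : ℤ) (h : p + q = n) :
    ιMapBifunctor K Y F p q n h ≫ gradedMap₁ F φ Y n =
      (F.map (φ p)).app (Y.X q) ≫ ιMapBifunctor L Y F p q n h :=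
  HomologicalComplex.ι_mapBifunctorDesc _ p q h

theorem gradedMap₁_f {K L : CochainComplex C₁ ℤ} (φ : K ⟶ L)
    (Y : CochainComplex C₂ ℤ) (n : ℤ) :
    gradedMap₁ F φ.f Y n = ((F.map₂CochainComplex.flip.obj Y).map φ).f n := by
  refine mapBifunctor_hom_ext F fun p q h => ?_
  rw [ι_gradedMap₁]
  change _ = _ ≫ (HomologicalComplex.mapBifunctorMap φ (𝟙 Y) F (.up ℤ)).f n
  rw [HomologicalComplex.ι_mapBifunctorMap]
  simp

theorem gradedMap₁_comp {K L M : CochainComplex C₁ ℤ} (φ : ∀ p, K.X p ⟶ L.X p)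
    (ψ : ∀ p, L.X p ⟶ M.X p) (Y : CochainComplex C₂ ℤ) (n : ℤ) :
    gradedMap₁ F φ Y n ≫ gradedMap₁ F ψ Y n = gradedMap₁ F (fun p => φ p ≫ ψ p) Y n := by
  refine mapBifunctor_hom_ext F fun p q h => ?_
  rw [← Category.assoc, ι_gradedMap₁, Category.assoc, ι_gradedMap₁, ι_gradedMap₁]
  simp

theorem gradedMap₁_add {K L : CochainComplex C₁ ℤ} (φ ψ : ∀ p, K.X p ⟶ L.X p)
    (Y : CochainComplex C₂ ℤ) (n : ℤ) :
    gradedMap₁ F φ Y n + gradedMap₁ F ψ Y n = gradedMap₁ F (fun p => φ p + ψ p) Y n := by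
  refine mapBifunctor_hom_ext F fun p q h => ?_
  rw [Preadditive.comp_add, ι_gradedMap₁, ι_gradedMap₁, ι_gradedMap₁]
  simp [Functor.map_add]

theorem gradedMap₁_id (K : CochainComplex C₁ ℤ) (Y : CochainComplex C₂ ℤ) (n : ℤ) :
    gradedMap₁ F (fun p => 𝟙 (K.X p)) Y n = 𝟙 _ := by
  refine mapBifunctor_hom_ext F fun p q h => ?_
  rw [ι_gradedMap₁]
  simp

instance (Y : CochainComplex C₂ ℤ) : (F.map₂CochainComplex.flip.obj Y).Additive where
  map_add {K L φ ψ} := by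
    refine HomologicalComplex.hom_ext _ _ fun n => ?_
    exact (gradedMap₁_f F (φ + ψ) Y n).symm.trans ((gradedMap₁_add F φ.f ψ.f Y n).symm.trans
      (congrArg₂ (· + ·) (gradedMap₁_f F φ Y n) (gradedMap₁_f F ψ Y n)))

/-- A degreewise splitting induces one after tensoring. -/
noncomputable def splittingMap₁ {S : ShortComplex (CochainComplex C₁ ℤ)}
    (σ : ∀ n, (S.map (HomologicalComplex.eval C₁ _ n)).Splitting) (Y : CochainComplex C₂ ℤ)
    (n : ℤ) : ((S.map (F.map₂CochainComplex.flip.obj Y)).map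
      (HomologicalComplex.eval D _ n)).Splitting where
  r := gradedMap₁ F (fun p => (σ p).r) Y n
  s := gradedMap₁ F (fun p => (σ p).s) Y n
  -- The sections and retractions of a degreewise splitting are not chain maps. This is why
  -- `gradedMap₁` takes arbitrary families of morphisms.
  f_r := by
    refine (congrArg (· ≫ _) (gradedMap₁_f F S.f Y n).symm).trans
      ((gradedMap₁_comp F _ _ Y n).trans (Eq.trans ?_ (gradedMap₁_id F S.X₁ Y n)))
    exact congrArg (gradedMap₁ F · Y n) (funext fun p => (σ p).f_r)
  s_g := by
    refine (congrArg (_ ≫ ·) (gradedMap₁_f F S.g Y n).symm).trans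
      ((gradedMap₁_comp F _ _ Y n).trans (Eq.trans ?_ (gradedMap₁_id F S.X₃ Y n)))
    exact congrArg (gradedMap₁ F · Y n) (funext fun p => (σ p).s_g)
  id := by
    have h₁ := gradedMap₁_comp F (fun p => (σ p).r) S.f.f Y n
    have h₂ := gradedMap₁_comp F S.g.f (fun p => (σ p).s) Y n
    rw [gradedMap₁_f] at h₁ h₂
    refine (congrArg₂ (· + ·) h₁ h₂).trans ((gradedMap₁_add F _ _ Y n).trans
      (Eq.trans ?_ (gradedMap₁_id F S.X₂ Y n)))
    exact congrArg (gradedMap₁ F · Y n) (funext fun p => (σ p).id)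

/-- The part of the total differential coming from `Y` commutes with `s` and `r`, hence contributes
`s ≫ r = 0`; only the differential of `L` survives. -/
theorem ι_gradedMap₁_d_gradedMap₁ {K L M : CochainComplex C₁ ℤ} (s : ∀ p, K.X p ⟶ L.X p)
    (r : ∀ p, L.X p ⟶ M.X p) (hsr : ∀ p, s p ≫ r p = 0) (Y : CochainComplex C₂ ℤ) (n p q : ℤ)
    (h : p + q = n) :
    ιMapBifunctor K Y F p q n h ≫ gradedMap₁ F s Y n ≫ (mapBifunctor L Y F).d n (n + 1) ≫
      gradedMap₁ F r Y (n + 1) = (F.map (s p ≫ L.d p (p + 1) ≫ r (p + 1))).app _ ≫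
        ιMapBifunctor M Y F (p + 1) q (n + 1) (by lia) := by
  rw [← Category.assoc, ι_gradedMap₁, Category.assoc,
    ← Category.assoc (ιMapBifunctor _ _ _ _ _ _ _), ι_mapBifunctor_d, Preadditive.add_comp, Category.assoc, ι_gradedMap₁,
    Linear.units_smul_comp, Category.assoc, ι_gradedMap₁, Preadditive.comp_add,
    Linear.comp_units_smul, NatTrans.naturality_assoc]
  have h₀ := congrArg (fun f => (F.map f).app (Y.X q)) (hsr p)
  simp only [Functor.map_comp, NatTrans.comp_app, Functor.map_zero, zero_app] at h₀
  rw [reassoc_of% h₀]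
  simp

/-- Shifting the first variable of a total complex introduces no sign, so the commutation
isomorphism is the identity on each summand. -/
theorem ι_map_comp_commShiftIso₁ {K L : CochainComplex C₁ ℤ} (φ : K ⟶ L⟦(1 : ℤ)⟧)
    (Y : CochainComplex C₂ ℤ) (n p q : ℤ) (h : p + q = n) :
    ιMapBifunctor K Y F p q n h ≫ ((F.map₂CochainComplex.flip.obj Y).map φ).f n ≫
        (((F.map₂CochainComplex.flip.obj Y).commShiftIso (1 : ℤ)).hom.app L).f n =
      (F.map (show K.X p ⟶ L.X (p + 1) from φ.f p)).app _ ≫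
        ιMapBifunctor L Y F (p + 1) q (n + 1) (by lia) := by
  have h₁ := ι_gradedMap₁ F φ.f Y n p q h
  rw [gradedMap₁_f] at h₁
  have h₂ := ι_mapBifunctorShift₁Iso_hom_f L Y F 1 p q n h (p + 1) (n + 1) rfl rfl
  refine (Category.assoc _ _ _).symm.trans ((congrArg (· ≫ _) h₁).trans
    ((Category.assoc _ _ _).trans (congrArg (_ ≫ ·) (h₂.trans ?_))))
  rw [shiftFunctorObjXIso, shiftFunctorObjXIso]
  simp only [HomologicalComplex.XIsoOfEq_rfl, Iso.refl_hom, Iso.refl_inv]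
  have h₃ : (F.map (𝟙 (L.X (p + 1)))).app (Y.X q) = 𝟙 _ := by simp
  refine (congrArg (· ≫ _) h₃).trans ((Category.id_comp _).trans ?_)
  exact Category.comp_id _

/-- The connecting morphism of a degreewise split sequence is `s ≫ d ≫ r`, so the two preceding
computations identify the connecting morphism of the tensored sequence. -/
theorem homOfDegreewiseSplit_splittingMap₁ {S : ShortComplex (CochainComplex C₁ ℤ)}
    (σ : ∀ n, (S.map (HomologicalComplex.eval C₁ _ n)).Splitting) (Y : CochainComplex C₂ ℤ) :
    homOfDegreewiseSplit _ (splittingMap₁ F σ Y) =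
      (F.map₂CochainComplex.flip.obj Y).map (homOfDegreewiseSplit S σ) ≫
        ((F.map₂CochainComplex.flip.obj Y).commShiftIso (1 : ℤ)).hom.app S.X₁ := by
  refine HomologicalComplex.hom_ext _ _ fun n => ?_
  rw [homOfDegreewiseSplit_f]
  refine mapBifunctor_hom_ext F fun p q h => ?_
  refine (ι_gradedMap₁_d_gradedMap₁ F (K := S.X₃) (L := S.X₂) (M := S.X₁) (fun p => (σ p).s)
    (fun p => (σ p).r) (fun p => (σ p).s_r) Y n p q h).trans
    (Eq.trans ?_ (ι_map_comp_commShiftIso₁ F (homOfDegreewiseSplit S σ) Y n p q h).symm)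
  rw [homOfDegreewiseSplit_f]
  rfl

/-- The functor `- ⊗ Y` on homotopy categories attached to an additive bifunctor. -/
noncomputable def mapHomotopyCategory₁ (Y : CochainComplex C₂ ℤ) :
    HomotopyCategory C₁ (.up ℤ) ⥤ HomotopyCategory D (.up ℤ) :=
  CategoryTheory.Quotient.lift _
    (F.map₂CochainComplex.flip.obj Y ⋙ HomotopyCategory.quotient D (.up ℤ))
    (by
      rintro _ _ _ _ ⟨h⟩
      exact HomotopyCategory.eq_of_homotopy _ _
        (HomologicalComplex.mapBifunctorMapHomotopy₁ h (𝟙 Y) F (.up ℤ)))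

/-- `mapHomotopyCategory₁` is induced by the functor `- ⊗ Y` on complexes. -/
noncomputable def mapHomotopyCategory₁Factors (Y : CochainComplex C₂ ℤ) :
    HomotopyCategory.quotient C₁ (.up ℤ) ⋙ mapHomotopyCategory₁ F Y ≅
      F.map₂CochainComplex.flip.obj Y ⋙ HomotopyCategory.quotient D (.up ℤ) :=
  CategoryTheory.Quotient.lift.isLift _ _ _

noncomputable instance (Y : CochainComplex C₂ ℤ) : (mapHomotopyCategory₁ F Y).CommShift ℤ :=
  Quotient.liftCommShift _ _ _ _

instance (Y : CochainComplex C₂ ℤ) :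
    NatTrans.CommShift (mapHomotopyCategory₁Factors F Y).hom ℤ :=
  Quotient.liftCommShift_compatibility _ _ _ _

/-- A morphism of complexes in the second variable induces a natural transformation. -/
noncomputable def mapHomotopyCategory₁Map {Y Y' : CochainComplex C₂ ℤ} (g : Y ⟶ Y') :
    mapHomotopyCategory₁ F Y ⟶ mapHomotopyCategory₁ F Y' :=
  CategoryTheory.Quotient.natTransLift _
    (Functor.whiskerRight (F.map₂CochainComplex.flip.map g) (HomotopyCategory.quotient D (.up ℤ)))

theorem homotopyCategory_natTrans_ext {E : Type*} [Category* E]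
    {G G' : HomotopyCategory C₁ (.up ℤ) ⥤ E} {τ τ' : G ⟶ G'}
    (h : ∀ X, τ.app ((HomotopyCategory.quotient C₁ (.up ℤ)).obj X) =
      τ'.app ((HomotopyCategory.quotient C₁ (.up ℤ)).obj X)) : τ = τ' := by
  ext X
  obtain ⟨X, rfl⟩ := HomotopyCategory.quotient_obj_surjective X
  exact h X

theorem mapHomotopyCategory₁Map_eq_of_homotopy {Y Y' : CochainComplex C₂ ℤ} {g g' : Y ⟶ Y'}
    (h : Homotopy g g') : mapHomotopyCategory₁Map F g = mapHomotopyCategory₁Map F g' :=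
  homotopyCategory_natTrans_ext fun X => HomotopyCategory.eq_of_homotopy _ _
    (HomologicalComplex.mapBifunctorMapHomotopy₂ (𝟙 X) h F (.up ℤ))

theorem mapHomotopyCategory₁Map_id (Y : CochainComplex C₂ ℤ) :
    mapHomotopyCategory₁Map F (𝟙 Y) = 𝟙 _ :=
  homotopyCategory_natTrans_ext fun X =>
    (congrArg (HomotopyCategory.quotient D (.up ℤ)).map
      (congr_app (F.map₂CochainComplex.flip.map_id Y) X)).trans
      ((HomotopyCategory.quotient D (.up ℤ)).map_id _)

theorem mapHomotopyCategory₁Map_comp {Y Y' Y'' : CochainComplex C₂ ℤ} (g : Y ⟶ Y')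
    (g' : Y' ⟶ Y'') : mapHomotopyCategory₁Map F (g ≫ g') =
      mapHomotopyCategory₁Map F g ≫ mapHomotopyCategory₁Map F g' :=
  homotopyCategory_natTrans_ext fun X =>
    (congrArg (HomotopyCategory.quotient D (.up ℤ)).map
      (congr_app (F.map₂CochainComplex.flip.map_comp g g') X)).trans
      ((HomotopyCategory.quotient D (.up ℤ)).map_comp _ _)

theorem map₂CochainComplex_flip_map_app_add {Y Y' : CochainComplex C₂ ℤ} (g g' : Y ⟶ Y')
    (X : CochainComplex C₁ ℤ) :
    (F.map₂CochainComplex.flip.map (g + g')).app X =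
      (F.map₂CochainComplex.flip.map g).app X + (F.map₂CochainComplex.flip.map g').app X := by
  refine HomologicalComplex.hom_ext _ _ fun n => mapBifunctor_hom_ext F fun p q h => ?_
  rw [HomologicalComplex.add_f_apply]
  refine Eq.trans ?_ (Preadditive.comp_add _ _ _ _ _ _).symm
  refine (HomologicalComplex.ι_mapBifunctorMap _ _ F _ p q n h).trans (Eq.trans ?_
    (congrArg₂ (· + ·) (HomologicalComplex.ι_mapBifunctorMap _ _ F _ p q n h)
      (HomologicalComplex.ι_mapBifunctorMap _ _ F _ p q n h)).symm)
  simp [Functor.map_add]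

theorem mapHomotopyCategory₁Map_add {Y Y' : CochainComplex C₂ ℤ} (g g' : Y ⟶ Y') :
    mapHomotopyCategory₁Map F (g + g') =
      mapHomotopyCategory₁Map F g + mapHomotopyCategory₁Map F g' :=
  homotopyCategory_natTrans_ext fun X =>
    (congrArg (HomotopyCategory.quotient D (.up ℤ)).map
      (map₂CochainComplex_flip_map_app_add F g g' X)).trans
      ((HomotopyCategory.quotient D (.up ℤ)).map_add ..)

theorem natTrans_ext_of_essSurj {C D E : Type*} [Category* C] [Category* D] [Category* E]
    (L : C ⥤ D) [L.EssSurj] {G G' : D ⥤ E} {τ τ' : G ⟶ G'}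
    (h : ∀ X, τ.app (L.obj X) = τ'.app (L.obj X)) : τ = τ' := by
  ext X
  have e := L.objObjPreimageIso X
  rw [← cancel_epi (G.map e.hom), τ.naturality, τ'.naturality, h]

/-- Compatibility with shifts is an equality of natural transformations, which can be tested on the
essential image of `L`. It is used for the quotient functor and for the localization functor. -/
theorem commShift_of_precomp {C D E A : Type*} [Category* C] [Category* D] [Category* E]
    [AddMonoid A] [HasShift C A] [HasShift D A] [HasShift E A] (L : C ⥤ D) [L.CommShift A]
    [L.EssSurj] {G G' : D ⥤ E} [G.CommShift A] [G'.CommShift A] (τ : G ⟶ G')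
    [NatTrans.CommShift (Functor.whiskerLeft L τ) A] : NatTrans.CommShift τ A where
  shift_comm a := natTrans_ext_of_essSurj L fun Y => by
    have h := NatTrans.shift_app_comm (Functor.whiskerLeft L τ) a Y
    rw [Functor.commShiftIso_comp_hom_app, Functor.commShiftIso_comp_hom_app] at h
    simp only [Functor.whiskerLeft_app, Category.assoc] at h
    rw [← reassoc_of% τ.naturality] at h
    exact (cancel_epi _).1 h

section Linear

variable (k : Type*) [CommRing k] [Linear k C₁] [Linear k C₂] [Linear k D]

instance [∀ Z, (F.flip.obj Z).Linear k] (Y : CochainComplex C₂ ℤ) :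
    (F.map₂CochainComplex.flip.obj Y).Linear k where
  map_smul {K L} φ c := by
    refine HomologicalComplex.hom_ext _ _ fun n => mapBifunctor_hom_ext F fun p q h => ?_
    rw [HomologicalComplex.smul_f_apply]
    refine Eq.trans ?_ (Linear.comp_smul _ _ _ _ _ _).symm
    refine (HomologicalComplex.ι_mapBifunctorMap _ _ F _ p q n h).trans (Eq.trans ?_
      (congrArg (c • ·) (HomologicalComplex.ι_mapBifunctorMap _ _ F _ p q n h)).symm)
    have h := (F.flip.obj (Y.X q)).map_smul c (φ.f p)
    simp only [Functor.flip_obj_map] at h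
    simp [h]

instance [∀ Z, (F.flip.obj Z).Linear k] (Y : CochainComplex C₂ ℤ) :
    (mapHomotopyCategory₁ F Y).Linear k := by
  have : (HomotopyCategory.quotient C₁ (.up ℤ) ⋙ mapHomotopyCategory₁ F Y).Linear k :=
    Functor.linear_of_iso k (mapHomotopyCategory₁Factors F Y).symm
  exact Functor.linear_of_full_essSurj_comp (HomotopyCategory.quotient C₁ (.up ℤ)) _

omit [Linear k C₁] in
theorem map₂CochainComplex_flip_map_app_smul [∀ X, (F.obj X).Linear k]
    {Y Y' : CochainComplex C₂ ℤ} (c : k) (g : Y ⟶ Y') (X : CochainComplex C₁ ℤ) :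
    (F.map₂CochainComplex.flip.map (c • g)).app X =
      c • (F.map₂CochainComplex.flip.map g).app X := by
  refine HomologicalComplex.hom_ext _ _ fun n => mapBifunctor_hom_ext F fun p q h => ?_
  rw [HomologicalComplex.smul_f_apply]
  refine Eq.trans ?_ (Linear.comp_smul _ _ _ _ _ _).symm
  refine (HomologicalComplex.ι_mapBifunctorMap _ _ F _ p q n h).trans (Eq.trans ?_
    (congrArg (c • ·) (HomologicalComplex.ι_mapBifunctorMap _ _ F _ p q n h)).symm)
  simp [Functor.map_smul]

omit [Linear k C₁] in
theorem mapHomotopyCategory₁Map_app_smul [∀ X, (F.obj X).Linear k] {Y Y' : CochainComplex C₂ ℤ}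
    (c : k) (g : Y ⟶ Y') (X : HomotopyCategory C₁ (.up ℤ)) :
    (mapHomotopyCategory₁Map F (c • g)).app X =
      c • (mapHomotopyCategory₁Map F g).app X := by
  obtain ⟨X, rfl⟩ := HomotopyCategory.quotient_obj_surjective X
  exact (congrArg (HomotopyCategory.quotient D (.up ℤ)).map
    (map₂CochainComplex_flip_map_app_smul F k c g X)).trans
    ((HomotopyCategory.quotient D (.up ℤ)).map_smul c _)

end Linear

instance {Y Y' : CochainComplex C₂ ℤ} (g : Y ⟶ Y') :
    NatTrans.CommShift (mapHomotopyCategory₁Map F g) ℤ := by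
  have h : Functor.whiskerLeft (HomotopyCategory.quotient C₁ (.up ℤ))
      (mapHomotopyCategory₁Map F g) = (mapHomotopyCategory₁Factors F Y).hom ≫
      Functor.whiskerRight (F.map₂CochainComplex.flip.map g) (HomotopyCategory.quotient D (.up ℤ)) ≫
      (mapHomotopyCategory₁Factors F Y').inv := by
    ext X
    exact ((Category.id_comp _).trans (Category.comp_id _)).symm
  have : NatTrans.CommShift (Functor.whiskerLeft (HomotopyCategory.quotient C₁ (.up ℤ))
      (mapHomotopyCategory₁Map F g)) ℤ := by
    rw [h]
    infer_instance
  exact commShift_of_precomp (HomotopyCategory.quotient C₁ (.up ℤ)) _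

variable [HasZeroObject C₁] [HasZeroObject D] [HasBinaryBiproducts C₁] [HasBinaryBiproducts D]

/-- Tensoring the triangle of a degreewise split sequence. -/
noncomputable def mapTriangleOfDegreewiseSplitIso {S : ShortComplex (CochainComplex C₁ ℤ)}
    (σ : ∀ n, (S.map (HomologicalComplex.eval C₁ _ n)).Splitting) (Y : CochainComplex C₂ ℤ) :
    (F.map₂CochainComplex.flip.obj Y).mapTriangle.obj (triangleOfDegreewiseSplit S σ) ≅
      triangleOfDegreewiseSplit _ (splittingMap₁ F σ Y) :=
  Triangle.isoMk _ _ (Iso.refl _) (Iso.refl _) (Iso.refl _)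
    ((Category.comp_id _).trans (Category.id_comp _).symm)
    ((Category.comp_id _).trans (Category.id_comp _).symm)
    ((congrArg (_ ≫ ·) (CategoryTheory.Functor.map_id _ _)).trans ((Category.comp_id _).trans
      ((homOfDegreewiseSplit_splittingMap₁ F σ Y).symm.trans (Category.id_comp _).symm)))

/-- Every distinguished triangle of the homotopy category comes from a degreewise split sequence,
and those are preserved together with their connecting morphisms. -/
instance (Y : CochainComplex C₂ ℤ) : (mapHomotopyCategory₁ F Y).IsTriangulated where
  map_distinguished T hT := by
    obtain ⟨S, σ, ⟨e⟩⟩ := (HomotopyCategory.distinguished_iff_iso_trianglehOfDegreewiseSplit T).1 hT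
    refine (HomotopyCategory.distinguished_iff_iso_trianglehOfDegreewiseSplit _).2
      ⟨_, splittingMap₁ F σ Y, ⟨(mapHomotopyCategory₁ F Y).mapTriangle.mapIso e ≪≫
        (Functor.mapTriangleCompIso _ _).symm.app _ ≪≫
        (Functor.mapTriangleIso (mapHomotopyCategory₁Factors F Y)).app _ ≪≫
        (Functor.mapTriangleCompIso _ _).app _ ≪≫
        (HomotopyCategory.quotient D (.up ℤ)).mapTriangle.mapIso
          (mapTriangleOfDegreewiseSplitIso F σ Y)⟩⟩

end Bifunctor

/-! ### Descent to derived categories for flat complexes. -/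

section DerivedBifunctor

open Pretriangulated CochainComplex

variable {C₁ C₂ D : Type*} [Category* C₁] [Category* C₂] [Category* D]
  [Abelian C₁] [Preadditive C₂] [Abelian D]
  (F : C₁ ⥤ C₂ ⥤ D) [F.Additive] [∀ X, (F.obj X).Additive]
  [∀ (K₁ : CochainComplex C₁ ℤ) (K₂ : CochainComplex C₂ ℤ), HasMapBifunctor K₁ K₂ F]

/-- The complex `Y` is flat if `- ⊗ Y` preserves acyclic complexes. -/
class IsTensorFlat (Y : CochainComplex C₂ ℤ) : Prop where
  acyclic (X : CochainComplex C₁ ℤ) (hX : X.Acyclic) : (mapBifunctor X Y F).Acyclic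

variable [HasDerivedCategory.{w₁} C₁] [HasDerivedCategory.{w₃} D]

-- Quasi-isomorphisms are the morphisms with acyclic cone, and a triangulated functor preserving
-- acyclic objects preserves these.
omit [HasDerivedCategory.{w₁} C₁] in
theorem mapHomotopyCategory₁_isInvertedBy (Y : CochainComplex C₂ ℤ) [IsTensorFlat F Y] :
    (HomotopyCategory.quasiIso C₁ (.up ℤ)).IsInvertedBy
      (mapHomotopyCategory₁ F Y ⋙ DerivedCategory.Qh) := by
  rw [HomotopyCategory.quasiIso_eq_trW_subcategoryAcyclic]
  refine fun K L f hf => (HomotopyCategory.subcategoryAcyclic D).inverseImage_trW_isInverted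
    (mapHomotopyCategory₁ F Y) DerivedCategory.Qh f (ObjectProperty.trW_monotone ?_ _ hf)
  intro X hX
  obtain ⟨X, rfl⟩ := HomotopyCategory.quotient_obj_surjective X
  rw [HomotopyCategory.quotient_obj_mem_subcategoryAcyclic_iff_acyclic] at hX
  exact (HomotopyCategory.quotient_obj_mem_subcategoryAcyclic_iff_acyclic _).2
    (IsTensorFlat.acyclic X hX)

/-- The functor `- ⊗ Y` on derived categories for a flat complex `Y`. -/
noncomputable def mapDerivedCategory₁ (Y : CochainComplex C₂ ℤ) [IsTensorFlat F Y] :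
    DerivedCategory C₁ ⥤ DerivedCategory D :=
  Localization.lift _ (mapHomotopyCategory₁_isInvertedBy F Y) DerivedCategory.Qh

noncomputable instance (Y : CochainComplex C₂ ℤ) [IsTensorFlat F Y] :
    Localization.Lifting DerivedCategory.Qh (HomotopyCategory.quasiIso C₁ (.up ℤ))
      (mapHomotopyCategory₁ F Y ⋙ DerivedCategory.Qh) (mapDerivedCategory₁ F Y) :=
  Localization.liftingLift _ _ _

/-- The functor `- ⊗ Y` on derived categories is induced by the one on homotopy categories. -/
noncomputable def mapDerivedCategory₁Factors (Y : CochainComplex C₂ ℤ) [IsTensorFlat F Y] :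
    DerivedCategory.Qh ⋙ mapDerivedCategory₁ F Y ≅
      mapHomotopyCategory₁ F Y ⋙ DerivedCategory.Qh :=
  Localization.Lifting.iso DerivedCategory.Qh (HomotopyCategory.quasiIso C₁ (.up ℤ)) _ _

noncomputable instance (Y : CochainComplex C₂ ℤ) [IsTensorFlat F Y] :
    (mapDerivedCategory₁ F Y).CommShift ℤ :=
  Functor.commShiftOfLocalization DerivedCategory.Qh
    (HomotopyCategory.quasiIso C₁ (.up ℤ)) ℤ (mapHomotopyCategory₁ F Y ⋙ DerivedCategory.Qh) _

instance (Y : CochainComplex C₂ ℤ) [IsTensorFlat F Y] :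
    NatTrans.CommShift (mapDerivedCategory₁Factors F Y).hom ℤ :=
  inferInstanceAs (NatTrans.CommShift (Localization.Lifting.iso
      DerivedCategory.Qh (HomotopyCategory.quasiIso C₁ (.up ℤ))
        (mapHomotopyCategory₁ F Y ⋙ DerivedCategory.Qh) (mapDerivedCategory₁ F Y)).hom ℤ)

instance (Y : CochainComplex C₂ ℤ) [IsTensorFlat F Y] :
    (mapDerivedCategory₁ F Y).IsTriangulated :=
  Functor.isTriangulated_of_precomp_iso (mapDerivedCategory₁Factors F Y)

instance (Y : CochainComplex C₂ ℤ) [IsTensorFlat F Y] (k : Type*) [CommRing k] [Linear k C₁]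
    [Linear k D] [∀ Z, (F.flip.obj Z).Linear k] : (mapDerivedCategory₁ F Y).Linear k := by
  rw [← Localization.functor_linear_iff DerivedCategory.Qh (HomotopyCategory.quasiIso C₁
    (.up ℤ)) k (mapHomotopyCategory₁ F Y ⋙ DerivedCategory.Qh)]
  infer_instance

/-- The value of `- ⊗ Y` on a complex. -/
noncomputable def mapDerivedCategory₁ObjIso (Y : CochainComplex C₂ ℤ) [IsTensorFlat F Y]
    (X : CochainComplex C₁ ℤ) :
    (mapDerivedCategory₁ F Y).obj (DerivedCategory.Q.obj X) ≅
      DerivedCategory.Q.obj (mapBifunctor X Y F) :=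
  (mapDerivedCategory₁Factors F Y).app ((HomotopyCategory.quotient _ _).obj X)

/-- A morphism of flat complexes in the second variable induces a natural transformation. -/
noncomputable def mapDerivedCategory₁Map {Y Y' : CochainComplex C₂ ℤ} [IsTensorFlat F Y]
    [IsTensorFlat F Y'] (g : Y ⟶ Y') : mapDerivedCategory₁ F Y ⟶ mapDerivedCategory₁ F Y' :=
  Localization.liftNatTrans DerivedCategory.Qh (HomotopyCategory.quasiIso C₁ (.up ℤ)) 
    (mapHomotopyCategory₁ F Y ⋙ DerivedCategory.Qh)
    (mapHomotopyCategory₁ F Y' ⋙ DerivedCategory.Qh) _ _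
    (Functor.whiskerRight (mapHomotopyCategory₁Map F g) DerivedCategory.Qh)

theorem mapDerivedCategory₁Map_app {Y Y' : CochainComplex C₂ ℤ} [IsTensorFlat F Y]
    [IsTensorFlat F Y'] (g : Y ⟶ Y') (X : HomotopyCategory C₁ (.up ℤ)) :
    (mapDerivedCategory₁Map F g).app (DerivedCategory.Qh.obj X) =
      (mapDerivedCategory₁Factors F Y).hom.app X ≫
        DerivedCategory.Qh.map ((mapHomotopyCategory₁Map F g).app X) ≫
        (mapDerivedCategory₁Factors F Y').inv.app X :=
  Localization.liftNatTrans_app ..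

theorem derivedCategory_natTrans_ext {E : Type*} [Category* E] {G G' : DerivedCategory C₁ ⥤ E}
    {τ τ' : G ⟶ G'} (h : ∀ X, τ.app (DerivedCategory.Qh.obj X) =
      τ'.app (DerivedCategory.Qh.obj X)) : τ = τ' :=
  natTrans_ext_of_essSurj DerivedCategory.Qh h

instance {Y Y' : CochainComplex C₂ ℤ} [IsTensorFlat F Y]
    [IsTensorFlat F Y'] (g : Y ⟶ Y') : NatTrans.CommShift (mapDerivedCategory₁Map F g) ℤ := by
  have h : Functor.whiskerLeft DerivedCategory.Qh (mapDerivedCategory₁Map F g) =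
      (mapDerivedCategory₁Factors F Y).hom ≫
        Functor.whiskerRight (mapHomotopyCategory₁Map F g) DerivedCategory.Qh ≫
        (mapDerivedCategory₁Factors F Y').inv := by
    ext X
    exact mapDerivedCategory₁Map_app F g X
  have : NatTrans.CommShift (Functor.whiskerLeft DerivedCategory.Qh
      (mapDerivedCategory₁Map F g)) ℤ := by
    rw [h]
    infer_instance
  exact commShift_of_precomp DerivedCategory.Qh _

variable {Y Y' Y'' : CochainComplex C₂ ℤ} [IsTensorFlat F Y] [IsTensorFlat F Y']
  [IsTensorFlat F Y'']

theorem mapDerivedCategory₁Map_eq_of_homotopy {g g' : Y ⟶ Y'} (h : Homotopy g g') :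
    mapDerivedCategory₁Map F g = mapDerivedCategory₁Map F g' := by
  rw [mapDerivedCategory₁Map, mapDerivedCategory₁Map, mapHomotopyCategory₁Map_eq_of_homotopy F h]

theorem mapDerivedCategory₁Map_id : mapDerivedCategory₁Map F (𝟙 Y) = 𝟙 _ := by
  rw [mapDerivedCategory₁Map, mapHomotopyCategory₁Map_id, Functor.whiskerRight_id']
  exact Localization.liftNatTrans_id ..

theorem mapDerivedCategory₁Map_comp (g : Y ⟶ Y') (g' : Y' ⟶ Y'') :
    mapDerivedCategory₁Map F (g ≫ g') =
      mapDerivedCategory₁Map F g ≫ mapDerivedCategory₁Map F g' := by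
  rw [mapDerivedCategory₁Map, mapHomotopyCategory₁Map_comp, Functor.whiskerRight_comp]
  exact (Localization.comp_liftNatTrans ..).symm

theorem mapDerivedCategory₁Map_add (g g' : Y ⟶ Y') :
    mapDerivedCategory₁Map F (g + g') =
      mapDerivedCategory₁Map F g + mapDerivedCategory₁Map F g' :=
  derivedCategory_natTrans_ext fun X => by
    rw [NatTrans.app_add, mapDerivedCategory₁Map_app, mapDerivedCategory₁Map_app,
      mapDerivedCategory₁Map_app, mapHomotopyCategory₁Map_add, NatTrans.app_add, Functor.map_add]
    simp

theorem mapDerivedCategory₁Map_app_smul (k : Type*) [CommRing k] [Linear k C₁] [Linear k C₂]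
    [Linear k D] [∀ X, (F.obj X).Linear k] (c : k) (g : Y ⟶ Y') (X : DerivedCategory C₁) :
    (mapDerivedCategory₁Map F (c • g)).app X = c • (mapDerivedCategory₁Map F g).app X := by
  have e := DerivedCategory.Qh.objObjPreimageIso X
  rw [← cancel_epi ((mapDerivedCategory₁ F Y).map e.hom), NatTrans.naturality, Linear.comp_smul,
    NatTrans.naturality, ← Linear.smul_comp, mapDerivedCategory₁Map_app,
    mapDerivedCategory₁Map_app, mapHomotopyCategory₁Map_app_smul, Functor.map_smul]
  simp

-- Tensor products whose first factor is concentrated in degree zero.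

end DerivedBifunctor

section SingleFirst

open CochainComplex

variable {C₁ C₂ D : Type*} [Category* C₁] [Category* C₂] [Category* D]
  [Preadditive C₁] [HasZeroObject C₁] [Preadditive C₂] [Preadditive D]
  (F : C₁ ⥤ C₂ ⥤ D) [F.Additive] [∀ X, (F.obj X).Additive]
  [∀ (K₁ : CochainComplex C₁ ℤ) (K₂ : CochainComplex C₂ ℤ), HasMapBifunctor K₁ K₂ F]

/-- The projection of the tensor product with a complex concentrated in degree zero. -/
noncomputable def mapBifunctorSingleHom (M : C₁) (Y : CochainComplex C₂ ℤ) (n : ℤ) :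
    (mapBifunctor ((HomologicalComplex.single C₁ (.up ℤ) 0).obj M) Y F).X n ⟶
      (F.obj M).obj (Y.X n) :=
  HomologicalComplex.mapBifunctorDesc fun p q h =>
    if hp : p = 0 then
      (F.map (HomologicalComplex.singleObjXIsoOfEq (.up ℤ) 0 M p hp).hom).app _ ≫
        (F.obj M).map (Y.XIsoOfEq (show q = n by
          change p + q = n at h
          lia)).hom
    else 0

theorem ι_mapBifunctorSingleHom_zero (M : C₁) (Y : CochainComplex C₂ ℤ) (n : ℤ) :
    ιMapBifunctor _ Y F 0 n n (zero_add n) ≫ mapBifunctorSingleHom F M Y n =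
      (F.map (HomologicalComplex.singleObjXSelf (.up ℤ) 0 M).hom).app _ := by
  refine (HomologicalComplex.ι_mapBifunctorDesc _ 0 n (zero_add n)).trans ?_
  rw [dif_pos rfl]
  refine (congrArg (_ ≫ ·) ((F.obj M).map_id _)).trans (Category.comp_id _)

theorem mapBifunctorSingle_hom_inv_id (M : C₁) (Y : CochainComplex C₂ ℤ) (n : ℤ) :
    ((F.map (HomologicalComplex.singleObjXSelf (.up ℤ) 0 M).inv).app (Y.X n) ≫
      ιMapBifunctor _ Y F 0 n n (zero_add n)) ≫ mapBifunctorSingleHom F M Y n = 𝟙 _ := by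
  rw [Category.assoc, ι_mapBifunctorSingleHom_zero, ← NatTrans.comp_app, ← Functor.map_comp,
    Iso.inv_hom_id, F.map_id, NatTrans.id_app]

theorem mapBifunctorSingle_inv_hom_id (M : C₁) (Y : CochainComplex C₂ ℤ) (n : ℤ) :
    mapBifunctorSingleHom F M Y n ≫
      (F.map (HomologicalComplex.singleObjXSelf (.up ℤ) 0 M).inv).app (Y.X n) ≫
      ιMapBifunctor _ Y F 0 n n (zero_add n) = 𝟙 _ := by
  refine mapBifunctor_hom_ext F fun p q h => ?_
  by_cases hp : p = 0
  · subst hp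
    obtain rfl : q = n := by lia
    rw [← Category.assoc, ι_mapBifunctorSingleHom_zero, ← Category.assoc, ← NatTrans.comp_app,
      ← Functor.map_comp, Iso.hom_inv_id, F.map_id, NatTrans.id_app, Category.id_comp,
      Category.comp_id]
  · exact IsZero.eq_of_src ((F.flip.obj (Y.X q)).map_isZero
      (HomologicalComplex.isZero_single_obj_X _ _ _ _ hp)) _ _

/-- The tensor product with a complex concentrated in degree zero is computed termwise. -/
noncomputable def mapBifunctorSingleIso (M : C₁) (Y : CochainComplex C₂ ℤ) :
    ((F.obj M).mapHomologicalComplex (.up ℤ)).obj Y ≅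
      mapBifunctor ((HomologicalComplex.single C₁ (.up ℤ) 0).obj M) Y F :=
  HomologicalComplex.Hom.isoOfComponents
    (fun n =>
      { hom := (F.map (HomologicalComplex.singleObjXSelf (.up ℤ) 0 M).inv).app _ ≫
          ιMapBifunctor _ Y F 0 n n (zero_add n)
        inv := mapBifunctorSingleHom F M Y n
        hom_inv_id := mapBifunctorSingle_hom_inv_id F M Y n
        inv_hom_id := mapBifunctorSingle_inv_hom_id F M Y n })
    (by
      rintro n _ rfl
      refine (Category.assoc _ _ _).trans ((congrArg (_ ≫ ·)
        (ι_mapBifunctor_d F _ Y 0 n n (zero_add n))).trans ?_)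
      have h₀ : ((HomologicalComplex.single C₁ (.up ℤ) 0).obj M).d 0 (0 + 1) = 0 :=
        HomologicalComplex.single_obj_d ..
      rw [h₀, Functor.map_zero, zero_app, zero_comp, zero_add, Int.negOnePow_zero, one_smul]
      exact (Category.assoc _ _ _).symm.trans ((congrArg (· ≫ _)
        ((F.map (HomologicalComplex.singleObjXSelf (.up ℤ) 0 M).inv).naturality
          (Y.d n (n + 1))).symm).trans (Category.assoc _ _ _)))

theorem mapBifunctorSingleIso_hom_naturality (M : C₁) {Y Y' : CochainComplex C₂ ℤ} (g : Y ⟶ Y') :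
    ((F.obj M).mapHomologicalComplex (.up ℤ)).map g ≫ (mapBifunctorSingleIso F M Y').hom =
      (mapBifunctorSingleIso F M Y).hom ≫ (F.map₂CochainComplex.flip.map g).app
        ((HomologicalComplex.single C₁ (.up ℤ) 0).obj M) := by
  refine HomologicalComplex.hom_ext _ _ fun n => ?_
  have h := HomologicalComplex.ι_mapBifunctorMap
    (𝟙 ((HomologicalComplex.single C₁ (.up ℤ) 0).obj M)) g F (.up ℤ) 0 n n (zero_add n)
  rw [HomologicalComplex.id_f, F.map_id, NatTrans.id_app, Category.id_comp] at h
  refine Eq.trans ?_ ((congrArg (_ ≫ ·) h).symm.trans (Category.assoc _ _ _).symm)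
  exact (Category.assoc _ _ _).symm.trans ((congrArg (· ≫ _)
    ((F.map (HomologicalComplex.singleObjXSelf (.up ℤ) 0 M).inv).naturality (g.f n))).trans
    (Category.assoc _ _ _))

theorem mapBifunctorSingleIso_hom_naturality₁ {M M' : C₁} (f : M ⟶ M') (Y : CochainComplex C₂ ℤ) :
    (NatTrans.mapHomologicalComplex (F.map f) (.up ℤ)).app Y ≫
        (mapBifunctorSingleIso F M' Y).hom =
      (mapBifunctorSingleIso F M Y).hom ≫ (F.map₂CochainComplex.flip.obj Y).map
        ((HomologicalComplex.single C₁ (.up ℤ) 0).map f) := by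
  refine HomologicalComplex.hom_ext _ _ fun n => ?_
  have h := ι_gradedMap₁ F ((HomologicalComplex.single C₁ (.up ℤ) 0).map f).f Y n 0 n (zero_add n)
  rw [gradedMap₁_f] at h
  refine Eq.trans ?_ ((congrArg (_ ≫ ·) h).symm.trans (Category.assoc _ _ _).symm)
  refine (Category.assoc _ _ _).symm.trans (Eq.trans (congrArg (· ≫ _) ?_) (Category.assoc _ _ _))
  refine (NatTrans.comp_app _ _ _).symm.trans (Eq.trans ?_ (NatTrans.comp_app _ _ _))
  rw [← F.map_comp, ← F.map_comp, HomologicalComplex.single_map_f_self, Iso.inv_hom_id_assoc]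

end SingleFirst

/-! ### The comparison map `Hom(X, W) ⊗ H ⟶ Hom(G X, G' W)` and its thick locus of bijectivity. -/

section CompareHom

open Pretriangulated ZeroObject

theorem bijective_of_retract {M N M' N' : Type*} {a : M → N} {b : M' → N'} {i : M → M'}
    {r : M' → M} {i' : N → N'} {r' : N' → N} (hri : ∀ x, r (i x) = x) (hri' : ∀ x, r' (i' x) = x)
    (hi : ∀ x, b (i x) = i' (a x)) (hr : ∀ x, a (r x) = r' (b x)) (hb : Function.Bijective b) :
    Function.Bijective a := by
  refine ⟨fun x y hxy => ?_, fun y => ?_⟩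
  · rw [← hri x, ← hri y, hb.1 ((hi x).trans ((congrArg i' hxy).trans (hi y).symm))]
  · obtain ⟨x, hx⟩ := hb.2 (i' y)
    exact ⟨r x, by rw [hr, hx, hri']⟩

theorem subsingleton_tensorProduct {k : Type*} [CommRing k] {M N : Type*} [AddCommGroup M]
    [AddCommGroup N] [Module k M] [Module k N] [Subsingleton M] : Subsingleton (M ⊗[k] N) := by
  refine ⟨fun x y => ?_⟩
  have h (x : M ⊗[k] N) : x = 0 := by
    induction x with
    | zero => rfl
    | add x y hx hy => rw [hx, hy, add_zero]
    | tmul m n => rw [Subsingleton.elim m 0, TensorProduct.zero_tmul]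
  rw [h x, h y]

variable {k : Type*} [CommRing k] {C D : Type*} [Category* C] [Category* D]
  [Preadditive C] [Preadditive D] [Linear k C] [Linear k D]

section

variable {G G' : C ⥤ D} [G.Additive] [G.Linear k] {H : Type*} [AddCommGroup H] [Module k H]
  (τ : H →ₗ[k] (G ⟶ G'))

/-- The map `f ⊗ h ↦ G(f) ≫ τ(h)`. -/
noncomputable def compareHom (X W : C) :
    (X ⟶ W) ⊗[k] H →ₗ[k] (G.obj X ⟶ G'.obj W) :=
  TensorProduct.lift (LinearMap.mk₂ k (fun f h => G.map f ≫ (τ h).app W)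
    (fun f f' h => by rw [Functor.map_add, Preadditive.add_comp])
    (fun c f h => by rw [Functor.map_smul, Linear.smul_comp])
    (fun f h h' => by rw [map_add, NatTrans.app_add, Preadditive.comp_add])
    (fun c f h => by
      rw [map_smul, ← Linear.comp_smul]
      rfl))

theorem compareHom_tmul {X W : C} (f : X ⟶ W) (h : H) :
    compareHom τ X W (f ⊗ₜ h) = G.map f ≫ (τ h).app W := rfl

theorem compareHom_comp_right {X W W' : C} (v : W ⟶ W') (t : (X ⟶ W) ⊗[k] H) :
    compareHom τ X W' ((Linear.rightComp k X v).rTensor H t) =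
      compareHom τ X W t ≫ G'.map v := by
  induction t with
  | zero => simp
  | add x y hx hy => rw [map_add, map_add, map_add, hx, hy, Preadditive.add_comp]
  | tmul f h =>
    rw [LinearMap.rTensor_tmul, compareHom_tmul, compareHom_tmul, Category.assoc,
      ← NatTrans.naturality, ← Functor.map_comp_assoc]
    rfl

theorem compareHom_comp_left {X X' W : C} (v : X' ⟶ X) (t : (X ⟶ W) ⊗[k] H) :
    compareHom τ X' W ((Linear.leftComp k W v).rTensor H t) =
      G.map v ≫ compareHom τ X W t := by
  induction t with
  | zero => simp
  | add x y hx hy => rw [map_add, map_add, map_add, hx, hy, Preadditive.comp_add]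
  | tmul f h =>
    rw [LinearMap.rTensor_tmul, compareHom_tmul, compareHom_tmul, ← Functor.map_comp_assoc]
    rfl

theorem compareHom_bijective_of_retract_right {X W W' : C} (r : Retract W W')
    (h : Function.Bijective (compareHom τ X W')) : Function.Bijective (compareHom τ X W) := by
  refine bijective_of_retract (i := (Linear.rightComp k X r.i).rTensor H)
    (r := (Linear.rightComp k X r.r).rTensor H) (i' := (· ≫ G'.map r.i)) (r' := (· ≫ G'.map r.r))
    (fun x => ?_) (fun x => ?_) (compareHom_comp_right τ r.i) (compareHom_comp_right τ r.r) h
  · rw [← LinearMap.comp_apply, ← LinearMap.rTensor_comp]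
    have : Linear.rightComp k X r.r ∘ₗ Linear.rightComp k X r.i = .id :=
      LinearMap.ext fun f => by simp
    rw [this, LinearMap.rTensor_id, LinearMap.id_apply]
  · simp [← Functor.map_comp]

theorem compareHom_bijective_of_retract_left {X X' W : C} (r : Retract X X')
    (h : Function.Bijective (compareHom τ X' W)) : Function.Bijective (compareHom τ X W) := by
  refine bijective_of_retract (i := (Linear.leftComp k W r.r).rTensor H)
    (r := (Linear.leftComp k W r.i).rTensor H) (i' := (G.map r.r ≫ ·)) (r' := (G.map r.i ≫ ·))
    (fun x => ?_) (fun x => ?_) (compareHom_comp_left τ r.r) (compareHom_comp_left τ r.i) h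
  · rw [← LinearMap.comp_apply, ← LinearMap.rTensor_comp]
    have : Linear.leftComp k W r.i ∘ₗ Linear.leftComp k W r.r = .id :=
      LinearMap.ext fun f => by simp
    rw [this, LinearMap.rTensor_id, LinearMap.id_apply]
  · simp [← Functor.map_comp_assoc]

end

variable [HasZeroObject C] [HasZeroObject D] [HasShift C ℤ] [HasShift D ℤ]
  [∀ n : ℤ, (shiftFunctor C n).Additive] [∀ n : ℤ, (shiftFunctor D n).Additive]
  [Pretriangulated C] [Pretriangulated D]

theorem exact_rightComp {T : Triangle C} (hT : T ∈ distTriang C) (X : C) :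
    Function.Exact (Linear.rightComp k X T.mor₁) (Linear.rightComp k X T.mor₂) := by
  intro f
  constructor
  · intro hf
    obtain ⟨g, hg⟩ := T.coyoneda_exact₂ hT f hf
    exact ⟨g, hg.symm⟩
  · rintro ⟨g, rfl⟩
    exact (Category.assoc _ _ _).trans ((congrArg (g ≫ ·) (comp_distTriang_mor_zero₁₂ _ hT)).trans
      comp_zero)

theorem exact_leftComp {T : Triangle C} (hT : T ∈ distTriang C) (Y : C) :
    Function.Exact (Linear.leftComp k Y T.mor₂) (Linear.leftComp k Y T.mor₁) := by
  intro f
  constructor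
  · intro hf
    obtain ⟨g, hg⟩ := T.yoneda_exact₂ hT f hf
    exact ⟨g, hg.symm⟩
  · rintro ⟨g, rfl⟩
    exact (Category.assoc _ _ _).symm.trans ((congrArg (· ≫ g)
      (comp_distTriang_mor_zero₁₂ _ hT)).trans zero_comp)

variable {G G' : C ⥤ D} [G.CommShift ℤ] [G'.CommShift ℤ] [G.IsTriangulated] [G'.IsTriangulated]
  [G.Linear k] {H : Type*} [AddCommGroup H] [Module k H] [Module.Flat k H]
  (τ : H →ₗ[k] (G ⟶ G'))

/-- Five lemma: both sides are exact along the triangle, the left one because tensoring with the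
flat module `H` preserves the exact Hom sequence. -/
theorem compareHom_bijective_obj₂_right {T : Triangle C} (hT : T ∈ distTriang C) (X : C)
    (h₀ : Function.Bijective (compareHom τ X T.invRotate.obj₁))
    (h₁ : Function.Bijective (compareHom τ X T.obj₁))
    (h₃ : Function.Bijective (compareHom τ X T.obj₃))
    (h₄ : Function.Bijective (compareHom τ X T.rotate.obj₃)) :
    Function.Bijective (compareHom τ X T.obj₂) := by
  have hT' := inv_rot_of_distTriang _ hT
  have hT'' := rot_of_distTriang _ hT
  exact LinearMap.bijective_of_surjective_of_bijective_of_bijective_of_injective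
    ((Linear.rightComp k X T.invRotate.mor₁).rTensor H) ((Linear.rightComp k X T.mor₁).rTensor H)
    ((Linear.rightComp k X T.mor₂).rTensor H) ((Linear.rightComp k X T.mor₃).rTensor H)
    (Linear.rightComp k (G.obj X) (G'.map T.invRotate.mor₁))
    (Linear.rightComp k (G.obj X) (G'.map T.mor₁))
    (Linear.rightComp k (G.obj X) (G'.map T.mor₂))
    (Linear.rightComp k (G.obj X) (G'.map T.mor₃))
    (compareHom τ X T.invRotate.obj₁) (compareHom τ X T.obj₁) (compareHom τ X T.obj₂)
    (compareHom τ X T.obj₃) (compareHom τ X T.rotate.obj₃)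
    (LinearMap.ext fun t => (compareHom_comp_right τ _ t).symm)
    (LinearMap.ext fun t => (compareHom_comp_right τ _ t).symm)
    (LinearMap.ext fun t => (compareHom_comp_right τ _ t).symm)
    (LinearMap.ext fun t => (compareHom_comp_right τ _ t).symm)
    (Module.Flat.rTensor_exact H (exact_rightComp hT' X))
    (Module.Flat.rTensor_exact H (exact_rightComp hT X))
    (Module.Flat.rTensor_exact H (exact_rightComp hT'' X))
    (exact_rightComp (G'.map_distinguished _ hT') _)
    (exact_rightComp (G'.map_distinguished _ hT) _)
    (exact_rightComp (G'.map_distinguished _ hT'') _) h₀.2 h₁ h₃ h₄.1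

omit [G'.CommShift ℤ] [G'.IsTriangulated] in
theorem compareHom_bijective_obj₂_left {T : Triangle C} (hT : T ∈ distTriang C) (W : C)
    (h₀ : Function.Bijective (compareHom τ T.invRotate.obj₁ W))
    (h₁ : Function.Bijective (compareHom τ T.obj₁ W))
    (h₃ : Function.Bijective (compareHom τ T.obj₃ W))
    (h₄ : Function.Bijective (compareHom τ T.rotate.obj₃ W)) :
    Function.Bijective (compareHom τ T.obj₂ W) := by
  have hT' := inv_rot_of_distTriang _ hT
  have hT'' := rot_of_distTriang _ hT
  exact LinearMap.bijective_of_surjective_of_bijective_of_bijective_of_injective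
    ((Linear.leftComp k W T.mor₃).rTensor H) ((Linear.leftComp k W T.mor₂).rTensor H)
    ((Linear.leftComp k W T.mor₁).rTensor H) ((Linear.leftComp k W T.invRotate.mor₁).rTensor H)
    (Linear.leftComp k (G'.obj W) (G.map T.mor₃))
    (Linear.leftComp k (G'.obj W) (G.map T.mor₂))
    (Linear.leftComp k (G'.obj W) (G.map T.mor₁))
    (Linear.leftComp k (G'.obj W) (G.map T.invRotate.mor₁))
    (compareHom τ T.rotate.obj₃ W) (compareHom τ T.obj₃ W) (compareHom τ T.obj₂ W)
    (compareHom τ T.obj₁ W) (compareHom τ T.invRotate.obj₁ W)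
    (LinearMap.ext fun t => (compareHom_comp_left τ _ t).symm)
    (LinearMap.ext fun t => (compareHom_comp_left τ _ t).symm)
    (LinearMap.ext fun t => (compareHom_comp_left τ _ t).symm)
    (LinearMap.ext fun t => (compareHom_comp_left τ _ t).symm)
    (Module.Flat.rTensor_exact H (exact_leftComp hT'' W))
    (Module.Flat.rTensor_exact H (exact_leftComp hT W))
    (Module.Flat.rTensor_exact H (exact_leftComp hT' W))
    (exact_leftComp (G.map_distinguished _ hT'') _)
    (exact_leftComp (G.map_distinguished _ hT) _)
    (exact_leftComp (G.map_distinguished _ hT') _) h₄.2 h₃ h₁ h₀.1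

/-- The objects `W` such that `compareHom τ X W⟦n⟧` is bijective for all `n`. -/
def compareRight (X : C) : ObjectProperty C :=
  fun W => ∀ n : ℤ, Function.Bijective (compareHom τ X (W⟦n⟧))

/-- The objects `X` such that `compareHom τ X⟦n⟧ W` is bijective for all `n`. -/
def compareLeft (W : C) : ObjectProperty C :=
  fun X => ∀ n : ℤ, Function.Bijective (compareHom τ (X⟦n⟧) W)

instance (X : C) : (compareRight τ X).IsStableUnderRetracts where
  of_retract r h n := compareHom_bijective_of_retract_right τ (r.map (shiftFunctor C n)) (h n)

instance (W : C) : (compareLeft τ W).IsStableUnderRetracts where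
  of_retract r h n := compareHom_bijective_of_retract_left τ (r.map (shiftFunctor C n)) (h n)

omit [G'.CommShift ℤ] [G'.IsTriangulated] [Module.Flat k H] in
theorem compareRight_shift_iff (X W : C) (a : ℤ) :
    compareRight τ X (W⟦a⟧) ↔ compareRight τ X W :=
  ⟨fun h n => compareHom_bijective_of_retract_right τ
      (Retract.ofIso ((shiftFunctorAdd' C a (n - a) n (by lia)).app W)) (h (n - a)),
    fun h n => compareHom_bijective_of_retract_right τ
      (Retract.ofIso ((shiftFunctorAdd' C a n (a + n) rfl).symm.app W)) (h (a + n))⟩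

omit [G'.CommShift ℤ] [G'.IsTriangulated] [Module.Flat k H] in
theorem compareLeft_shift_iff (X W : C) (a : ℤ) :
    compareLeft τ W (X⟦a⟧) ↔ compareLeft τ W X :=
  ⟨fun h n => compareHom_bijective_of_retract_left τ
      (Retract.ofIso ((shiftFunctorAdd' C a (n - a) n (by lia)).app X)) (h (n - a)),
    fun h n => compareHom_bijective_of_retract_left τ
      (Retract.ofIso ((shiftFunctorAdd' C a n (a + n) rfl).symm.app X)) (h (a + n))⟩

omit [G'.CommShift ℤ] [G'.IsTriangulated] [Module.Flat k H] in
theorem compareRight.bijective {X W : C} (h : compareRight τ X W) :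
    Function.Bijective (compareHom τ X W) :=
  compareHom_bijective_of_retract_right τ
    (Retract.ofIso ((shiftFunctorZero C ℤ).symm.app W)) (h 0)

omit [G'.CommShift ℤ] [G'.IsTriangulated] [Module.Flat k H] in
theorem compareLeft.bijective {X W : C} (h : compareLeft τ W X) :
    Function.Bijective (compareHom τ X W) :=
  compareHom_bijective_of_retract_left τ
    (Retract.ofIso ((shiftFunctorZero C ℤ).symm.app X)) (h 0)

instance (X : C) : (compareRight τ X).IsTriangulated := by
  have h0 : (compareRight τ X).ContainsZero := ⟨0, isZero_zero C, fun n => by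
    have h := (shiftFunctor C n).map_isZero (isZero_zero C)
    have : Subsingleton (X ⟶ (0 : C)⟦n⟧) := ⟨fun f g => h.eq_of_tgt f g⟩
    have : Subsingleton (G.obj X ⟶ G'.obj ((0 : C)⟦n⟧)) :=
      ⟨fun f g => (G'.map_isZero h).eq_of_tgt f g⟩
    have := subsingleton_tensorProduct (k := k) (M := X ⟶ (0 : C)⟦n⟧) (N := H)
    exact ⟨Function.injective_of_subsingleton _, fun y => ⟨0, Subsingleton.elim _ _⟩⟩⟩
  have h1 : (compareRight τ X).IsStableUnderShift ℤ :=
    ⟨fun n => ⟨fun W hW => (compareRight_shift_iff τ X W n).2 hW⟩⟩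
  have h2 : (compareRight τ X).IsTriangulatedClosed₂ := .mk' fun T hT h h' n => by
    refine compareHom_bijective_obj₂_right τ (T.shift_distinguished hT n) X ?_ (h n) (h' n) ?_
    · exact (((compareRight_shift_iff τ X _ _).2 ((compareRight_shift_iff τ X _ n).2 h')).bijective
        (W := (T.obj₃⟦n⟧)⟦(-1 : ℤ)⟧))
    · exact (((compareRight_shift_iff τ X _ _).2 ((compareRight_shift_iff τ X _ n).2 h)).bijective
        (W := (T.obj₁⟦n⟧)⟦(1 : ℤ)⟧))
  exact {}

instance (W : C) : (compareLeft τ W).IsTriangulated := by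
  have h0 : (compareLeft τ W).ContainsZero := ⟨0, isZero_zero C, fun n => by
    have h := (shiftFunctor C n).map_isZero (isZero_zero C)
    have : Subsingleton ((0 : C)⟦n⟧ ⟶ W) := ⟨fun f g => h.eq_of_src f g⟩
    have : Subsingleton (G.obj ((0 : C)⟦n⟧) ⟶ G'.obj W) :=
      ⟨fun f g => (G.map_isZero h).eq_of_src f g⟩
    have := subsingleton_tensorProduct (k := k) (M := (0 : C)⟦n⟧ ⟶ W) (N := H)
    exact ⟨Function.injective_of_subsingleton _, fun y => ⟨0, Subsingleton.elim _ _⟩⟩⟩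
  have h1 : (compareLeft τ W).IsStableUnderShift ℤ :=
    ⟨fun n => ⟨fun X hX => (compareLeft_shift_iff τ X W n).2 hX⟩⟩
  have h2 : (compareLeft τ W).IsTriangulatedClosed₂ := .mk' fun T hT h h' n => by
    refine compareHom_bijective_obj₂_left τ (T.shift_distinguished hT n) W ?_ (h n) (h' n) ?_
    · exact (((compareLeft_shift_iff τ _ W _).2 ((compareLeft_shift_iff τ _ W n).2 h')).bijective
        (X := (T.obj₃⟦n⟧)⟦(-1 : ℤ)⟧))
    · exact (((compareLeft_shift_iff τ _ W _).2 ((compareLeft_shift_iff τ _ W n).2 h)).bijective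
        (X := (T.obj₁⟦n⟧)⟦(1 : ℤ)⟧))
  exact {}

-- Each `τ h` commutes with shifts, so shifting both arguments conjugates the comparison map by
-- bijections.
omit [G'.IsTriangulated] [Module.Flat k H] in
theorem compareHom_shift_bijective [∀ n : ℤ, (shiftFunctor C n).Linear k]
    [∀ h, NatTrans.CommShift (τ h) ℤ] {X W : C}
    (h : Function.Bijective (compareHom τ X W)) (n : ℤ) :
    Function.Bijective (compareHom τ (X⟦n⟧) (W⟦n⟧)) := by
  let s : (X ⟶ W) ≃ₗ[k] (X⟦n⟧ ⟶ W⟦n⟧) := LinearEquiv.ofBijective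
    ((shiftFunctor C n).mapLinearMap k) ⟨(shiftFunctor C n).map_injective,
      (shiftFunctor C n).map_surjective⟩
  have hs (t : (X ⟶ W) ⊗[k] H) : compareHom τ (X⟦n⟧) (W⟦n⟧) (s.rTensor H t) =
      (G.commShiftIso n).hom.app X ≫ (compareHom τ X W t)⟦n⟧' ≫
        (G'.commShiftIso n).inv.app W := by
    induction t with
    | zero => simp
    | add x y hx hy =>
      rw [map_add, map_add, map_add, hx, hy, Functor.map_add, Preadditive.add_comp,
        Preadditive.comp_add]
    | tmul f h =>
      rw [compareHom_tmul]
      change G.map (f⟦n⟧') ≫ (τ h).app (W⟦n⟧) = _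
      rw [NatTrans.app_shift, Functor.commShiftIso_hom_naturality_assoc, Functor.map_comp,
        Category.assoc]
  have hb : Function.Bijective (compareHom τ (X⟦n⟧) (W⟦n⟧) ∘ (s.rTensor H)) := by
    have : compareHom τ (X⟦n⟧) (W⟦n⟧) ∘ (s.rTensor H) =
      (fun f => (G.commShiftIso n).hom.app X ≫ f ≫ (G'.commShiftIso n).inv.app W) ∘
        (shiftFunctor D n).map ∘ compareHom τ X W := funext hs
    rw [this]
    refine Function.Bijective.comp ?_ (Function.Bijective.comp ⟨(shiftFunctor D n).map_injective,
      (shiftFunctor D n).map_surjective⟩ h)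
    exact (Iso.homCongr ((G.commShiftIso n).app X).symm ((G'.commShiftIso n).app W).symm).bijective
  exact (Function.Bijective.of_comp_iff _ (s.rTensor H).bijective).1 hb

/-- If the comparison map is bijective for an exceptional object `A`, then it is bijective for all
objects in the thick subcategory generated by `A`. -/
theorem compareHom_bijective [∀ n : ℤ, (shiftFunctor C n).Linear k]
    [∀ h, NatTrans.CommShift (τ h) ℤ] {A : C} (hA : ∀ n : ℤ, n ≠ 0 → ∀ f : A ⟶ A⟦n⟧, f = 0)
    (hA' : ∀ n : ℤ, n ≠ 0 → ∀ f : G.obj A ⟶ (G'.obj A)⟦n⟧, f = 0)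
    (h : Function.Bijective (compareHom τ A A)) {X W : C}
    (hX : (ObjectProperty.singleton A).triangEnvelope X)
    (hW : (ObjectProperty.singleton A).triangEnvelope W) :
    Function.Bijective (compareHom τ X W) := by
  -- For `n = 0` this is the hypothesis; for `n ≠ 0` both sides vanish.
  have h₁ : compareRight τ A A := fun n => by
    by_cases hn : n = 0
    · subst hn
      exact compareHom_bijective_of_retract_right τ
        (Retract.ofIso ((shiftFunctorZero C ℤ).app A)) h
    · have : Subsingleton (A ⟶ A⟦n⟧) := ⟨fun f g => by rw [hA n hn f, hA n hn g]⟩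
      have : Subsingleton (G.obj A ⟶ G'.obj (A⟦n⟧)) := ⟨fun f g => by
        rw [← cancel_mono ((G'.commShiftIso n).hom.app A)]
        exact (hA' n hn _).trans (hA' n hn _).symm⟩
      have := subsingleton_tensorProduct (k := k) (M := A ⟶ A⟦n⟧) (N := H)
      exact ⟨Function.injective_of_subsingleton _, fun y => ⟨0, Subsingleton.elim _ _⟩⟩
  have h₂ : compareRight τ A W := by
    refine (ObjectProperty.triangEnvelope_le_iff _ (Q := compareRight τ A)).2 ?_ W hW
    rintro _ ⟨⟩
    exact h₁
  refine compareLeft.bijective τ ?_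
  refine (ObjectProperty.triangEnvelope_le_iff _ (Q := compareLeft τ W)).2 ?_ X hX
  rintro _ ⟨⟩
  intro n
  -- Write `W` as `W[-n][n]`: the comparison for `A[n]` and `W` is the `n`-th shift of the one for
  -- `A` and `W[-n]`, which `h₂` covers.
  exact compareHom_bijective_of_retract_right τ
    (Retract.ofIso ((shiftFunctorCompIsoId C (-n) n (by lia)).symm.app W))
    (compareHom_shift_bijective τ (h₂ (-n)) n)

end CompareHom

/-! ### Split differentials and cohomology of tensor products. -/

section LinearAlgebra

variable {k : Type*} [CommRing k] {C₀ C₁ C₂ Z H : Type*}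
  [AddCommGroup C₀] [AddCommGroup C₁] [AddCommGroup C₂] [AddCommGroup Z] [AddCommGroup H]
  [Module k C₀] [Module k C₁] [Module k C₂] [Module k Z] [Module k H]
  {f : C₀ →ₗ[k] C₁} {g : C₁ →ₗ[k] C₂} {j : Z →ₗ[k] C₁} {π : Z →ₗ[k] H}

/-- If `g t g = g`, then `1 - t g` takes values in the kernel `Z` of `g` and is the identity there,
so `Z` is a direct summand of `C₁`. -/
theorem exists_retraction_of_quasiInverse (hj : Function.Injective j) (hjg : Function.Exact j g)
    {t : C₂ →ₗ[k] C₁} (ht : ∀ x, g (t (g x)) = g x) :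
    ∃ p : C₁ →ₗ[k] Z, ∀ x, j (p x) = x - t (g x) := by
  have h (x : C₁) : (LinearMap.id - t ∘ₗ g : C₁ →ₗ[k] C₁) x ∈ LinearMap.range j :=
    (hjg _).1 (by simp [ht])
  refine ⟨(LinearEquiv.ofInjective j hj).symm.toLinearMap ∘ₗ
    LinearMap.codRestrict (LinearMap.range j) (LinearMap.id - t ∘ₗ g) h, fun x => ?_⟩
  exact congrArg Subtype.val ((LinearEquiv.ofInjective j hj).apply_symm_apply
    (LinearMap.codRestrict (LinearMap.range j) (LinearMap.id - t ∘ₗ g) h x))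

/-- In a complex with projective terms and projective cohomology, a quasi-inverse of a differential
gives rise to one of the preceding differential. -/
theorem exists_quasiInverse [Module.Projective k C₁] [Module.Projective k H]
    (hj : Function.Injective j) (hjg : Function.Exact j g) (hπ : Function.Surjective π)
    (hπf : ∀ z, π z = 0 ↔ ∃ c, f c = j z) (hfg : ∀ x, g (f x) = 0)
    {t : C₂ →ₗ[k] C₁} (ht : ∀ x, g (t (g x)) = g x) :
    ∃ s : C₁ →ₗ[k] C₀, ∀ x, f (s (f x)) = f x := by
  obtain ⟨p, hp⟩ := exists_retraction_of_quasiInverse hj hjg ht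
  have hpj : p ∘ₗ j = .id := LinearMap.ext fun z => hj (by
    rw [LinearMap.comp_apply, hp, hjg.apply_apply_eq_zero, map_zero, sub_zero, LinearMap.id_apply])
  have : Module.Projective k Z := .of_split j p hpj
  have hjpf (x : C₀) : j (p (f x)) = f x := by rw [hp, hfg, map_zero, sub_zero]
  obtain ⟨σ, hσ⟩ := Module.projective_lifting_property π LinearMap.id hπ
  have hσ' (x : H) : π (σ x) = x := LinearMap.congr_fun hσ x
  -- A section `σ` of `π` makes `1 - σ π` a projection of the cycles onto the boundaries. As `Z` is
  -- a direct summand of `C₁`, it is projective, and the projection lifts to a map `h : Z ⟶ C₀`.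
  let q : Z →ₗ[k] LinearMap.range (p ∘ₗ f) := LinearMap.codRestrict _ (LinearMap.id - σ ∘ₗ π)
    fun z => by
      obtain ⟨c, hc⟩ := (hπf ((LinearMap.id - σ ∘ₗ π : Z →ₗ[k] Z) z)).1 (by simp [hσ'])
      exact ⟨c, hj (by rw [LinearMap.comp_apply, hjpf, hc])⟩
  obtain ⟨h, hh⟩ := Module.projective_lifting_property (p ∘ₗ f).rangeRestrict q
    (LinearMap.surjective_rangeRestrict _)
  have hh' (z : Z) : p (f (h z)) = z - σ (π z) := congrArg Subtype.val (LinearMap.congr_fun hh z)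
  refine ⟨h ∘ₗ p, fun x => ?_⟩
  have h₀ : π (p (f x)) = 0 := (hπf _).2 ⟨x, (hjpf x).symm⟩
  rw [LinearMap.comp_apply, ← hjpf (h _), hh', h₀, map_zero, sub_zero, hjpf]

variable {W D₀ D₁ D₂ Z' H' : Type*} [AddCommGroup W] [Module k W]
  [AddCommGroup D₀] [AddCommGroup D₁] [AddCommGroup D₂] [AddCommGroup Z'] [AddCommGroup H']
  [Module k D₀] [Module k D₁] [Module k D₂] [Module k Z'] [Module k H']
  {f' : D₀ →ₗ[k] D₁} {g' : D₁ →ₗ[k] D₂} {j' : Z' →ₗ[k] D₁} {π' : Z' →ₗ[k] H'}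

/-- The cohomology of `W ⊗ C` is `W ⊗ H(C)` in a degree whose outgoing differential has a
quasi-inverse. -/
theorem tensor_cohomology_bijective
    (hj : Function.Injective j) (hjg : Function.Exact j g) (hπ : Function.Surjective π)
    (hπf : ∀ z, π z = 0 ↔ ∃ c, f c = j z) (hfg : ∀ x, g (f x) = 0)
    {t : C₂ →ₗ[k] C₁} (ht : ∀ x, g (t (g x)) = g x)
    (hj' : Function.Injective j') (hjg' : Function.Exact j' g') (hπ' : Function.Surjective π')
    (hπf' : ∀ z, π' z = 0 ↔ ∃ c, f' c = j' z)
    {Φ₀ : W ⊗[k] C₀ →ₗ[k] D₀} {Φ₁ : W ⊗[k] C₁ →ₗ[k] D₁} {Φ₂ : W ⊗[k] C₂ →ₗ[k] D₂}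
    (h₀ : Function.Surjective Φ₀) (h₁ : Function.Bijective Φ₁) (h₂ : Function.Injective Φ₂)
    (h₀₁ : ∀ x, Φ₁ (f.lTensor W x) = f' (Φ₀ x)) (h₁₂ : ∀ x, Φ₂ (g.lTensor W x) = g' (Φ₁ x))
    {ζ : W ⊗[k] Z →ₗ[k] Z'} {θ : W ⊗[k] H →ₗ[k] H'} (hζ : ∀ x, j' (ζ x) = Φ₁ (j.lTensor W x))
    (hθ : ∀ x, θ (π.lTensor W x) = π' (ζ x)) : Function.Bijective θ := by
  obtain ⟨p, hp⟩ := exists_retraction_of_quasiInverse hj hjg ht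
  have hjp : j ∘ₗ p = LinearMap.id - t ∘ₗ g := LinearMap.ext hp
  have hpj : p ∘ₗ j = .id := LinearMap.ext fun z => hj (by
    rw [LinearMap.comp_apply, hp, hjg.apply_apply_eq_zero, map_zero, sub_zero, LinearMap.id_apply])
  constructor
  · rw [injective_iff_map_eq_zero]
    intro y hy
    obtain ⟨y, rfl⟩ := LinearMap.lTensor_surjective W hπ y
    rw [hθ, hπf'] at hy
    obtain ⟨c, hc⟩ := hy
    obtain ⟨x, rfl⟩ := h₀ c
    rw [hζ, ← h₀₁] at hc
    have hx := h₁.1 hc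
    -- The map `π p` kills boundaries and is `π` on cycles. Tensored with `W`, which need not be
    -- flat, it turns `hx` into the vanishing of the class.
    have hπpf : π ∘ₗ p ∘ₗ f = 0 := LinearMap.ext fun x => (hπf _).2 ⟨x, by
      rw [LinearMap.comp_apply, hp, hfg, map_zero, sub_zero]⟩
    have h := congrArg ((π ∘ₗ p).lTensor W) hx
    rw [← LinearMap.comp_apply, ← LinearMap.comp_apply, ← LinearMap.lTensor_comp,
      ← LinearMap.lTensor_comp, LinearMap.comp_assoc, LinearMap.comp_assoc, hπpf, hpj] at h
    simpa using h.symm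
  · intro y
    obtain ⟨z, rfl⟩ := hπ' y
    obtain ⟨x, hx⟩ := h₁.2 (j' z)
    have hgx : g.lTensor W x = 0 := h₂ (by
      rw [h₁₂, hx, hjg'.apply_apply_eq_zero, map_zero])
    -- Since `g` kills `x`, the identity `j p = 1 - t g` shows that `x` comes from the element `p x`
    -- of `W ⊗ Z`.
    refine ⟨π.lTensor W (p.lTensor W x), ?_⟩
    rw [hθ]
    congr 1
    apply hj'
    rw [hζ, ← hx, ← LinearMap.comp_apply (LinearMap.lTensor W j), ← LinearMap.lTensor_comp, hjp,
      LinearMap.lTensor_sub, LinearMap.lTensor_id, LinearMap.sub_apply,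
      LinearMap.lTensor_comp, LinearMap.comp_apply, hgx, map_zero, sub_zero, LinearMap.id_apply]

end LinearAlgebra

/-! ### Morphisms between tensor products of modules. -/

section TensorHom

variable (k : Type u) {A B : Type u} [CommRing k] [Ring A] [Algebra k A] [Ring B] [Algebra k B]

theorem tensorHom_add_left {M M' : ModuleCat.{u} A} {N N' : ModuleCat.{u} B} (f f' : M ⟶ M')
    (g : N ⟶ N') : tensorHom k (f + f') g = tensorHom k f g + tensorHom k f' g :=
  tensorObj_hom_ext k fun x y => TensorProduct.add_tmul (f.hom x) (f'.hom x) (g.hom y)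

theorem tensorHom_add_right {M M' : ModuleCat.{u} A} {N N' : ModuleCat.{u} B} (f : M ⟶ M')
    (g g' : N ⟶ N') : tensorHom k f (g + g') = tensorHom k f g + tensorHom k f g' :=
  tensorObj_hom_ext k fun x y => TensorProduct.tmul_add (f.hom x) (g.hom y) (g'.hom y)

theorem algebraMap_smul_tensorObj {M : ModuleCat.{u} A} {N : ModuleCat.{u} B} (c : k)
    (x : M) (y : N) :
    (algebraMap k (A ⊗[k] B) c) • (show tensorObj k A B M N from x ⊗ₜ[k] y) =
      (show tensorObj k A B M N from c • (x ⊗ₜ[k] y : M ⊗[k] N)) := by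
  refine (tmul_smul_tmul k A B M N (algebraMap k A c) 1 x y).trans ?_
  rw [one_smul]
  rfl

theorem tensorHom_smul_left {M M' : ModuleCat.{u} A} {N N' : ModuleCat.{u} B} (c : k)
    (f : M ⟶ M') (g : N ⟶ N') : tensorHom k (c • f) g = c • tensorHom k f g :=
  tensorObj_hom_ext k fun x y => (algebraMap_smul_tensorObj k c (f.hom x) (g.hom y)).symm

theorem tensorHom_smul_right {M M' : ModuleCat.{u} A} {N N' : ModuleCat.{u} B} (c : k)
    (f : M ⟶ M') (g : N ⟶ N') : tensorHom k f (c • g) = c • tensorHom k f g :=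
  tensorObj_hom_ext k fun x y => (TensorProduct.tmul_smul c (f.hom x) (g.hom y)).trans
    (algebraMap_smul_tensorObj k c (f.hom x) (g.hom y)).symm

/-- The linear map `f ⊗ g ↦ tensorHom k f g`. -/
noncomputable def tensorHomMap (M M' : ModuleCat.{u} A) (N N' : ModuleCat.{u} B) :
    (M ⟶ M') ⊗[k] (N ⟶ N') →ₗ[k] (tensorObj k A B M N ⟶ tensorObj k A B M' N') :=
  TensorProduct.lift (LinearMap.mk₂ k (tensorHom k) (tensorHom_add_left k)
    (tensorHom_smul_left k) (tensorHom_add_right k) (tensorHom_smul_right k))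

/-- A dual basis of a finitely generated projective module. -/
theorem exists_dualBasis (R : Type*) (M : Type*) [Ring R] [AddCommGroup M] [Module R M]
    [Module.Finite R M] [Module.Projective R M] :
    ∃ (n : ℕ) (m : Fin n → M) (φ : Fin n → M →ₗ[R] R), ∀ x, ∑ i, φ i x • m i = x := by
  obtain ⟨n, f, g, -, -, h⟩ := Module.Finite.exists_comp_eq_id_of_projective R M
  refine ⟨n, fun i => f (Pi.single i 1), fun i => LinearMap.proj i ∘ₗ g, fun x => ?_⟩
  have hx := LinearMap.congr_fun h x
  rw [LinearMap.comp_apply, LinearMap.id_apply] at hx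
  conv_rhs => rw [← hx, LinearMap.pi_apply_eq_sum_univ f (g x)]
  refine Finset.sum_congr rfl fun i _ => ?_
  rw [LinearMap.comp_apply, LinearMap.proj_apply]
  exact congrArg (g x i • f ·) (funext fun j => by simp [Pi.single_apply, eq_comm])

section Bijective

/-- The rank one morphism `x ↦ φ x • n`. -/
noncomputable def rankOneHom {N : ModuleCat.{u} B} (φ : N →ₗ[B] B) (N' : ModuleCat.{u} B) :
    N' →ₗ[k] (N ⟶ N') where
  toFun n := ModuleCat.ofHom (φ.smulRight n)
  map_add' a b := ModuleCat.hom_ext (LinearMap.ext fun x => smul_add (φ x) a b)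
  map_smul' c a := ModuleCat.hom_ext (LinearMap.ext fun x =>
    (by
      change φ x • algebraMap k B c • a = algebraMap k B c • φ x • a
      rw [smul_smul, smul_smul, Algebra.commutes]))

theorem tensorHomMap_map_apply {M M' : ModuleCat.{u} A} {N N' : ModuleCat.{u} B}
    (ψ : M →ₗ[A] A) (φ : N →ₗ[B] B) (u : tensorObj k A B M' N') (x : M) (y : N) :
    (tensorHomMap k M M' N N' (TensorProduct.map (rankOneHom k ψ M') (rankOneHom k φ N') u)).hom
        (show tensorObj k A B M N from x ⊗ₜ[k] y) = (ψ x ⊗ₜ[k] φ y : A ⊗[k] B) • u := by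
  change M' ⊗[k] N' at u
  induction u with
  | zero => 
    rw [map_zero, map_zero]
    exact (smul_zero (A := tensorObj k A B M' N') (ψ x ⊗ₜ[k] φ y : A ⊗[k] B)).symm
  | add u v hu hv =>
    rw [map_add, map_add]
    exact (congrArg₂ (· + ·) hu hv).trans (smul_add (A := tensorObj k A B M' N')
      (ψ x ⊗ₜ[k] φ y : A ⊗[k] B) u v).symm
  | tmul a n => rfl

theorem sum_rankOneHom {N N' : ModuleCat.{u} B} {n : ℕ} {m : Fin n → N} {φ : Fin n → N →ₗ[B] B}
    (h : ∀ x, ∑ i, φ i x • m i = x) (g : N ⟶ N') :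
    ∑ i, rankOneHom k (φ i) N' (g.hom (m i)) = g := by
  refine ModuleCat.hom_ext (LinearMap.ext fun x => ?_)
  rw [ModuleCat.hom_sum, LinearMap.sum_apply]
  conv_rhs => rw [← h x, map_sum]
  exact Finset.sum_congr rfl fun i _ => (g.hom.map_smul (φ i x) (m i)).symm

/-- An `A ⊗ B`-linear map on `M ⊗ N` is determined by its values on tensors of dual basis vectors,
and any such values are realised by rank one maps. No condition on `M'` or `N'` is needed. -/
theorem tensorHomMap_bijective (M M' : ModuleCat.{u} A) (N N' : ModuleCat.{u} B)
    [Module.Finite A M] [Module.Projective A M] [Module.Finite B N] [Module.Projective B N] :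
    Function.Bijective (tensorHomMap k M M' N N') := by
  obtain ⟨r, l, ψ, h'⟩ := exists_dualBasis A M
  obtain ⟨n, m, φ, h⟩ := exists_dualBasis B N
  -- The inverse: evaluate at `l p ⊗ m q` and spread the value out by the rank one maps of the dual
  -- forms `ψ p` and `φ q`.
  let s (t : tensorObj k A B M N ⟶ tensorObj k A B M' N') : (M ⟶ M') ⊗[k] (N ⟶ N') :=
      ∑ q : Fin r × Fin n,
        TensorProduct.map (rankOneHom k (ψ q.1) M') (rankOneHom k (φ q.2) N')
          (show M' ⊗[k] N' from t.hom (show tensorObj k A B M N from l q.1 ⊗ₜ[k] m q.2))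
  constructor
  · refine Function.LeftInverse.injective (g := s) fun t => ?_
    induction t with
    | zero =>
      refine Finset.sum_eq_zero fun i _ => ?_
      rw [map_zero]
      exact map_zero (TensorProduct.map (rankOneHom k (ψ i.1) M') (rankOneHom k (φ i.2) N'))
    | add t t' ht ht' =>
      refine Eq.trans ?_ (congrArg₂ (· + ·) ht ht')
      refine Eq.trans ?_ Finset.sum_add_distrib
      refine Finset.sum_congr rfl fun i _ => ?_
      rw [map_add]
      exact map_add (TensorProduct.map (rankOneHom k (ψ i.1) M') (rankOneHom k (φ i.2) N')) _ _
    | tmul e g =>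
      calc _ = ∑ q : Fin r × Fin n, rankOneHom k (ψ q.1) M' (e.hom (l q.1)) ⊗ₜ[k]
              rankOneHom k (φ q.2) N' (g.hom (m q.2)) := rfl
        _ = e ⊗ₜ[k] g := by
          rw [Fintype.sum_prod_type]
          simp only [← TensorProduct.tmul_sum, ← TensorProduct.sum_tmul]
          rw [sum_rankOneHom k h', sum_rankOneHom k h]
  · intro t
    refine ⟨s t, tensorObj_hom_ext k fun x y => ?_⟩
    have hxy : (∑ q : Fin r × Fin n, (ψ q.1 x ⊗ₜ[k] φ q.2 y : A ⊗[k] B) •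
        (show tensorObj k A B M N from l q.1 ⊗ₜ[k] m q.2)) =
        (show tensorObj k A B M N from x ⊗ₜ[k] y) := by
      calc _ = ∑ q : Fin r × Fin n, (ψ q.1 x • l q.1) ⊗ₜ[k] (φ q.2 y • m q.2) := rfl
        _ = x ⊗ₜ[k] y := by
          rw [Fintype.sum_prod_type]
          simp only [← TensorProduct.tmul_sum, ← TensorProduct.sum_tmul]
          rw [h', h]
    refine Eq.trans ?_ (congrArg t.hom hxy)
    rw [map_sum, map_sum, ModuleCat.hom_sum]
    refine (LinearMap.sum_apply _ _ _).trans (Finset.sum_congr rfl fun i _ => ?_)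
    exact (tensorHomMap_map_apply k (ψ i.1) (φ i.2) _ x y).trans (t.hom.map_smul _ _).symm

theorem projective_pi {ι : Type*} [Fintype ι] (N : ι → Type*) [∀ i, AddCommGroup (N i)]
    [∀ i, Module k (N i)] [∀ i, Module.Projective k (N i)] : Module.Projective k (∀ i, N i) := by
  classical
  exact Module.Projective.of_equiv' DFinsupp.linearEquivFunOnFintype

/-- Morphisms from a finitely generated projective module to a `k`-projective module form a
projective `k`-module. -/
theorem projective_hom (N N' : ModuleCat.{u} B) [Module.Finite B N]
    [Module.Projective B N] [Module.Projective k N'] : Module.Projective k (N ⟶ N') := by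
  obtain ⟨n, m, φ, h⟩ := exists_dualBasis B N
  let i : (N ⟶ N') →ₗ[k] (Fin n → N') :=
    LinearMap.pi fun i =>
      { toFun g := g.hom (m i)
        map_add' _ _ := rfl
        map_smul' _ _ := rfl }
  let r : (Fin n → N') →ₗ[k] (N ⟶ N') :=
    ∑ i, rankOneHom k (φ i) N' ∘ₗ LinearMap.proj i
  have := projective_pi k (fun _ : Fin n => (N' : Type u))
  refine Module.Projective.of_split i r (LinearMap.ext fun g => ?_)
  rw [LinearMap.comp_apply, LinearMap.sum_apply]
  exact sum_rankOneHom k h g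

/-- A projective module over a `k`-projective algebra is `k`-projective. -/
theorem projective_restrictScalars [Module.Projective k B] (N : ModuleCat.{u} B)
    [Module.Projective B N] : Module.Projective k N := by
  obtain ⟨s, hs⟩ := Module.projective_def.1 (inferInstance : Module.Projective B N)
  have : Module.Projective k (N →₀ B) := by
    classical
    exact Module.Projective.of_equiv' (finsuppLequivDFinsupp k).symm
  refine Module.Projective.of_split (M := N →₀ B) (s.restrictScalars k)
    ((Finsupp.linearCombination B id).restrictScalars k) (LinearMap.ext hs)

end Bijective

end TensorHom

/-! ### The Hom complex and the splitting of its differentials. -/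

section Cochain

open CochainComplex CochainComplex.HomComplex

/-- The equivalences are allowed to commute with the maps only up to a sign, since shifting the
target changes the differential of the Hom complex by a sign. -/
theorem exists_quasiInverse_of_linearEquiv {k C D C' D' : Type*} [CommRing k] [AddCommGroup C]
    [AddCommGroup D] [AddCommGroup C'] [AddCommGroup D'] [Module k C] [Module k D] [Module k C']
    [Module k D'] {g : C →ₗ[k] D} {g' : C' →ₗ[k] D'} {e : C ≃ₗ[k] C'} {e' : D ≃ₗ[k] D'} (u : ℤˣ)
    (h : ∀ x, g' (e x) = u • e' (g x)) {t : D →ₗ[k] C} (ht : ∀ x, g (t (g x)) = g x) :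
    ∃ t' : D' →ₗ[k] C', ∀ x, g' (t' (g' x)) = g' x := by
  refine ⟨(u : ℤ) • (e.toLinearMap ∘ₗ t ∘ₗ e'.symm.toLinearMap), fun y => ?_⟩
  obtain ⟨x, rfl⟩ := e.surjective y
  have h₁ : t (e'.symm (u • e' (g x))) = u • t (g x) := by
    rw [Units.smul_def, map_zsmul, map_zsmul, e'.symm_apply_apply,
      Units.smul_def]
  rw [h x, LinearMap.smul_apply, map_zsmul, LinearMap.comp_apply, LinearMap.comp_apply]
  refine (congrArg (fun y => (u : ℤ) • g' (e y)) h₁).trans ?_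
  rw [Units.smul_def, map_zsmul, map_zsmul, smul_smul, ← Units.val_mul, Int.units_mul_self,
    Units.val_one, one_smul, h (t (g x)), ht]

variable (k : Type*) [CommRing k]

section

variable {C : Type*} [Category* C] [Preadditive C] [Linear k C] (P L : CochainComplex C ℤ)

/-- The differential of the complex of morphisms from degree `n` to degree `m` is von Neumann
regular. -/
def HasQuasiInverse (n m : ℤ) : Prop :=
  ∃ t : Cochain P L m →ₗ[k] Cochain P L n, ∀ z, δ n m (t (δ n m z)) = δ n m z

variable {P L}

/-- This moves any degree to degree zero, where cocycles are chain maps and cohomology classes are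
morphisms in the derived category. -/
theorem hasQuasiInverse_shift_iff (n m a n' m' : ℤ) (hn : n' + a = n) (hm : m' + a = m) :
    HasQuasiInverse k P (L⟦a⟧) n' m' ↔ HasQuasiInverse k P L n m :=
  have h (z : Cochain P L n) : δ_hom k P (L⟦a⟧) n' m'
      (Cochain.rightShiftLinearEquiv k P L n a n' hn z) =
      a.negOnePow • Cochain.rightShiftLinearEquiv k P L m a m' hm (δ_hom k P L n m z) :=
    Cochain.δ_rightShift z a n' m' hn m hm
  ⟨fun ⟨_, ht⟩ => exists_quasiInverse_of_linearEquiv (g := δ_hom k P (L⟦a⟧) n' m')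
    (g' := δ_hom k P L n m)
    (e := (Cochain.rightShiftLinearEquiv k P L n a n' hn).symm)
    (e' := (Cochain.rightShiftLinearEquiv k P L m a m' hm).symm) (a.negOnePow)
    (fun z => (Cochain.rightShiftLinearEquiv k P L m a m' hm).injective (by
      have h' := h ((Cochain.rightShiftLinearEquiv k P L n a n' hn).symm z)
      rw [LinearEquiv.apply_symm_apply] at h'
      rw [Units.smul_def, map_zsmul, LinearEquiv.apply_symm_apply, h', ← Units.smul_def,
        smul_smul, Int.units_mul_self, one_smul])) ht,
  fun ⟨_, ht⟩ => exists_quasiInverse_of_linearEquiv (g := δ_hom k P L n m)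
    (g' := δ_hom k P (L⟦a⟧) n' m') a.negOnePow h ht⟩

variable (P L)

/-- A morphism of complexes, as a cochain of degree zero. -/
noncomputable def ofHomLinear : (P ⟶ L) →ₗ[k] Cochain P L 0 where
  toFun f := Cochain.ofHom f
  map_add' f g := Cochain.ofHom_add f g
  map_smul' c f := by ext; simp

theorem ofHomLinear_injective : Function.Injective (ofHomLinear k P L) :=
  fun _ _ h => Cochain.ofHom_injective h

theorem exact_ofHomLinear : Function.Exact (ofHomLinear k P L) (δ_hom k P L 0 1) := by
  intro z
  constructor
  · intro hz
    exact ⟨Cocycle.homOf (Cocycle.mk z 1 (zero_add 1) hz), Cocycle.cochain_ofHom_homOf_eq_coe _⟩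
  · rintro ⟨f, rfl⟩
    exact δ_ofHom f

/-- The component of a cochain. -/
noncomputable def cochainEval (p q n : ℤ) (h : p + n = q) :
    Cochain P L n →ₗ[k] (P.X p ⟶ L.X q) where
  toFun z := z.v p q h
  map_add' _ _ := rfl
  map_smul' _ _ := rfl

/-- The cochain with a single component. -/
noncomputable def cochainSingle (p q n : ℤ) :
    (P.X p ⟶ L.X q) →ₗ[k] Cochain P L n where
  toFun f := Cochain.single f n
  map_add' f g := by
    ext p' q' h
    by_cases hp : p' = p
    · subst hp
      by_cases hq : q' = q
      · subst hq
        simp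
      · simp [Cochain.single_v_eq_zero' _ _ _ _ _ hq]
    · simp [Cochain.single_v_eq_zero _ _ _ _ _ hp]
  map_smul' c f := by
    ext p' q' h
    by_cases hp : p' = p
    · subst hp
      by_cases hq : q' = q
      · subst hq
        simp
      · simp [Cochain.single_v_eq_zero' _ _ _ _ _ hq]
    · simp [Cochain.single_v_eq_zero _ _ _ _ _ hp]

/-- As `P` is bounded, a cochain is the finite sum of its components, so the cochains form a finite
direct sum of modules of morphisms. -/
theorem sum_cochainSingle_cochainEval {a b : ℤ} (h : ∀ p, p ∉ Finset.Icc a b → IsZero (P.X p))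
    (n : ℤ) :
    ∑ p ∈ Finset.Icc a b, cochainSingle k P L p (p + n) n ∘ₗ
      cochainEval k P L p (p + n) n rfl = .id := by
  refine LinearMap.ext fun z => ?_
  rw [LinearMap.sum_apply]
  ext p q hpq
  obtain rfl := hpq
  by_cases hp : p ∈ Finset.Icc a b
  · refine (map_sum (cochainEval k P L p (p + n) n rfl) (fun i => cochainSingle k P L i (i + n) n
      (cochainEval k P L i (i + n) n rfl z)) (Finset.Icc a b)).trans ?_
    rw [Finset.sum_eq_single p]
    · exact Cochain.single_v _ n rfl
    · intro i _ hi
      exact Cochain.single_v_eq_zero _ n p (p + n) rfl hi.symm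
    · exact fun h => absurd hp h
  · exact (h p hp).eq_of_src _ _

theorem projective_cochain {a b : ℤ} (h : ∀ p, p ∉ Finset.Icc a b → IsZero (P.X p)) (n : ℤ)
    [∀ p q, Module.Projective k (P.X p ⟶ L.X q)] : Module.Projective k (Cochain P L n) := by
  have := projective_pi k (fun p : Finset.Icc a b => (P.X p ⟶ L.X (p + n)))
  refine Module.Projective.of_split (M := ∀ p : Finset.Icc a b, (P.X p ⟶ L.X (p + n)))
    (LinearMap.pi fun p => cochainEval k P L p (p + n) n rfl)
    (∑ p : Finset.Icc a b, cochainSingle k P L p (p + n) n ∘ₗ LinearMap.proj p) ?_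
  rw [← sum_cochainSingle_cochainEval k P L h n, ← Finset.sum_coe_sort (Finset.Icc a b)]
  refine LinearMap.ext fun z => ?_
  rw [LinearMap.comp_apply, LinearMap.sum_apply, LinearMap.sum_apply]
  rfl

end

section Derived

variable {R : Type u} [Ring R] [HasDerivedCategory.{w₁} (ModuleCat.{u} R)]
  [Linear k (ModuleCat.{u} R)] (P L : CochainComplex (ModuleCat.{u} R) ℤ)

/-- The localization functor on morphisms of complexes. -/
noncomputable abbrev QLinear :
    (P ⟶ L) →ₗ[k] (DerivedCategory.Q.obj P ⟶ DerivedCategory.Q.obj L) :=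
  DerivedCategory.Q.mapLinearMap k

variable [P.IsKProjective]

/-- As `P` is K-projective, a chain map vanishes in the derived category exactly if it is
null-homotopic. Thus `QLinear` is the projection from degree zero cocycles to cohomology. -/
theorem QLinear_eq_zero_iff (f : P ⟶ L) :
    QLinear k P L f = 0 ↔ ∃ c, δ_hom k P L (-1) 0 c = ofHomLinear k P L f := by
  constructor
  · intro h
    have h' : DerivedCategory.Q.map f = DerivedCategory.Q.map (0 : P ⟶ L) :=
      h.trans (DerivedCategory.Q.map_zero _ _).symm
    obtain ⟨c, hc⟩ := Cochain.equivHomotopy _ _ (homotopy_of_Q_map_eq h').some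
    exact ⟨c, by
      rw [Cochain.ofHom_zero, add_zero] at hc
      exact hc.symm⟩
  · rintro ⟨c, hc⟩
    have h : Homotopy f 0 := (Cochain.equivHomotopy _ _).symm ⟨c, by
      rw [Cochain.ofHom_zero, add_zero]
      exact hc.symm⟩
    exact (DerivedCategory.Q_map_eq_of_homotopy _ h).trans (DerivedCategory.Q.map_zero _ _)

/-- Descending induction on the degree. The Hom complex vanishes in high degrees, and
`exists_quasiInverse` passes from one differential to the preceding one because terms and cohomology
are projective over `k`. -/
theorem hasQuasiInverse_of_projective {a b : ℤ} (hP : ∀ p, p ∉ Finset.Icc a b → IsZero (P.X p))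
    {c : ℤ} (hL : ∀ p, c ≤ p → IsZero (L.X p))
    [∀ p q, Module.Projective k (P.X p ⟶ L.X q)]
    [∀ n : ℤ, Module.Projective k (DerivedCategory.Q.obj P ⟶ DerivedCategory.Q.obj (L⟦n⟧))]
    (n : ℤ) : HasQuasiInverse k P L n (n + 1) := by
  have step (n : ℤ) (h : HasQuasiInverse k P L n (n + 1)) : HasQuasiInverse k P L (n - 1) n := by
    rw [← hasQuasiInverse_shift_iff k n (n + 1) n 0 1 (zero_add n) (add_comm 1 n)] at h
    rw [← hasQuasiInverse_shift_iff k (n - 1) n n (-1) 0 (by lia) (zero_add n)]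
    obtain ⟨t, ht⟩ := h
    have (p q : ℤ) : Module.Projective k (P.X p ⟶ (L⟦n⟧).X q) :=
      inferInstanceAs (Module.Projective k (P.X p ⟶ L.X (q + n)))
    have := projective_cochain k P (L⟦n⟧) hP 0
    exact exists_quasiInverse (ofHomLinear_injective k P (L⟦n⟧)) (exact_ofHomLinear k P (L⟦n⟧))
      (π := QLinear k P (L⟦n⟧)) (Q_map_surjective P (L⟦n⟧)) (QLinear_eq_zero_iff k P (L⟦n⟧))
      (f := δ_hom k P (L⟦n⟧) (-1) 0) (fun z => δ_δ _ _ _ z) ht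
  -- A component of degree `n + 1` leaves a degree `≥ a` and lands in a degree above `c`, where `L`
  -- is zero; so the target of the differential is trivial and `t = 0` works.
  have base (n : ℤ) (h : c - a ≤ n) : HasQuasiInverse k P L n (n + 1) := ⟨0, fun z => by
    refine Cochain.ext _ _ fun p q hpq => ?_
    by_cases hp : p ∈ Finset.Icc a b
    · rw [Finset.mem_Icc] at hp
      exact (hL q (by lia)).eq_of_tgt _ _
    · exact (hP p hp).eq_of_src _ _⟩
  rcases le_total (c - a) n with h | h
  · exact base n h
  · refine Int.leInductionDown (motive := fun n _ => HasQuasiInverse k P L n (n + 1))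
      (base _ le_rfl) (fun n _ hn => ?_) n h
    simpa using step n hn

end Derived

end Cochain

/-! ### Hom complexes between `M ⊗ P` and `M' ⊗ L`. -/

section TensorLeft

open CochainComplex CochainComplex.HomComplex

variable (k : Type u) {A B : Type u} [CommRing k] [Ring A] [Algebra k A] [Ring B] [Algebra k B]

instance : (tensorBifunctor k A B).Additive where
  map_add {M M' f g} := by
    ext N : 2
    exact tensorHom_add_left k f g (𝟙 N)

instance (M : ModuleCat.{u} A) : ((tensorBifunctor k A B).obj M).Additive where
  map_add {_ _ f g} := tensorHom_add_right k (𝟙 M) f g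

instance (M : ModuleCat.{u} A) : ((tensorBifunctor k A B).obj M).Linear k where
  map_smul f c := tensorHom_smul_right k c (𝟙 M) f

instance (N : ModuleCat.{u} B) : ((tensorBifunctor k A B).flip.obj N).Linear k where
  map_smul f c := tensorHom_smul_left k c f (𝟙 N)

theorem finite_projective_of_dualBasis {R M : Type*} [Ring R] [AddCommGroup M] [Module R M]
    {ι : Type*} [Fintype ι] (m : ι → M) (φ : ι → M →ₗ[R] R) (h : ∀ x, ∑ i, φ i x • m i = x) :
    Module.Finite R M ∧ Module.Projective R M := by
  classical
  have h' : Fintype.linearCombination R m ∘ₗ LinearMap.pi φ = .id := LinearMap.ext h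
  exact ⟨.of_surjective (Fintype.linearCombination R m) fun x => ⟨_, h x⟩, .of_split _ _ h'⟩

/-- The linear form `ψ ⊗ φ` on a tensor product. -/
noncomputable def tensorForm {M : ModuleCat.{u} A} {N : ModuleCat.{u} B} (ψ : M →ₗ[A] A)
    (φ : N →ₗ[B] B) : tensorObj k A B M N →ₗ[A ⊗[k] B] A ⊗[k] B :=
  letI := tensorModule k A B M N
  show (M ⊗[k] N) →ₗ[A ⊗[k] B] A ⊗[k] B from
  { TensorProduct.map (ψ.restrictScalars k) (φ.restrictScalars k) with
    map_smul' := by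
      intro s t
      induction s with
      | zero => simp
      | add s₁ s₂ h₁ h₂ =>
        simp only [AddHom.toFun_eq_coe, LinearMap.coe_toAddHom, RingHom.id_apply] at h₁ h₂ ⊢
        rw [add_smul, add_smul, map_add, h₁, h₂]
      | tmul a b =>
        induction t with
        | zero => simp
        | add t₁ t₂ h₁ h₂ =>
          simp only [AddHom.toFun_eq_coe, LinearMap.coe_toAddHom, RingHom.id_apply] at h₁ h₂ ⊢
          rw [smul_add, map_add, map_add, smul_add, h₁, h₂]
        | tmul x y =>
          exact (congrArg₂ (fun u v => (u ⊗ₜ[k] v : A ⊗[k] B)) (ψ.map_smul a x)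
            (φ.map_smul b y)).trans
              (Algebra.TensorProduct.tmul_mul_tmul a (ψ x) b (φ y)).symm }

theorem tensorObj_finite_projective (M : ModuleCat.{u} A) (N : ModuleCat.{u} B)
    [Module.Finite A M] [Module.Projective A M] [Module.Finite B N] [Module.Projective B N] :
    Module.Finite (A ⊗[k] B) (tensorObj k A B M N) ∧
      Module.Projective (A ⊗[k] B) (tensorObj k A B M N) := by
  obtain ⟨r, l, ψ, h'⟩ := exists_dualBasis A M
  obtain ⟨n, m, φ, h⟩ := exists_dualBasis B N
  have hid : ModuleCat.ofHom (∑ q : Fin r × Fin n, (tensorForm k (ψ q.1) (φ q.2)).smulRight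
      (show tensorObj k A B M N from l q.1 ⊗ₜ[k] m q.2)) = 𝟙 (tensorObj k A B M N) := by
    refine tensorObj_hom_ext k fun x y => (LinearMap.sum_apply _ _ _).trans ?_
    calc _ = ∑ q : Fin r × Fin n, (ψ q.1 x • l q.1) ⊗ₜ[k] (φ q.2 y • m q.2) := rfl
      _ = x ⊗ₜ[k] y := by
        rw [Fintype.sum_prod_type]
        simp only [← TensorProduct.tmul_sum, ← TensorProduct.sum_tmul]
        rw [h', h]
  exact finite_projective_of_dualBasis (M := tensorObj k A B M N) (ι := Fin r × Fin n)
    (fun q => (show tensorObj k A B M N from l q.1 ⊗ₜ[k] m q.2))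
    (fun q => tensorForm k (ψ q.1) (φ q.2)) fun t => (LinearMap.sum_apply _ _ _).symm.trans
      (congrArg (fun f => f.hom t) hid)

/-- The functor `M ⊗ -` on complexes. -/
noncomputable abbrev tensorLeft (M : ModuleCat.{u} A) :
    CochainComplex (ModuleCat.{u} B) ℤ ⥤ CochainComplex (ModuleCat.{u} (A ⊗[k] B)) ℤ :=
  ((tensorBifunctor k A B).obj M).mapHomologicalComplex (.up ℤ)

theorem isFGProjIcc_tensorLeft (M : ModuleCat.{u} A) [Module.Finite A M] [Module.Projective A M]
    {P : CochainComplex (ModuleCat.{u} B) ℤ} {a b : ℤ} (hP : IsFGProjIcc P a b) :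
    IsFGProjIcc ((tensorLeft k M).obj P) a b where
  ge := by
    have := hP.ge
    rw [CochainComplex.isStrictlyGE_iff] at this ⊢
    exact fun i hi => ((tensorBifunctor k A B).obj M).map_isZero (this i hi)
  le := by
    have := hP.le
    rw [CochainComplex.isStrictlyLE_iff] at this ⊢
    exact fun i hi => ((tensorBifunctor k A B).obj M).map_isZero (this i hi)
  finite m := by
    have := hP.finite m
    have := hP.projective m
    exact (tensorObj_finite_projective k M (P.X m)).1
  projective m := by
    have := hP.finite m
    have := hP.projective m
    exact (tensorObj_finite_projective k M (P.X m)).2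

variable {M M' : ModuleCat.{u} A} {P L : CochainComplex (ModuleCat.{u} B) ℤ}

/-- The morphism `e ⊗ f` on complexes. -/
noncomputable def tensorLeftMap (e : M ⟶ M') (f : P ⟶ L) :
    (tensorLeft k M).obj P ⟶ (tensorLeft k M').obj L where
  f n := tensorHom k e (f.f n)
  comm' i j _ := (tensorHom_comp k e (𝟙 M') (f.f i) (L.d i j)).symm.trans ((congrArg₂ (tensorHom k)
      ((Category.comp_id e).trans (Category.id_comp e).symm) (f.comm i j)).trans
        (tensorHom_comp k (𝟙 M) e (P.d i j) (f.f j)))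

variable (M M' P L)

/-- The linear map `e ⊗ f ↦ tensorLeftMap e f`. -/
noncomputable def tensorLeftMapLinear :
    (M ⟶ M') ⊗[k] (P ⟶ L) →ₗ[k] ((tensorLeft k M).obj P ⟶ (tensorLeft k M').obj L) :=
  TensorProduct.lift (LinearMap.mk₂ k (tensorLeftMap k)
    (fun e e' f => HomologicalComplex.hom_ext _ _ fun n => tensorHom_add_left k e e' (f.f n))
    (fun c e f => HomologicalComplex.hom_ext _ _ fun n => tensorHom_smul_left k c e (f.f n))
    (fun e f f' => HomologicalComplex.hom_ext _ _ fun n =>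
      tensorHom_add_right k e (f.f n) (f'.f n))
    (fun c e f => HomologicalComplex.hom_ext _ _ fun n => tensorHom_smul_right k c e (f.f n)))

/-- The tensor product of a morphism of modules and a cochain. -/
noncomputable def tensorCochain (n : ℤ) : (M ⟶ M') ⊗[k] Cochain P L n →ₗ[k]
    Cochain ((tensorLeft k M).obj P) ((tensorLeft k M').obj L) n :=
  TensorProduct.lift (LinearMap.mk₂ k
    (fun e z => Cochain.mk fun p q h => tensorHom k e (z.v p q h))
    (fun e e' z => Cochain.ext _ _ fun p q h => tensorHom_add_left k e e' (z.v p q h))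
    (fun c e z => Cochain.ext _ _ fun p q h => tensorHom_smul_left k c e (z.v p q h))
    (fun e z z' => Cochain.ext _ _ fun p q h => tensorHom_add_right k e (z.v p q h) (z'.v p q h))
    (fun c e z => Cochain.ext _ _ fun p q h => tensorHom_smul_right k c e (z.v p q h)))

variable {M M' P L}

theorem tensorCochain_tmul_v (e : M ⟶ M') {n : ℤ} (z : Cochain P L n) (p q : ℤ) (h : p + n = q) :
    (tensorCochain k M M' P L n (e ⊗ₜ z)).v p q h = tensorHom k e (z.v p q h) := rfl

/-- The module factor sits in degree zero, so no sign enters and the differential acts on the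
cochain factor alone. -/
theorem tensorCochain_lTensor_δ (n m : ℤ) (hnm : n + 1 = m) (x : (M ⟶ M') ⊗[k] Cochain P L n) :
    tensorCochain k M M' P L m ((δ_hom k P L n m).lTensor _ x) =
      δ_hom k _ _ n m (tensorCochain k M M' P L n x) := by
  induction x with
  | zero => simp only [map_zero]
  | add x y hx hy => simp only [map_add, hx, hy]
  | tmul e z =>
    refine Cochain.ext _ _ fun p q h => ?_
    rw [LinearMap.lTensor_tmul, tensorCochain_tmul_v]
    refine Eq.trans ?_ (δ_v n m hnm _ p q h (q - 1) (p + 1) rfl rfl).symm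
    refine (congrArg (tensorHom k e) (δ_v n m hnm z p q h (q - 1) (p + 1) rfl rfl)).trans ?_
    rw [tensorHom_add_right, Units.smul_def, Units.smul_def]
    refine congrArg₂ (· + ·) ?_ ?_
    · exact ((congrArg (tensorHom k · _) (Category.comp_id e)).symm.trans
        (tensorHom_comp k e (𝟙 M') _ _))
    · have (c : ℤ) {N N' : ModuleCat.{u} B} (g : N ⟶ N') :
          tensorHom k e (c • g) = c • tensorHom k e g :=
        map_zsmul (tensorHomMap k M M' N N' ∘ₗ TensorProduct.mk k _ _ e) c g
      rw [this]
      exact congrArg _ ((congrArg (tensorHom k · _) (Category.id_comp e)).symm.trans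
        (tensorHom_comp k (𝟙 M) e _ _))

theorem cochainEval_tensorCochain (p q n : ℤ) (h : p + n = q) (x : (M ⟶ M') ⊗[k] Cochain P L n) :
    cochainEval k _ _ p q n h (tensorCochain k M M' P L n x) =
      tensorHomMap k M M' (P.X p) (L.X q) ((cochainEval k P L p q n h).lTensor _ x) := by
  induction x with
  | zero => simp only [map_zero]; rfl
  | add x y hx hy => simp only [map_add, hx, hy]; rfl
  | tmul e z => rfl

theorem tensorCochain_lTensor_cochainSingle (p q n : ℤ) (h : p + n = q)
    (x : (M ⟶ M') ⊗[k] (P.X p ⟶ L.X q)) :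
    tensorCochain k M M' P L n ((cochainSingle k P L p q n).lTensor _ x) =
      cochainSingle k ((tensorLeft k M).obj P) ((tensorLeft k M').obj L) p q n
        (tensorHomMap k M M' (P.X p) (L.X q) x) := by
  induction x with
  | zero =>
    simp only [map_zero]
    exact (map_zero (cochainSingle k ((tensorLeft k M).obj P) ((tensorLeft k M').obj L) p q n)).symm
  | add x y hx hy =>
    simp only [map_add, hx, hy]
    exact (map_add (cochainSingle k ((tensorLeft k M).obj P) ((tensorLeft k M').obj L) p q n)
      _ _).symm
  | tmul e f =>
    refine Cochain.ext _ _ fun p' q' h' => ?_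
    rw [LinearMap.lTensor_tmul, tensorCochain_tmul_v]
    by_cases hp : p' = p
    · subst hp
      obtain rfl : q' = q := by lia
      exact (congrArg (tensorHom k e) (Cochain.single_v f n h')).trans
        (Cochain.single_v (K := (tensorLeft k M).obj P) (L := (tensorLeft k M').obj L)
          (tensorHom k e f) n h').symm
    · exact (congrArg (tensorHom k e) (Cochain.single_v_eq_zero f n p' q' h' hp)).trans
        ((tensorHom_zero_right k e).trans (Cochain.single_v_eq_zero (K := (tensorLeft k M).obj P)
          (L := (tensorLeft k M').obj L) (tensorHom k e f) n p' q' h' hp).symm)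

/-- Boundedness of `P` makes cochains finite sums of components, and in each component this is
`tensorHomMap_bijective`. -/
theorem tensorCochain_bijective [Module.Finite A M] [Module.Projective A M]
    [∀ p, Module.Finite B (P.X p)] [∀ p, Module.Projective B (P.X p)] {a b : ℤ}
    (hP : ∀ p, p ∉ Finset.Icc a b → IsZero (P.X p)) (n : ℤ) :
    Function.Bijective (tensorCochain k M M' P L n) := by
  constructor
  · rw [injective_iff_map_eq_zero]
    intro x hx
    have h (p : ℤ) : (cochainEval k P L p (p + n) n rfl).lTensor _ x = 0 := by
      apply (tensorHomMap_bijective k M M' (P.X p) (L.X (p + n))).1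
      rw [map_zero, ← cochainEval_tensorCochain, hx]
      exact map_zero _
    have h' := LinearMap.congr_fun (congrArg (LinearMap.lTensor (M ⟶ M'))
      (sum_cochainSingle_cochainEval k P L hP n)) x
    rw [LinearMap.lTensor_id, LinearMap.id_apply] at h'
    rw [← h', ← LinearMap.coe_lTensorHom, map_sum, LinearMap.sum_apply]
    refine Finset.sum_eq_zero fun p _ => ?_
    rw [LinearMap.coe_lTensorHom, LinearMap.lTensor_comp, LinearMap.comp_apply, h, map_zero]
  · intro y
    have hP' (p : ℤ) (hp : p ∉ Finset.Icc a b) : IsZero (((tensorLeft k M).obj P).X p) :=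
      ((tensorBifunctor k A B).obj M).map_isZero (hP p hp)
    choose u hu using fun p => (tensorHomMap_bijective k M M' (P.X p) (L.X (p + n))).2
      (cochainEval k ((tensorLeft k M).obj P) ((tensorLeft k M').obj L) p (p + n) n rfl y)
    refine ⟨∑ p ∈ Finset.Icc a b, (cochainSingle k P L p (p + n) n).lTensor _ (u p), ?_⟩
    refine Eq.trans ?_ (LinearMap.congr_fun (sum_cochainSingle_cochainEval k
      ((tensorLeft k M).obj P) ((tensorLeft k M').obj L) hP' n) y)
    rw [map_sum, LinearMap.sum_apply]
    refine Finset.sum_congr rfl fun p _ => ?_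
    rw [tensorCochain_lTensor_cochainSingle k p (p + n) n rfl, hu]
    rfl

end TensorLeft

/-! ### The Künneth formula over a single finitely generated projective `A`-module. -/

section Base

variable (k : Type u) {A B : Type u} [CommRing k] [Ring A] [Algebra k A] [Ring B] [Algebra k B]
  [HasDerivedCategory.{w₂} (ModuleCat.{u} B)]
  [HasDerivedCategory.{w₃} (ModuleCat.{u} (A ⊗[k] B))]
  {M M' : ModuleCat.{u} A} {P L : CochainComplex (ModuleCat.{u} B) ℤ}

/-- The Künneth formula for morphisms between tensor products of a finitely generated projective
module with bounded complexes of finitely generated projective modules. -/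
theorem bijective_of_apply_tmul_Q_map [Module.Projective k B] [Module.Finite A M]
    [Module.Projective A M] {a b a' b' : ℤ} (hP : IsFGProjIcc P a b) (hL : IsFGProjIcc L a' b')
    [∀ n : ℤ, Module.Projective k (DerivedCategory.Q.obj P ⟶ DerivedCategory.Q.obj (L⟦n⟧))]
    [Module.Projective k (DerivedCategory.Q.obj P ⟶ DerivedCategory.Q.obj L)]
    (θ : (M ⟶ M') ⊗[k] (DerivedCategory.Q.obj P ⟶ DerivedCategory.Q.obj L) →ₗ[k]
      (DerivedCategory.Q.obj ((tensorLeft k M).obj P) ⟶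
        DerivedCategory.Q.obj ((tensorLeft k M').obj L)))
    (hθ : ∀ (e : M ⟶ M') (f : P ⟶ L), θ (e ⊗ₜ DerivedCategory.Q.map f) =
      DerivedCategory.Q.map (tensorLeftMap k e f)) :
    Function.Bijective θ := by
  have := hP.isKProjective
  have := (isFGProjIcc_tensorLeft k M hP).isKProjective
  have := hP.finite
  have := hP.projective
  have := hL.projective
  have (p : ℤ) : Module.Projective k (L.X p) := projective_restrictScalars k (L.X p)
  have (p q : ℤ) : Module.Projective k (P.X p ⟶ L.X q) := projective_hom k _ _
  have hge := hP.ge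
  have hle := hP.le
  have hle' := hL.le
  rw [CochainComplex.isStrictlyGE_iff] at hge
  rw [CochainComplex.isStrictlyLE_iff] at hle hle'
  have hP' (p : ℤ) (hp : p ∉ Finset.Icc a b) : IsZero (P.X p) := by
    rw [Finset.mem_Icc, not_and_or, not_le, not_le] at hp
    exact hp.elim (fun h => hge p h) (hle p)
  -- Only the differential leaving degree zero has to be split in order to compute degree zero
  -- cohomology after tensoring.
  obtain ⟨t, ht⟩ := hasQuasiInverse_of_projective k P L hP' (c := b' + 1)
    (fun p hp => hle' p (by lia)) 0
  exact tensor_cohomology_bijective (f := CochainComplex.HomComplex.δ_hom k P L (-1) 0)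
    (ofHomLinear_injective k P L) (exact_ofHomLinear k P L)
    (π := QLinear k P L) (Q_map_surjective P L) (QLinear_eq_zero_iff k P L)
    (fun z => CochainComplex.HomComplex.δ_δ _ _ _ z) ht
    (ofHomLinear_injective k _ _) (exact_ofHomLinear k _ _) (π' := QLinear k _ _)
    (Q_map_surjective _ _) (QLinear_eq_zero_iff k _ _)
    (tensorCochain_bijective k hP' (-1)).2 (tensorCochain_bijective k hP' 0)
    (tensorCochain_bijective k hP' 1).1
    (tensorCochain_lTensor_δ k (-1) 0 rfl) (tensorCochain_lTensor_δ k 0 1 rfl)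
    (ζ := tensorLeftMapLinear k M M' P L) (θ := θ)
    (fun x => by
      induction x with
      | zero => simp only [map_zero]
      | add x y hx hy => simp only [map_add, hx, hy]
      | tmul e f =>
        refine CochainComplex.HomComplex.Cochain.ext₀ _ _ fun p => ?_
        exact (CochainComplex.HomComplex.Cochain.ofHom_v _ p).trans (congrArg (tensorHom k e)
          (CochainComplex.HomComplex.Cochain.ofHom_v f p)).symm)
    (fun x => by
      induction x with
      | zero => simp only [map_zero]
      | add x y hx hy => simp only [map_add, hx, hy]
      | tmul e f => exact hθ e f)

end Base

/-! ### Bounded complexes with `k`-flat terms are flat. -/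

section Flat

open CochainComplex

theorem acyclic_of_iso {C : Type*} [Category* C] [Abelian C] {K L : CochainComplex C ℤ}
    (e : K ≅ L) (h : K.Acyclic) : L.Acyclic := fun i => (h i).of_iso e

variable (k : Type u) {A B : Type u} [CommRing k] [Ring A] [Algebra k A] [Ring B] [Algebra k B]

theorem exact_tensorHom_of_flat (N : ModuleCat.{u} B) [Module.Flat k N] {M₁ M₂ M₃ : ModuleCat.{u} A}
    (f : M₁ ⟶ M₂) (g : M₂ ⟶ M₃) (h : Function.Exact f.hom g.hom) :
    Function.Exact (tensorHom k f (𝟙 N)).hom (tensorHom k g (𝟙 N)).hom :=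
  Module.Flat.rTensor_exact N (f := f.hom.restrictScalars k) (g := g.hom.restrictScalars k) h

instance : (tensorBifunctor k A B).flip.Additive where
  map_add {_ _ f g} := by
    ext M : 2
    exact tensorHom_add_right k (𝟙 M) f g

instance (N : ModuleCat.{u} B) : ((tensorBifunctor k A B).flip.obj N).Additive where
  map_add {_ _ f g} := tensorHom_add_left k f g (𝟙 N)

theorem acyclic_flip_map (N : ModuleCat.{u} B) [Module.Flat k N]
    {X : CochainComplex (ModuleCat.{u} A) ℤ} (hX : X.Acyclic) :
    ((((tensorBifunctor k A B).flip.obj N).mapHomologicalComplex (.up ℤ)).obj X).Acyclic := by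
  intro n
  have h := hX n
  rw [HomologicalComplex.exactAt_iff, ShortComplex.moduleCat_exact_iff] at h ⊢
  have h' := exact_tensorHom_of_flat k N (X.sc n).f (X.sc n).g fun x =>
    ⟨h x, by
      rintro ⟨y, rfl⟩
      exact LinearMap.congr_fun (congrArg ModuleCat.Hom.hom (X.sc n).zero) y⟩
  exact fun x hx => (h' x).1 hx

/-- Fix an acyclic `X`. The complexes in the second variable whose tensor product with `X` is
acyclic form a triangulated subcategory, seen through the flipped bifunctor. Dévissage reduces to
one flat module, where exactness is termwise. -/
theorem isTensorFlat_of_bounded (P : CochainComplex (ModuleCat.{u} B) ℤ) (a b : ℤ)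
    [P.IsStrictlyGE a] [P.IsStrictlyLE b] (hP : ∀ n, Module.Flat k (P.X n)) :
    IsTensorFlat (tensorBifunctor k A B) P where
  acyclic X hX := by
    have h := quotient_obj_mem_of_forall_single_mem
      ((HomotopyCategory.subcategoryAcyclic (ModuleCat.{u} (A ⊗[k] B))).inverseImage
        (mapHomotopyCategory₁ (tensorBifunctor k A B).flip X))
      (fun N : ModuleCat.{u} B => Module.Flat k N) (fun N hN => ?_) (fun N N' e hN => ?_)
      (fun N hN => ?_) P a b hP
    · exact acyclic_of_iso (HomologicalComplex.mapBifunctorFlipIso X P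
        (tensorBifunctor k A B) (.up ℤ))
        ((HomotopyCategory.quotient_obj_mem_subcategoryAcyclic_iff_acyclic _).1 h)
    · exact (HomotopyCategory.quotient_obj_mem_subcategoryAcyclic_iff_acyclic _).2
        (acyclic_of_iso (mapBifunctorSingleIso (tensorBifunctor k A B).flip N X)
          (acyclic_flip_map k N hX))
    · exact Module.Flat.of_linearEquiv (e.toLinearEquiv.restrictScalars k).symm
    · have := ModuleCat.subsingleton_of_isZero hN
      have := Module.Free.of_subsingleton k N
      infer_instance

theorem IsFGProjIcc.isTensorFlat [Module.Projective k B] {P : CochainComplex (ModuleCat.{u} B) ℤ}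
    {a b : ℤ} (hP : IsFGProjIcc P a b) : IsTensorFlat (tensorBifunctor k A B) P := by
  have := hP.ge
  have := hP.le
  refine isTensorFlat_of_bounded k P a b fun n => ?_
  have := hP.projective n
  have := projective_restrictScalars k (P.X n)
  infer_instance

end Flat

/-! ### Naturality of the comparison with complexes. -/

section Naturality

open CochainComplex

variable {C₁ C₂ D : Type*} [Category* C₁] [Category* C₂] [Category* D]
  [Abelian C₁] [Preadditive C₂] [Abelian D]
  (F : C₁ ⥤ C₂ ⥤ D) [F.Additive] [∀ X, (F.obj X).Additive]
  [∀ (K₁ : CochainComplex C₁ ℤ) (K₂ : CochainComplex C₂ ℤ), HasMapBifunctor K₁ K₂ F]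
  [HasDerivedCategory.{w₁} C₁] [HasDerivedCategory.{w₃} D]

theorem mapDerivedCategory₁ObjIso_hom_naturality (Y : CochainComplex C₂ ℤ) [IsTensorFlat F Y]
    {X X' : CochainComplex C₁ ℤ} (f : X ⟶ X') :
    (mapDerivedCategory₁ F Y).map (DerivedCategory.Q.map f) ≫
        (mapDerivedCategory₁ObjIso F Y X').hom =
      (mapDerivedCategory₁ObjIso F Y X).hom ≫
        DerivedCategory.Q.map ((F.map₂CochainComplex.flip.obj Y).map f) :=
  (mapDerivedCategory₁Factors F Y).hom.naturality ((HomotopyCategory.quotient _ _).map f)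

theorem mapDerivedCategory₁Map_app_objIso {Y Y' : CochainComplex C₂ ℤ} [IsTensorFlat F Y]
    [IsTensorFlat F Y'] (g : Y ⟶ Y') (X : CochainComplex C₁ ℤ) :
    (mapDerivedCategory₁Map F g).app (DerivedCategory.Q.obj X) ≫
        (mapDerivedCategory₁ObjIso F Y' X).hom =
      (mapDerivedCategory₁ObjIso F Y X).hom ≫
        DerivedCategory.Q.map ((F.map₂CochainComplex.flip.map g).app X) := by
  refine (congrArg (· ≫ _) (mapDerivedCategory₁Map_app F g
    ((HomotopyCategory.quotient _ _).obj X))).trans ?_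
  refine (Category.assoc _ _ _).trans (congrArg (_ ≫ ·) ((Category.assoc _ _ _).trans ?_))
  exact (congrArg (_ ≫ ·) ((mapDerivedCategory₁Factors F Y').inv_hom_id_app
    ((HomotopyCategory.quotient _ _).obj X))).trans (Category.comp_id _)

end Naturality

/-! ### The ring has no self-extensions. -/

section Exceptional

variable {R : Type u} [Ring R] [HasDerivedCategory.{w₁} (ModuleCat.{u} R)]

/-- Such a morphism lifts to a chain map between complexes concentrated in different degrees. -/
theorem unitObj_exceptional (n : ℤ) (hn : n ≠ 0) (f : unitObj R ⟶ (unitObj R)⟦n⟧) : f = 0 := by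
  have hS := isFGProjIcc_single (ModuleCat.of R R) 0
  have := hS.isKProjective
  obtain ⟨g, hg⟩ := Q_map_surjective ((HomologicalComplex.single (ModuleCat.{u} R) (.up ℤ) 0).obj
    (ModuleCat.of R R)) (((HomologicalComplex.single (ModuleCat.{u} R) (.up ℤ) 0).obj
      (ModuleCat.of R R))⟦n⟧) (f ≫ (DerivedCategory.Q.commShiftIso n).inv.app
      ((HomologicalComplex.single (ModuleCat.{u} R) (.up ℤ) 0).obj (ModuleCat.of R R)))
  have hg₀ : g = 0 := HomologicalComplex.hom_ext _ _ fun i => by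
    by_cases hi : i = 0
    · exact (HomologicalComplex.isZero_single_obj_X (.up ℤ) 0 (ModuleCat.of R R) (i + n)
        (by lia)).eq_of_tgt _ _
    · exact (HomologicalComplex.isZero_single_obj_X (.up ℤ) 0 (ModuleCat.of R R) i
        hi).eq_of_src _ _
  rw [hg₀, Functor.map_zero] at hg
  exact (cancel_mono ((DerivedCategory.Q.commShiftIso n).inv.app _)).1
    (hg.symm.trans zero_comp.symm)

end Exceptional

/-! ### Vanishing of morphisms between tensor products. -/

section TensorLeftMap

variable (k : Type u) {A B : Type u} [CommRing k] [Ring A] [Algebra k A] [Ring B] [Algebra k B]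

theorem tensorLeftMap_comp_mapBifunctorSingleIso {M M' : ModuleCat.{u} A}
    {P L : CochainComplex (ModuleCat.{u} B) ℤ} (e : M ⟶ M') (f : P ⟶ L) :
    tensorLeftMap k e f ≫ (mapBifunctorSingleIso (tensorBifunctor k A B) M' L).hom =
      (mapBifunctorSingleIso (tensorBifunctor k A B) M P).hom ≫
        ((tensorBifunctor k A B).map₂CochainComplex.flip.obj P).map
          ((HomologicalComplex.single _ (.up ℤ) 0).map e) ≫
        ((tensorBifunctor k A B).map₂CochainComplex.flip.map f).app
          ((HomologicalComplex.single _ (.up ℤ) 0).obj M') := by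
  have h : tensorLeftMap k e f =
      (NatTrans.mapHomologicalComplex ((tensorBifunctor k A B).map e) (.up ℤ)).app P ≫
        (tensorLeft k M').map f := by
    refine HomologicalComplex.hom_ext _ _ fun n => ?_
    exact (congrArg₂ (tensorHom k) (Category.comp_id e).symm (Category.id_comp _).symm).trans
      (tensorHom_comp k e (𝟙 M') (𝟙 (P.X n)) (f.f n))
  rw [h]
  refine (Category.assoc _ _ _).trans ((congrArg (_ ≫ ·)
    (mapBifunctorSingleIso_hom_naturality (tensorBifunctor k A B) M' f)).trans ?_)
  exact (Category.assoc _ _ _).symm.trans ((congrArg (· ≫ _)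
    (mapBifunctorSingleIso_hom_naturality₁ (tensorBifunctor k A B) e P)).trans
    (Category.assoc _ _ _))

theorem subsingleton_tensorLeft_hom [HasDerivedCategory.{w₂} (ModuleCat.{u} B)]
    [HasDerivedCategory.{w₃} (ModuleCat.{u} (A ⊗[k] B))] (P L : CochainComplex (ModuleCat.{u} B) ℤ)
    [P.IsKProjective] [Module.Projective k B] {M M' : ModuleCat.{u} A}
    [Module.Finite A M] [Module.Projective A M]
    {a b a' b' : ℤ} (hP : IsFGProjIcc P a b) (hL : IsFGProjIcc L a' b')
    [∀ n : ℤ, Module.Projective k (DerivedCategory.Q.obj P ⟶ DerivedCategory.Q.obj (L⟦n⟧))]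
    [Subsingleton (DerivedCategory.Q.obj P ⟶ DerivedCategory.Q.obj L)] :
    Subsingleton (DerivedCategory.Q.obj ((tensorLeft k M).obj P) ⟶
        DerivedCategory.Q.obj ((tensorLeft k M').obj L)) := by
  have := Module.Free.of_subsingleton k (DerivedCategory.Q.obj P ⟶ DerivedCategory.Q.obj L)
  -- The Künneth formula is applied to the zero map: it has the required values because every `f : P
  -- ⟶ L` is null-homotopic. A bijective zero map forces its target to be trivial.
  have h := bijective_of_apply_tmul_Q_map k hP hL (M := M) (M' := M') 0 fun e f => by
    have h₁ : tensorLeftMap k e f = tensorLeftMap k e (𝟙 P) ≫ (tensorLeft k M').map f := by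
      refine HomologicalComplex.hom_ext _ _ fun n => ?_
      exact (congrArg₂ (tensorHom k) (Category.comp_id e).symm (Category.id_comp _).symm).trans
        (tensorHom_comp k e (𝟙 M') (𝟙 (P.X n)) (f.f n))
    have h₂ : Homotopy f 0 := (homotopy_of_Q_map_eq (Subsingleton.elim _ _)).some
    have h₃ := DerivedCategory.Q_map_eq_of_homotopy _
      (((tensorBifunctor k A B).obj M').mapHomotopy h₂)
    rw [h₁, Functor.map_comp, h₃, Functor.map_zero, Functor.map_zero, comp_zero]
    rfl
  refine ⟨fun x y => ?_⟩
  obtain ⟨x, rfl⟩ := h.2 x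
  obtain ⟨y, rfl⟩ := h.2 y
  rfl

end TensorLeftMap

/-! ### The Künneth formula for perfect objects. -/

section Transformation

variable (k : Type u) {A B : Type u} [CommRing k] [Ring A] [Algebra k A] [Ring B] [Algebra k B]
  [HasDerivedCategory.{w₁} (ModuleCat.{u} A)] [HasDerivedCategory.{w₂} (ModuleCat.{u} B)]
  [HasDerivedCategory.{w₃} (ModuleCat.{u} (A ⊗[k] B))]
  (P L : CochainComplex (ModuleCat.{u} B) ℤ) [P.IsKProjective]
  [IsTensorFlat (tensorBifunctor k A B) P] [IsTensorFlat (tensorBifunctor k A B) L]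

/-- The natural transformation `- ⊗ P ⟶ - ⊗ L` attached to a morphism `P ⟶ L` in the derived
category. -/
noncomputable def tensorTrans : (DerivedCategory.Q.obj P ⟶ DerivedCategory.Q.obj L) →ₗ[k]
    (mapDerivedCategory₁ (tensorBifunctor k A B) P ⟶
      mapDerivedCategory₁ (tensorBifunctor k A B) L) where
  -- Any chain map representing `h` will do: two of them are homotopic and induce the same
  -- transformation, which also yields linearity.
  toFun h := mapDerivedCategory₁Map _ (Q_map_surjective P L h).choose
  map_add' h h' := by
    rw [← mapDerivedCategory₁Map_add]
    refine mapDerivedCategory₁Map_eq_of_homotopy _ (homotopy_of_Q_map_eq ?_).some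
    rw [Functor.map_add, (Q_map_surjective P L h).choose_spec,
      (Q_map_surjective P L h').choose_spec, (Q_map_surjective P L (h + h')).choose_spec]
  map_smul' c h := by
    have h₁ : mapDerivedCategory₁Map (tensorBifunctor k A B)
        (Q_map_surjective P L (c • h)).choose =
        mapDerivedCategory₁Map (tensorBifunctor k A B)
          (c • (Q_map_surjective P L h).choose) := by
      refine mapDerivedCategory₁Map_eq_of_homotopy _ (homotopy_of_Q_map_eq ?_).some
      rw [Functor.map_smul, (Q_map_surjective P L h).choose_spec,
        (Q_map_surjective P L (c • h)).choose_spec]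
    rw [h₁]
    ext X
    exact mapDerivedCategory₁Map_app_smul _ k c _ X

variable {P L}

theorem tensorTrans_Q_map (f : P ⟶ L) : tensorTrans (A := A) k P L (DerivedCategory.Q.map f) =
    mapDerivedCategory₁Map (tensorBifunctor k A B) f :=
  mapDerivedCategory₁Map_eq_of_homotopy _
    (homotopy_of_Q_map_eq (Q_map_surjective P L (DerivedCategory.Q.map f)).choose_spec).some

instance (h : DerivedCategory.Q.obj P ⟶ DerivedCategory.Q.obj L) :
    NatTrans.CommShift (tensorTrans (A := A) k P L h) ℤ :=
  inferInstanceAs (NatTrans.CommShift (mapDerivedCategory₁Map _ _) ℤ)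

theorem tensorTrans_id :
    tensorTrans (A := A) k P P (𝟙 _) = 𝟙 (mapDerivedCategory₁ (tensorBifunctor k A B) P) := by
  rw [← DerivedCategory.Q.map_id, tensorTrans_Q_map, mapDerivedCategory₁Map_id]

theorem tensorTrans_comp {L' : CochainComplex (ModuleCat.{u} B) ℤ} [L.IsKProjective]
    [IsTensorFlat (tensorBifunctor k A B) L']
    (h : DerivedCategory.Q.obj P ⟶ DerivedCategory.Q.obj L)
    (h' : DerivedCategory.Q.obj L ⟶ DerivedCategory.Q.obj L') :
    tensorTrans (A := A) k P L' (h ≫ h') = tensorTrans k P L h ≫ tensorTrans k L L' h' := by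
  obtain ⟨f, rfl⟩ := Q_map_surjective P L h
  obtain ⟨f', rfl⟩ := Q_map_surjective L L' h'
  rw [← DerivedCategory.Q.map_comp, tensorTrans_Q_map, tensorTrans_Q_map, tensorTrans_Q_map,
    mapDerivedCategory₁Map_comp]

variable (P) in
/-- The value of `- ⊗ P` on a module. -/
noncomputable def tensorSingleIso (M : ModuleCat.{u} A) :
    (mapDerivedCategory₁ (tensorBifunctor k A B) P).obj
        ((DerivedCategory.singleFunctor _ 0).obj M) ≅
      DerivedCategory.Q.obj ((tensorLeft k M).obj P) :=
  mapDerivedCategory₁ObjIso _ P ((CochainComplex.singleFunctor _ 0).obj M) ≪≫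
    DerivedCategory.Q.mapIso (mapBifunctorSingleIso (tensorBifunctor k A B) M P).symm

theorem compareHom_objIso {X X' : CochainComplex (ModuleCat.{u} A) ℤ} (e : X ⟶ X') (f : P ⟶ L) :
    compareHom (tensorTrans (A := A) k P L) _ _
      (DerivedCategory.Q.map e ⊗ₜ DerivedCategory.Q.map f) ≫
        (mapDerivedCategory₁ObjIso (tensorBifunctor k A B) L X').hom =
      (mapDerivedCategory₁ObjIso (tensorBifunctor k A B) P X).hom ≫ DerivedCategory.Q.map
        (((tensorBifunctor k A B).map₂CochainComplex.flip.obj P).map e ≫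
          ((tensorBifunctor k A B).map₂CochainComplex.flip.map f).app X') := by
  rw [compareHom_tmul, tensorTrans_Q_map, Category.assoc, mapDerivedCategory₁Map_app_objIso]
  refine Eq.trans ?_ (congrArg (_ ≫ ·) (DerivedCategory.Q.map_comp _ _)).symm
  exact (Category.assoc _ _ _).symm.trans ((congrArg (· ≫ _)
    (mapDerivedCategory₁ObjIso_hom_naturality _ P e)).trans (Category.assoc _ _ _))

theorem compareHom_tensorSingleIso {M M' : ModuleCat.{u} A} (e : M ⟶ M') (f : P ⟶ L) :
    compareHom (tensorTrans (A := A) k P L) _ _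
      ((DerivedCategory.singleFunctor _ 0).map e ⊗ₜ DerivedCategory.Q.map f) ≫
        (tensorSingleIso k L M').hom =
      (tensorSingleIso k P M).hom ≫ DerivedCategory.Q.map (tensorLeftMap k e f) := by
  refine (Category.assoc _ _ _).symm.trans ((congrArg (· ≫ _) (compareHom_objIso k
    ((CochainComplex.singleFunctor _ 0).map e) f)).trans ?_)
  refine (Category.assoc _ _ _).trans (Eq.trans (congrArg (_ ≫ ·) ?_) (Category.assoc _ _ _).symm)
  refine (DerivedCategory.Q.map_comp _ _).symm.trans
    (Eq.trans (congrArg DerivedCategory.Q.map ?_) (DerivedCategory.Q.map_comp _ _))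
  exact (Iso.comp_inv_eq _).2 (((Iso.inv_comp_eq _).2
    (tensorLeftMap_comp_mapBifunctorSingleIso k e f)).symm.trans (Category.assoc _ _ _).symm)

/-- Modules embed fully faithfully in degree zero, and `M ⊗ P` is computed termwise, so up to these
identifications the comparison map is the one of `bijective_of_apply_tmul_Q_map`. -/
theorem compareHom_single_bijective [Module.Projective k B]
    {a b a' b' : ℤ} (hP : IsFGProjIcc P a b) (hL : IsFGProjIcc L a' b')
    [∀ n : ℤ, Module.Projective k (DerivedCategory.Q.obj P ⟶ DerivedCategory.Q.obj (L⟦n⟧))]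
    [Module.Projective k (DerivedCategory.Q.obj P ⟶ DerivedCategory.Q.obj L)]
    (M M' : ModuleCat.{u} A) [Module.Finite A M] [Module.Projective A M] :
    Function.Bijective (compareHom (tensorTrans (A := A) k P L)
      ((DerivedCategory.singleFunctor _ 0).obj M)
        ((DerivedCategory.singleFunctor _ 0).obj M')) := by
  let e₁ : (M ⟶ M') ≃ₗ[k] ((DerivedCategory.singleFunctor _ 0).obj M ⟶
      (DerivedCategory.singleFunctor _ 0).obj M') :=
    LinearEquiv.ofBijective ((DerivedCategory.singleFunctor _ 0).mapLinearMap k)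
      ⟨(DerivedCategory.singleFunctor _ 0).map_injective,
        (DerivedCategory.singleFunctor _ 0).map_surjective⟩
  let e₂ := Linear.homCongr k (tensorSingleIso k P M)
    (tensorSingleIso k L M')
  have h := bijective_of_apply_tmul_Q_map k hP hL (M := M) (M' := M')
    (e₂.toLinearMap ∘ₗ compareHom (tensorTrans (A := A) k P L) _ _ ∘ₗ
      (e₁.rTensor _).toLinearMap) fun e f => (Category.assoc _ _ _).trans <| (Iso.inv_comp_eq _).2
        (compareHom_tensorSingleIso k e f)
  rw [LinearMap.coe_comp, LinearMap.coe_comp] at h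
  exact (Function.Bijective.of_comp_iff _ (e₁.rTensor _).bijective).1
    ((Function.Bijective.of_comp_iff' e₂.bijective _).1 h)

/-- The Künneth formula for morphisms `X ⊗ P ⟶ W ⊗ L` with `X` and `W` perfect. -/
theorem compareHom_tensorTrans_bijective [Module.Projective k B]
    {a b a' b' : ℤ} (hP : IsFGProjIcc P a b) (hL : IsFGProjIcc L a' b')
    (hPL : ∀ n : ℤ, n ≠ 0 →
      ∀ f : DerivedCategory.Q.obj P ⟶ (DerivedCategory.Q.obj L)⟦n⟧, f = 0)
    [Module.Projective k (DerivedCategory.Q.obj P ⟶ DerivedCategory.Q.obj L)]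
    {X W : DerivedCategory (ModuleCat.{u} A)} (hX : IsPerfect X) (hW : IsPerfect W) :
    Function.Bijective (compareHom (tensorTrans (A := A) k P L) X W) := by
  have hsub (n : ℤ) (hn : n ≠ 0) :
      Subsingleton (DerivedCategory.Q.obj P ⟶ DerivedCategory.Q.obj (L⟦n⟧)) :=
    ⟨fun f g => (cancel_mono ((DerivedCategory.Q.commShiftIso n).hom.app L)).1
      ((hPL n hn _).trans (hPL n hn _).symm)⟩
  have hproj (n : ℤ) :
      Module.Projective k (DerivedCategory.Q.obj P ⟶ DerivedCategory.Q.obj (L⟦n⟧)) := by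
    by_cases hn : n = 0
    · subst hn
      have : Module.Projective k
          (DerivedCategory.Q.obj P ⟶ DerivedCategory.Q.obj ((𝟭 _).obj L)) := ‹_›
      exact .of_equiv' (Linear.homCongr k (Iso.refl (DerivedCategory.Q.obj P))
        (DerivedCategory.Q.mapIso ((shiftFunctorZero _ ℤ).app L).symm))
    · have := hsub n hn
      have := Module.Free.of_subsingleton k
        (DerivedCategory.Q.obj P ⟶ DerivedCategory.Q.obj (L⟦n⟧))
      infer_instance
  -- It suffices to treat the exceptional generator `A` of the perfect objects. This requires the
  -- vanishing of `Hom(A ⊗ P, (A ⊗ L)[n])` for `n ≠ 0`, obtained from `Hom(P, L[n]) = 0`.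
  refine compareHom_bijective (tensorTrans (A := A) k P L) (A := unitObj A) unitObj_exceptional
    (fun n hn f => ?_) ?_ ((isPerfect_iff_triangEnvelope X).1 hX)
    ((isPerfect_iff_triangEnvelope W).1 hW)
  · have := hsub n hn
    have := (hL.shift n).isTensorFlat (A := A) k
    have (m : ℤ) : Module.Projective k
        (DerivedCategory.Q.obj P ⟶ DerivedCategory.Q.obj ((L⟦n⟧)⟦m⟧)) :=
      .of_equiv' (Linear.homCongr k (Iso.refl (DerivedCategory.Q.obj P))
        (DerivedCategory.Q.mapIso ((shiftFunctorAdd _ n m).app L)))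
    have h := subsingleton_tensorLeft_hom k P (L⟦n⟧) (M := ModuleCat.of A A)
      (M' := ModuleCat.of A A) hP (hL.shift n)
    let e : ((mapDerivedCategory₁ (tensorBifunctor k A B) L).obj (unitObj A))⟦n⟧ ≅
        DerivedCategory.Q.obj ((tensorLeft k (ModuleCat.of A A)).obj (L⟦n⟧)) :=
      (shiftFunctor _ n).mapIso (tensorSingleIso k L (ModuleCat.of A A)) ≪≫
        ((DerivedCategory.Q.commShiftIso n).app _).symm ≪≫
        DerivedCategory.Q.mapIso (((tensorLeft k (ModuleCat.of A A)).commShiftIso n).app L).symm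
    rw [← cancel_mono e.hom, ← cancel_epi (tensorSingleIso k P (ModuleCat.of A A)).inv]
    exact Subsingleton.elim _ _
  · exact compareHom_single_bijective k hP hL _ _

end Transformation

theorem isIso_map_of_comm {C D : Type*} [Category* C] [Category* D] (F : C ⥤ D) {X Y X' Y' : C}
    (e : X ≅ X') (e' : Y ≅ Y') {f : X ⟶ Y} {f' : X' ⟶ Y'} (h : f ≫ e'.hom = e.hom ≫ f')
    (_ : IsIso (F.map f)) : IsIso (F.map f') := by
  rw [← (Iso.inv_comp_eq _).2 h, F.map_comp, F.map_comp]
  infer_instance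

/-! ### Invariance of `T ⊗ -` under quasi-isomorphisms of `k`-projective complexes. -/

section Contraction

open CochainComplex

variable (k : Type u) {A B : Type u} [CommRing k] [Ring A] [Algebra k A] [Ring B] [Algebra k B]
  {T : CochainComplex (ModuleCat.{u} A) ℤ} {C : CochainComplex (ModuleCat.{u} B) ℤ}

/-- The inclusion of a summand of a tensor product of complexes. -/
noncomputable def ιTensor (p q n : ℤ) (h : p + q = n) :
    T.X p ⊗[k] C.X q →+ (tensorComplex k T C).X n :=
  (ιMapBifunctor T C (tensorBifunctor k A B) p q n h).hom.toAddMonoidHom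

/-- A contraction over `k` is not `B`-linear, so the maps it induces on the total complex are only
additive. The forgetful functor to abelian groups preserves the coproducts involved, so additive
maps may be given summand by summand. -/
theorem exists_tensorComplex_desc {n : ℤ} {Z : Type u} [AddCommGroup Z]
    (φ : ∀ p q : ℤ, p + q = n → (T.X p ⊗[k] C.X q →+ Z)) :
    ∃ S : (tensorComplex k T C).X n →+ Z,
      ∀ (p q : ℤ) (h : p + q = n) (t : T.X p ⊗[k] C.X q), S (ιTensor k p q n h t) = φ p q h t := by
  let G := HomologicalComplex₂.toGradedObject
    ((((tensorBifunctor k A B).mapBifunctorHomologicalComplex (.up ℤ) (.up ℤ)).obj T).obj C)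
  let hc := isColimitOfPreserves (forget₂ (ModuleCat.{u} (A ⊗[k] B)) AddCommGrpCat.{u})
    (G.isColimitCofanMapObj (ComplexShape.π (.up ℤ) (.up ℤ) (.up ℤ)) n)
  let c : Cocone (Discrete.functor (fun i : (ComplexShape.π (ComplexShape.up ℤ) (.up ℤ)
      (.up ℤ) ⁻¹' {n}) => G i.1) ⋙ forget₂ (ModuleCat.{u} (A ⊗[k] B)) AddCommGrpCat.{u}) :=
    { pt := AddCommGrpCat.of Z
      ι := Discrete.natTrans fun i => AddCommGrpCat.ofHom (φ i.as.1.1 i.as.1.2 i.as.2) }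
  refine ⟨(hc.desc c).hom, fun p q h t => ?_⟩
  exact congrArg (fun f => f.hom t) (hc.fac c ⟨⟨(p, q), h⟩⟩)

theorem tensorComplex_addHom_ext {n : ℤ} {Z : Type u} [AddCommGroup Z]
    {S S' : (tensorComplex k T C).X n →+ Z}
    (h : ∀ (p q : ℤ) (h : p + q = n) (x : T.X p) (y : C.X q),
      S (ιTensor k p q n h (x ⊗ₜ y)) = S' (ιTensor k p q n h (x ⊗ₜ y))) : S = S' := by
  let G := HomologicalComplex₂.toGradedObject
    ((((tensorBifunctor k A B).mapBifunctorHomologicalComplex (.up ℤ) (.up ℤ)).obj T).obj C)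
  let hc := isColimitOfPreserves (forget₂ (ModuleCat.{u} (A ⊗[k] B)) AddCommGrpCat.{u})
    (G.isColimitCofanMapObj (ComplexShape.π (.up ℤ) (.up ℤ) (.up ℤ)) n)
  have h' : AddCommGrpCat.ofHom S = AddCommGrpCat.ofHom S' := by
    refine hc.hom_ext fun ⟨⟨⟨p, q⟩, hpq⟩⟩ => AddCommGrpCat.hom_ext ?_
    refine AddMonoidHom.ext fun t => ?_
    have h' : S.comp (ιTensor k p q n hpq) = S'.comp (ιTensor k p q n hpq) := by
      ext t
      induction t with
      | zero => simp only [map_zero]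
      | add t t' ht ht' => simp only [map_add, ht, ht']
      | tmul x y => exact h p q hpq x y
    exact DFunLike.congr_fun h' t
  exact congrArg AddCommGrpCat.Hom.hom h'

theorem d_ιTensor (p q n : ℤ) (h : p + q = n) (x : T.X p) (y : C.X q) :
    ((tensorComplex k T C).d n (n + 1)).hom (ιTensor k p q n h (x ⊗ₜ y)) =
      ιTensor k (p + 1) q (n + 1) (by lia) ((T.d p (p + 1)).hom x ⊗ₜ y) +
      (p.negOnePow : ℤ) • ιTensor k p (q + 1) (n + 1) (by lia) (x ⊗ₜ (C.d q (q + 1)).hom y) := by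
  have h' := ι_mapBifunctor_d (tensorBifunctor k A B) T C p q n h
  rw [Units.smul_def] at h'
  exact congrArg (fun f => f.hom (show tensorObj k A B (T.X p) (C.X q) from x ⊗ₜ y)) h'

/-- The tensor product with a complex which is contractible over `k` is acyclic. -/
theorem acyclic_tensorComplex_of_contraction (s : ∀ i j : ℤ, C.X i →ₗ[k] C.X j)
    (hs : ∀ (r : ℤ) (y : C.X (r + 1)), (C.d r (r + 1)).hom (s (r + 1) r y) +
      s (r + 1 + 1) (r + 1) ((C.d (r + 1) (r + 1 + 1)).hom y) = y) :
    (tensorComplex k T C).Acyclic := by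
  -- The contraction is `x ⊗ y ↦ (-1)ᵖ x ⊗ s y`. In `d S + S d` the terms `d x ⊗ s y` occur with
  -- opposite signs and cancel, leaving `x ⊗ (d s + s d) y`.
  have hS (n m : ℤ) (hnm : m + 1 = n) := exists_tensorComplex_desc k (T := T) (C := C) (n := n)
    (Z := (tensorComplex k T C).X m) fun p q h => (p.negOnePow : ℤ) •
      (ιTensor k p (q - 1) m (by lia)).comp ((s q (q - 1)).lTensor (T.X p)).toAddMonoidHom
  choose S hS using hS
  have hS' (n m : ℤ) (hnm : m + 1 = n) (p q r : ℤ) (h : p + q = n) (hr : r + 1 = q) (x : T.X p)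
      (y : C.X q) : S n m hnm (ιTensor k p q n h (x ⊗ₜ y)) =
        (p.negOnePow : ℤ) • ιTensor k p r m (by lia) (x ⊗ₜ s q r y) := by
    obtain rfl : r = q - 1 := by lia
    exact hS n m hnm p q h (x ⊗ₜ y)
  have key (m : ℤ) : (((tensorComplex k T C).d m (m + 1)).hom.toAddMonoidHom.comp
        (S (m + 1) m rfl)) + (S (m + 1 + 1) (m + 1) rfl).comp
          ((tensorComplex k T C).d (m + 1) (m + 1 + 1)).hom.toAddMonoidHom = .id _ := by
    refine tensorComplex_addHom_ext k fun p q h x y => ?_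
    obtain ⟨r, rfl⟩ : ∃ r, q = r + 1 := ⟨q - 1, by lia⟩
    change ((tensorComplex k T C).d m (m + 1)).hom (S (m + 1) m rfl _) +
      S (m + 1 + 1) (m + 1) rfl (((tensorComplex k T C).d (m + 1) (m + 1 + 1)).hom _) = _
    have hp : (p.negOnePow : ℤ) * (p.negOnePow : ℤ) = 1 := by
      rw [← Units.val_mul, Int.units_mul_self, Units.val_one]
    rw [hS' (m + 1) m rfl p (r + 1) r h rfl, map_zsmul, d_ιTensor, d_ιTensor, map_add, map_zsmul,
      hS' (m + 1 + 1) (m + 1) rfl (p + 1) (r + 1) r _ rfl,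
      hS' (m + 1 + 1) (m + 1) rfl p (r + 1 + 1) (r + 1) _ rfl,
      smul_add, smul_smul, smul_smul, hp, one_smul, one_smul, Int.negOnePow_succ]
    conv_rhs => rw [AddMonoidHom.id_apply, ← hs r y, TensorProduct.tmul_add, map_add]
    rw [Units.val_neg, neg_smul]
    abel
  intro n
  obtain ⟨m, rfl⟩ : ∃ m, n = m + 1 := ⟨n - 1, by lia⟩
  rw [HomologicalComplex.exactAt_iff' _ m (m + 1) (m + 1 + 1) (by simp) (by simp),
    ShortComplex.moduleCat_exact_iff]
  intro x hx
  refine ⟨S (m + 1) m rfl x, ?_⟩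
  have h := DFunLike.congr_fun (key m) x
  have h₀ : S (m + 1 + 1) (m + 1) rfl (((tensorComplex k T C).d (m + 1) (m + 1 + 1)).hom x) = 0 :=
    (congrArg _ hx).trans (map_zero _)
  exact (add_zero (((tensorComplex k T C).d m (m + 1)).hom (S (m + 1) m rfl x))).symm.trans
    ((congrArg (((tensorComplex k T C).d m (m + 1)).hom (S (m + 1) m rfl x) + ·) h₀.symm).trans h)

/-- A bounded above acyclic complex with `k`-projective terms has a `k`-linear contraction. -/
theorem exists_contraction {b : ℤ} [C.IsStrictlyLE b] (hC : C.Acyclic)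
    (hp : ∀ n, Module.Projective k (C.X n)) :
    ∃ s : ∀ i j : ℤ, C.X i →ₗ[k] C.X j, ∀ (r : ℤ) (y : C.X (r + 1)),
      (C.d r (r + 1)).hom (s (r + 1) r y) +
        s (r + 1 + 1) (r + 1) ((C.d (r + 1) (r + 1 + 1)).hom y) = y := by
  -- Over `k` the complex is a bounded above complex of projectives, hence K-projective; being
  -- acyclic, it has a null-homotopic identity.
  let Φ := ModuleCat.restrictScalars.{u} (algebraMap k B)
  let C' : CochainComplex (ModuleCat.{u} k) ℤ := (Φ.mapHomologicalComplex (.up ℤ)).obj C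
  have hC' : C'.Acyclic := by
    intro n
    have h := hC n
    rw [HomologicalComplex.exactAt_iff, ShortComplex.moduleCat_exact_iff] at h ⊢
    exact h
  have : C'.IsStrictlyLE b := by
    have h : C.IsStrictlyLE b := inferInstance
    rw [CochainComplex.isStrictlyLE_iff] at h ⊢
    exact fun i hi => Φ.map_isZero (h i hi)
  have (n : ℤ) : Projective (C'.X n) := by
    have := hp n
    exact (IsProjective.iff_projective (R := k) (Φ.obj (C.X n))).1 this
  have := CochainComplex.isKProjective_of_projective C' b
  have H := CochainComplex.IsKProjective.homotopyZero (𝟙 C') hC'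
  refine ⟨fun i j => (H.hom i j).hom, fun r y => ?_⟩
  have h := H.comm (r + 1)
  rw [dNext_eq _ (show (ComplexShape.up ℤ).Rel (r + 1) (r + 1 + 1) from rfl),
    prevD_eq _ (show (ComplexShape.up ℤ).Rel r (r + 1) from rfl)] at h
  have h' := congrArg (fun f => f.hom y) h
  exact (add_comm _ _).trans ((add_zero _).symm.trans h'.symm)

theorem acyclic_tensorComplex {b : ℤ} [C.IsStrictlyLE b] (hC : C.Acyclic)
    (hp : ∀ n, Module.Projective k (C.X n)) : (tensorComplex k T C).Acyclic := by
  obtain ⟨s, hs⟩ := exists_contraction k (b := b) hC hp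
  exact acyclic_tensorComplex_of_contraction k s hs

/-- Tensoring with an arbitrary complex preserves quasi-isomorphisms between bounded above
complexes with `k`-projective terms. -/
theorem isIso_Q_map_tensor [HasDerivedCategory.{w₂} (ModuleCat.{u} B)]
    [HasDerivedCategory.{w₃} (ModuleCat.{u} (A ⊗[k] B))]
    (T : CochainComplex (ModuleCat.{u} A) ℤ) {P L : CochainComplex (ModuleCat.{u} B) ℤ} (f : P ⟶ L)
    [IsIso (DerivedCategory.Q.map f)] {b c : ℤ} [P.IsStrictlyLE b] [L.IsStrictlyLE c]
    (hP : ∀ n, Module.Projective k (P.X n)) (hL : ∀ n, Module.Projective k (L.X n)) :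
    IsIso (DerivedCategory.Q.map
      (((tensorBifunctor k A B).map₂CochainComplex.flip.map f).app T)) := by
  have hT := HomotopyCategory.mappingCone_triangleh_distinguished f
  have hacyclic : (mappingCone f).Acyclic := by
    rw [← HomotopyCategory.quotient_obj_mem_subcategoryAcyclic_iff_acyclic]
    refine ((HomotopyCategory.subcategoryAcyclic _).trW_iff_of_distinguished _ hT).1 ?_
    rw [← HomotopyCategory.quasiIso_eq_trW_subcategoryAcyclic]
    exact (HomotopyCategory.quotient_map_mem_quasiIso_iff f).2
      ((DerivedCategory.isIso_Q_map_iff_quasiIso _ f).1 inferInstance)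
  have hLE : (mappingCone f).IsStrictlyLE (max b c) := by
    rw [CochainComplex.isStrictlyLE_iff]
    intro i hi
    rw [CochainComplex.mappingCone.isZero_X_iff]
    exact ⟨P.isZero_of_isStrictlyLE b _, L.isZero_of_isStrictlyLE c _⟩
  have hproj (m : ℤ) : Module.Projective k ((mappingCone f).X m) := by
    have h := congrArg ModuleCat.Hom.hom (mappingCone.id_X f m (m + 1) rfl)
    refine Module.Projective.of_split (M := P.X (m + 1) × L.X m)
      (((mappingCone.fst f).1.v m (m + 1) rfl).hom.prod
        ((mappingCone.snd f).v m m (add_zero m)).hom |>.restrictScalars k)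
      (((mappingCone.inl f).v (m + 1) m (by lia)).hom.coprod
        ((mappingCone.inr f).f m).hom |>.restrictScalars k) ?_
    ext x
    exact LinearMap.congr_fun h x
  have hzero := acyclic_tensorComplex k (T := T) (b := max b c) hacyclic hproj
  -- The flipped bifunctor makes `T ⊗ -` a triangulated functor of the second variable. It sends the
  -- triangle of `f` to one with acyclic third vertex.
  have h : IsIso (DerivedCategory.Qh.map ((mapHomotopyCategory₁ (tensorBifunctor k A B).flip T).map
      ((HomotopyCategory.quotient _ _).map f))) := by
    refine Localization.inverts DerivedCategory.Qh
      (HomotopyCategory.subcategoryAcyclic (ModuleCat.{u} (A ⊗[k] B))).trW _ ?_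
    refine ((HomotopyCategory.subcategoryAcyclic _).trW_iff_of_distinguished _
      ((mapHomotopyCategory₁ (tensorBifunctor k A B).flip T).map_distinguished _ hT)).2 ?_
    refine (HomotopyCategory.quotient_obj_mem_subcategoryAcyclic_iff_acyclic _).2 ?_
    exact acyclic_of_iso (HomologicalComplex.mapBifunctorFlipIso T (mappingCone f)
      (tensorBifunctor k A B) (.up ℤ)).symm hzero
  have h' : IsIso (DerivedCategory.Q.map
      (((tensorBifunctor k A B).flip.map₂CochainComplex.flip.obj T).map f)) := h
  have hf := HomologicalComplex.mapBifunctorFlipIso_hom_naturality (𝟙 T) f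
    (tensorBifunctor k A B) (.up ℤ)
  exact isIso_map_of_comm _ _ _ hf h'

end Contraction

/-! ### Pulling back thick subcategories along a derived functor of perfect complexes. -/

section PerfectInverseImage

open Pretriangulated

variable {R R' : Type u} [Ring R] [Ring R'] [HasDerivedCategory.{w₁} (ModuleCat.{u} R)]
  [HasDerivedCategory.{w₂} (ModuleCat.{u} R')] (Φ : ModuleCat.{u} R ⥤ ModuleCat.{u} R')
  [Φ.Additive]

/-- A retraction in the derived category between complexes, the first two of which are
K-projective, is preserved by termwise application of an additive functor. -/
theorem nonempty_retract_map {P L : CochainComplex (ModuleCat.{u} R) ℤ} [P.IsKProjective]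
    [L.IsKProjective] (r : Retract (DerivedCategory.Q.obj P) (DerivedCategory.Q.obj L)) :
    Nonempty (Retract (DerivedCategory.Q.obj ((Φ.mapHomologicalComplex (.up ℤ)).obj P))
      (DerivedCategory.Q.obj ((Φ.mapHomologicalComplex (.up ℤ)).obj L))) := by
  obtain ⟨i, hi⟩ := Q_map_surjective P L r.i
  obtain ⟨p, hp⟩ := Q_map_surjective L P r.r
  have h : Homotopy (i ≫ p) (𝟙 P) := (homotopy_of_Q_map_eq (by
    rw [DerivedCategory.Q.map_comp, hi, hp, r.retract, DerivedCategory.Q.map_id])).some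
  exact ⟨{
    i := DerivedCategory.Q.map ((Φ.mapHomologicalComplex (.up ℤ)).map i)
    r := DerivedCategory.Q.map ((Φ.mapHomologicalComplex (.up ℤ)).map p)
    retract := by
      rw [← Functor.map_comp, ← Functor.map_comp,
        DerivedCategory.Q_map_eq_of_homotopy _ (Φ.mapHomotopy h), CategoryTheory.Functor.map_id,
        CategoryTheory.Functor.map_id] }⟩

/-- The perfect objects whose image under the left derived functor of an additive functor
satisfies a property. -/
def perfectInverseImage (S : ObjectProperty (DerivedCategory (ModuleCat.{u} R'))) :
    ObjectProperty (DerivedCategory (ModuleCat.{u} R)) := fun Y =>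
  ∃ (P : CochainComplex (ModuleCat.{u} R) ℤ) (a b : ℤ), IsFGProjIcc P a b ∧
    Nonempty (Y ≅ DerivedCategory.Q.obj P) ∧
    S (DerivedCategory.Q.obj ((Φ.mapHomologicalComplex (.up ℤ)).obj P))

variable (S : ObjectProperty (DerivedCategory (ModuleCat.{u} R'))) [S.IsTriangulated]
  [S.IsStableUnderRetracts]

-- Membership does not depend on the chosen complex: isomorphic K-projective complexes are homotopy
-- equivalent, which an additive functor preserves. No exactness of `Φ` is needed; it will be `A ⊗
-- -` with `A` possibly not flat.
omit [S.IsTriangulated] in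
theorem perfectInverseImage.prop_obj {P : CochainComplex (ModuleCat.{u} R) ℤ} {a b : ℤ}
    (hP : IsFGProjIcc P a b) (h : perfectInverseImage Φ S (DerivedCategory.Q.obj P)) :
    S (DerivedCategory.Q.obj ((Φ.mapHomologicalComplex (.up ℤ)).obj P)) := by
  obtain ⟨L, a', b', hL, ⟨e⟩, hS⟩ := h
  have := hP.isKProjective
  have := hL.isKProjective
  exact S.prop_of_retract (nonempty_retract_map Φ (Retract.ofIso e)).some hS

instance : (perfectInverseImage Φ S).IsClosedUnderIsomorphisms where
  of_iso e h := by
    obtain ⟨P, a, b, hP, ⟨e'⟩, hS⟩ := h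
    exact ⟨P, a, b, hP, ⟨e.symm ≪≫ e'⟩, hS⟩

instance : (perfectInverseImage Φ S).IsStableUnderRetracts where
  of_retract {X Y} r h := by
    obtain ⟨L, a', b', hL, ⟨e⟩, hS⟩ := h
    obtain ⟨a, b, P, hP, ⟨e'⟩⟩ := isPerfect_iff.1 ((perfect R).prop_of_retract r
      (isPerfect_iff.2 ⟨a', b', L, hL, ⟨e⟩⟩))
    have := hP.isKProjective
    have := hL.isKProjective
    exact ⟨P, a, b, hP, ⟨e'⟩, S.prop_of_retract (nonempty_retract_map Φ
      ((Retract.ofIso e'.symm).trans (r.trans (Retract.ofIso e)))).some hS⟩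

omit [HasDerivedCategory.{w₁} (ModuleCat.{u} R)] in
theorem mapHomologicalComplex_shift_mem {P : CochainComplex (ModuleCat.{u} R) ℤ}
    (h : S (DerivedCategory.Q.obj ((Φ.mapHomologicalComplex (.up ℤ)).obj P))) (n : ℤ) :
    S (DerivedCategory.Q.obj ((Φ.mapHomologicalComplex (.up ℤ)).obj (P⟦n⟧))) :=
  S.prop_of_iso ((DerivedCategory.Q.mapIso (((Φ.mapHomologicalComplex (.up ℤ)).commShiftIso n).app
    P)) ≪≫ (DerivedCategory.Q.commShiftIso n).app _).symm (S.le_shift n _ h)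

omit [HasDerivedCategory.{w₁} (ModuleCat.{u} R)] in
theorem mapHomologicalComplex_mappingCone_mem {P L : CochainComplex (ModuleCat.{u} R) ℤ}
    (f : P ⟶ L) (h : S (DerivedCategory.Q.obj ((Φ.mapHomologicalComplex (.up ℤ)).obj P)))
    (h' : S (DerivedCategory.Q.obj ((Φ.mapHomologicalComplex (.up ℤ)).obj L))) :
    S (DerivedCategory.Q.obj ((Φ.mapHomologicalComplex (.up ℤ)).obj
      (CochainComplex.mappingCone f))) :=
  S.ext_of_isTriangulatedClosed₃ _ (DerivedCategory.Qh.map_distinguished _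
    ((Φ.mapHomotopyCategory (.up ℤ)).map_distinguished _
      (HomotopyCategory.mappingCone_triangleh_distinguished f))) h h'

instance : (perfectInverseImage Φ S).IsTriangulated := by
  have h0 : (perfectInverseImage Φ S).ContainsZero := by
    have h₀ : IsZero (ModuleCat.of R PUnit.{u + 1}) := ModuleCat.isZero_of_subsingleton _
    refine ⟨_, (DerivedCategory.singleFunctor _ 0).map_isZero h₀, _, 0, 0,
      isFGProjIcc_single (ModuleCat.of R PUnit.{u + 1}) 0, ⟨Iso.refl _⟩, ?_⟩
    exact S.prop_of_isZero (DerivedCategory.Q.map_isZero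
      ((Φ.mapHomologicalComplex (.up ℤ)).map_isZero
        ((HomologicalComplex.single _ (.up ℤ) 0).map_isZero h₀)))
  have h1 : (perfectInverseImage Φ S).IsStableUnderShift ℤ := ⟨fun n => ⟨fun X hX => by
    obtain ⟨P, a, b, hP, ⟨e⟩, hS⟩ := hX
    exact ⟨_, _, _, hP.shift n, ⟨(shiftFunctor _ n).mapIso e ≪≫
      ((DerivedCategory.Q.commShiftIso n).app P).symm⟩,
        mapHomologicalComplex_shift_mem Φ S hS n⟩⟩⟩
  have h3 : (perfectInverseImage Φ S).IsTriangulatedClosed₃ := .mk' fun T hT h h' => by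
    obtain ⟨P, a, b, hP, ⟨e⟩, hS⟩ := h
    obtain ⟨P', a', b', hP', ⟨e'⟩, hS'⟩ := h'
    have := hP.isKProjective
    obtain ⟨f, hf⟩ := exists_iso_mappingCone T hT e e'
    exact ⟨_, min (a - 1) a', max (b - 1) b', hP.mappingCone hP' f
      (min_le_left _ _) (min_le_right _ _) (le_max_left _ _) (le_max_right _ _), hf,
        mapHomologicalComplex_mappingCone_mem Φ S f hS hS'⟩
  have h2 : (perfectInverseImage Φ S).IsTriangulatedClosed₂ := .of_isTriangulatedClosed₃
  exact {}

end PerfectInverseImage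

/-! ### Endomorphism algebras of biproducts as matrix algebras. -/

section EndAlgebra

variable {k : Type*} [CommRing k] {C D E : Type*} [Category* C] [Category* D] [Category* E]
  [Preadditive C] [Preadditive D] [Preadditive E] [Linear k C] [Linear k D] [Linear k E]
  {ι : Type} [Fintype ι]

theorem Bicone.hom_ext_of_total {V : ι → E} (b : Bicone V) (hb : ∑ i, b.π i ≫ b.ι i = 𝟙 b.pt)
    {Z : E} {x y : b.pt ⟶ Z} (h : ∀ i, b.ι i ≫ x = b.ι i ≫ y) : x = y := by
  rw [← Category.id_comp x, ← Category.id_comp y, ← hb, Preadditive.sum_comp, Preadditive.sum_comp]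
  exact Finset.sum_congr rfl fun i _ => by rw [Category.assoc, Category.assoc, h]

theorem Bicone.hom_ext_of_total' {V : ι → E} (b : Bicone V) (hb : ∑ i, b.π i ≫ b.ι i = 𝟙 b.pt)
    {Z : E} {x y : Z ⟶ b.pt} (h : ∀ i, x ≫ b.π i = y ≫ b.π i) : x = y := by
  rw [← Category.comp_id x, ← Category.comp_id y, ← hb, Preadditive.comp_sum, Preadditive.comp_sum]
  exact Finset.sum_congr rfl fun i _ => by rw [← Category.assoc, ← Category.assoc, h]

variable [DecidableEq ι] {X : ι → C} {Y : ι → D} {V : ι → E}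
  (θ : ∀ i j, (X j ⟶ X i) ⊗[k] (Y j ⟶ Y i) ≃ₗ[k] (V j ⟶ V i))
  (b : Bicone V)

/-- The matrix of an endomorphism of a biproduct. -/
noncomputable def endMatrixEquiv (hb : ∑ i, b.π i ≫ b.ι i = 𝟙 b.pt) :
    End b.pt ≃ₗ[k] CompTensorMatrix k X Y :=
  LinearEquiv.ofBijective
    { toFun := fun x i j => (θ i j).symm (b.ι j ≫ x ≫ b.π i)
      map_add' := fun x y => by
        funext i j
        refine Eq.trans ?_ (map_add (θ i j).symm _ _)
        exact congrArg _ ((congrArg (_ ≫ ·) (Preadditive.add_comp _ _ _ _ _ _)).trans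
          (Preadditive.comp_add _ _ _ _ _ _))
      map_smul' := fun c x => by
        funext i j
        refine Eq.trans ?_ (map_smul (θ i j).symm _ _)
        exact congrArg _ ((congrArg (_ ≫ ·) (Linear.smul_comp _ _ _ _ _ _)).trans
          (Linear.comp_smul _ _ _ _ _ _)) } <| by
    refine ⟨fun x y hxy => ?_, fun a => ⟨∑ i, ∑ j, b.π j ≫ θ i j (a i j) ≫ b.ι i, ?_⟩⟩
    · refine Bicone.hom_ext_of_total b hb fun j => Bicone.hom_ext_of_total' b hb fun i => ?_
      have h := (θ i j).symm.injective (congrFun (congrFun hxy i) j)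
      rw [Category.assoc, Category.assoc, h]
    · funext i j
      refine (LinearEquiv.symm_apply_eq _).2 ?_
      rw [Preadditive.sum_comp, Preadditive.comp_sum, Finset.sum_eq_single i,
        Preadditive.sum_comp, Preadditive.comp_sum, Finset.sum_eq_single j]
      · simp
      · intro j' _ hj'
        rw [Category.assoc, bicone_ι_π_ne_assoc b hj'.symm, zero_comp]
      · simp
      · intro i' _ hi'
        rw [Preadditive.sum_comp, Preadditive.comp_sum]
        refine Finset.sum_eq_zero fun j' _ => ?_
        rw [Category.assoc, Category.assoc, bicone_ι_π_ne b hi', comp_zero, comp_zero, comp_zero]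
      · simp

theorem endMatrixEquiv_apply (hb : ∑ i, b.π i ≫ b.ι i = 𝟙 b.pt) (x : End b.pt) (i j : ι) :
    endMatrixEquiv θ b hb x i j = (θ i j).symm (b.ι j ≫ x ≫ b.π i) := rfl

theorem exists_endAlgEquiv_of_linearEquiv (hb : ∑ i, b.π i ≫ b.ι i = 𝟙 b.pt)
    (h₁ : ∀ i, θ i i (𝟙 (X i) ⊗ₜ 𝟙 (Y i)) = 𝟙 (V i))
    (h₂ : ∀ i j l (s : (X j ⟶ X i) ⊗[k] (Y j ⟶ Y i)) (t : (X l ⟶ X j) ⊗[k] (Y l ⟶ Y j)),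
      θ i l (compTensorMul k s t) = θ j l t ≫ θ i j s) :
    ∃ e : End b.pt ≃ₐ[k] CompTensorMatrix k X Y,
      ∀ i, e (End.of (b.π i ≫ b.ι i)) = CompTensorMatrix.diagUnit k X Y i := by
  refine ⟨AlgEquiv.ofLinearEquiv (endMatrixEquiv θ b hb) ?_ fun x y => ?_, fun i₀ => ?_⟩
  · funext i j
    rw [endMatrixEquiv_apply]
    refine (LinearEquiv.symm_apply_eq _).2 ((congrArg _ (Category.id_comp _)).trans ?_)
    by_cases h : j = i
    · subst h
      rw [CompTensorMatrix.one_apply_same, h₁, bicone_ι_π_self b]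
    · rw [CompTensorMatrix.one_apply_ne k X Y h, bicone_ι_π_ne b h, map_zero]
  · funext i l
    rw [endMatrixEquiv_apply, CompTensorMatrix.mul_apply]
    refine (LinearEquiv.symm_apply_eq _).2 ?_
    rw [map_sum]
    simp only [h₂, endMatrixEquiv_apply, LinearEquiv.apply_symm_apply]
    -- Multiplication in `End` is composition in the opposite order of `≫`; inserting the resolution
    -- of the identity turns it into the matrix product.
    have h : x * y = y ≫ (∑ i, b.π i ≫ b.ι i) ≫ x := by rw [hb, Category.id_comp]; rfl
    rw [h]
    simp only [Preadditive.sum_comp, Preadditive.comp_sum, Category.assoc]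
  · funext i j
    refine (endMatrixEquiv_apply θ b hb _ i j).trans ((LinearEquiv.symm_apply_eq _).2 ?_)
    change b.ι j ≫ (b.π i₀ ≫ b.ι i₀) ≫ b.π i = _
    unfold CompTensorMatrix.diagUnit
    by_cases hi : i = i₀
    · subst hi
      rw [Pi.single_eq_same]
      by_cases hj : j = i
      · subst hj
        rw [Pi.single_eq_same, h₁, Category.assoc, bicone_ι_π_self b, Category.comp_id,
          bicone_ι_π_self b]
      · rw [Pi.single_eq_of_ne hj, map_zero, Category.assoc, bicone_ι_π_ne_assoc b hj, zero_comp]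
    · rw [Pi.single_eq_of_ne hi, Category.assoc, bicone_ι_π_ne b (Ne.symm hi), comp_zero, comp_zero]
      exact (map_zero _).symm

end EndAlgebra

theorem Bicone.total_mapBicone {C D : Type*} [Category* C] [Category* D] [Preadditive C]
    [Preadditive D] {ι : Type} [Fintype ι] {V : ι → C} (F : C ⥤ D) [F.Additive] (b : Bicone V)
    (hb : ∑ i, b.π i ≫ b.ι i = 𝟙 b.pt) :
    ∑ i, (F.mapBicone b).π i ≫ (F.mapBicone b).ι i = 𝟙 (F.mapBicone b).pt := by
  refine Eq.trans ?_ ((congrArg F.map hb).trans (F.map_id _))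
  rw [F.map_sum]
  exact Finset.sum_congr rfl fun i _ => (F.map_comp _ _).symm

theorem compTensorMul_lTensor_homCongr {k : Type*} [CommRing k] {C D : Type*} [Category* C]
    [Category* D] [Preadditive C] [Preadditive D] [Linear k C] [Linear k D] {X₁ X₂ X₃ : C}
    {Y₁ Y₂ Y₃ Z₁ Z₂ Z₃ : D} (e₁ : Y₁ ≅ Z₁) (e₂ : Y₂ ≅ Z₂) (e₃ : Y₃ ≅ Z₃)
    (s : (X₂ ⟶ X₁) ⊗[k] (Y₂ ⟶ Y₁)) (t : (X₃ ⟶ X₂) ⊗[k] (Y₃ ⟶ Y₂)) :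
    (Linear.homCongr k e₃ e₁).lTensor (X₃ ⟶ X₁) (compTensorMul k s t) =
      compTensorMul k ((Linear.homCongr k e₂ e₁).lTensor (X₂ ⟶ X₁) s)
        ((Linear.homCongr k e₃ e₂).lTensor (X₃ ⟶ X₂) t) := by
  induction s with
  | zero => simp
  | add s₁ s₂ h₁ h₂ => simp only [map_add, LinearMap.add_apply, h₁, h₂]
  | tmul f g =>
    induction t with
    | zero => simp
    | add t₁ t₂ h₁ h₂ => simp only [map_add, h₁, h₂]
    | tmul f' g' =>
      rw [compTensorMul_tmul, LinearEquiv.lTensor_tmul, LinearEquiv.lTensor_tmul,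
        LinearEquiv.lTensor_tmul, compTensorMul_tmul]
      refine congrArg (_ ⊗ₜ[k] ·) ?_
      change (e₃.inv ≫ g' ≫ g) ≫ e₁.hom = ((e₃.inv ≫ g') ≫ e₂.hom) ≫ (e₂.inv ≫ g) ≫ e₁.hom
      simp only [Category.assoc, Iso.hom_inv_id_assoc]

/-- The tensor product of two free modules of rank one is free of rank one. -/
noncomputable def tensorObjUnitIso (k : Type u) {A B : Type u} [CommRing k] [Ring A] [Algebra k A]
    [Ring B] [Algebra k B] {M : ModuleCat.{u} A} {N : ModuleCat.{u} B} (e : M ≃ₗ[A] A)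
    (e' : N ≃ₗ[B] B) : tensorObj k A B M N ≅ ModuleCat.of (A ⊗[k] B) (A ⊗[k] B) :=
  (LinearEquiv.ofBijective (tensorForm k e.toLinearMap e'.toLinearMap)
    (TensorProduct.congr (e.restrictScalars k) (e'.restrictScalars k)).bijective).toModuleIso

/-! ### Assembling the tilting property and the endomorphism algebra. -/

section

variable (k : Type u) {A B : Type u} [CommRing k] [Ring A] [Algebra k A] [Ring B] [Algebra k B]
  [HasDerivedCategory.{w₁} (ModuleCat.{u} A)] [HasDerivedCategory.{w₂} (ModuleCat.{u} B)]
  [HasDerivedCategory.{w₃} (ModuleCat.{u} (A ⊗[k] B))]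

/-- The interchange law, from naturality of the transformation attached to `g'`, which may be moved
past the map induced by `f`. -/
theorem compareHom_tensorTrans_compTensorMul {P₁ P₂ P₃ : CochainComplex (ModuleCat.{u} B) ℤ}
    [P₂.IsKProjective] [P₃.IsKProjective] [IsTensorFlat (tensorBifunctor k A B) P₁]
    [IsTensorFlat (tensorBifunctor k A B) P₂] [IsTensorFlat (tensorBifunctor k A B) P₃]
    {X₁ X₂ X₃ : DerivedCategory (ModuleCat.{u} A)}
    (s : (X₂ ⟶ X₁) ⊗[k] (DerivedCategory.Q.obj P₂ ⟶ DerivedCategory.Q.obj P₁))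
    (t : (X₃ ⟶ X₂) ⊗[k] (DerivedCategory.Q.obj P₃ ⟶ DerivedCategory.Q.obj P₂)) :
    compareHom (tensorTrans (A := A) k P₃ P₁) X₃ X₁ (compTensorMul k s t) =
      compareHom (tensorTrans (A := A) k P₃ P₂) X₃ X₂ t ≫
        compareHom (tensorTrans (A := A) k P₂ P₁) X₂ X₁ s := by
  induction s with
  | zero => simp
  | add s₁ s₂ h₁ h₂ => simp only [map_add, LinearMap.add_apply, h₁, h₂, Preadditive.comp_add]
  | tmul f g =>
    induction t with
    | zero => simp
    | add t₁ t₂ h₁ h₂ => simp only [map_add, h₁, h₂, Preadditive.add_comp]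
    | tmul f' g' =>
      rw [compTensorMul_tmul, compareHom_tmul, compareHom_tmul, compareHom_tmul, tensorTrans_comp,
        NatTrans.comp_app, Functor.map_comp, Category.assoc, Category.assoc,
        NatTrans.naturality_assoc]

theorem compareHom_tensorTrans_one (P : CochainComplex (ModuleCat.{u} B) ℤ)
    [P.IsKProjective] [IsTensorFlat (tensorBifunctor k A B) P]
    (X : DerivedCategory (ModuleCat.{u} A)) :
    compareHom (tensorTrans (A := A) k P P) X X (𝟙 X ⊗ₜ 𝟙 _) = 𝟙 _ := by
  rw [compareHom_tmul, tensorTrans_id, CategoryTheory.Functor.map_id, Category.id_comp]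
  rfl

-- By thickness only `X = A` matters, where the result is the termwise finitely generated projective
-- complex `A ⊗ P`.
omit [HasDerivedCategory.{w₂} (ModuleCat.{u} B)] in
theorem isPerfect_mapDerivedCategory₁ [Module.Projective k B]
    {P : CochainComplex (ModuleCat.{u} B) ℤ} [IsTensorFlat (tensorBifunctor k A B) P] {a b : ℤ}
    (hP : IsFGProjIcc P a b) {X : DerivedCategory (ModuleCat.{u} A)} (hX : IsPerfect X) :
    IsPerfect ((mapDerivedCategory₁ (tensorBifunctor k A B) P).obj X) := by
  have : ((perfect (A ⊗[k] B)).inverseImage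
      (mapDerivedCategory₁ (tensorBifunctor k A B) P)).IsStableUnderRetracts :=
    ⟨fun r h => (perfect _).prop_of_retract (r.map _) h⟩
  refine mem_of_isPerfect ((perfect (A ⊗[k] B)).inverseImage
    (mapDerivedCategory₁ (tensorBifunctor k A B) P)) ?_ hX
  exact (perfect _).prop_of_iso (tensorSingleIso k P (ModuleCat.of A A)).symm
    (isPerfect_iff.2 ⟨a, b, _, isFGProjIcc_tensorLeft k (ModuleCat.of A A) hP, ⟨Iso.refl _⟩⟩)

variable {ι : Type} [Fintype ι] (P : ι → CochainComplex (ModuleCat.{u} B) ℤ)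
  [∀ i, (P i).IsKProjective] [∀ i, IsTensorFlat (tensorBifunctor k A B) (P i)]
  {X : ι → DerivedCategory (ModuleCat.{u} A)}
  {V : ι → DerivedCategory (ModuleCat.{u} (A ⊗[k] B))}
  (b : Bicone V)

theorem exists_endAlgEquiv (hb : ∑ i, b.π i ≫ b.ι i = 𝟙 b.pt)
    (v : ∀ i, (mapDerivedCategory₁ (tensorBifunctor k A B) (P i)).obj (X i) ≅ V i)
    [DecidableEq ι] {Y : ι → DerivedCategory (ModuleCat.{u} B)}
    (e : ∀ i, Y i ≅ DerivedCategory.Q.obj (P i))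
    (hbij : ∀ i j,
      Function.Bijective (compareHom (tensorTrans (A := A) k (P j) (P i)) (X j) (X i))) :
    ∃ e : End b.pt ≃ₐ[k] CompTensorMatrix k X Y,
      ∀ i, e (End.of (b.π i ≫ b.ι i)) = CompTensorMatrix.diagUnit k X Y i := by
  refine exists_endAlgEquiv_of_linearEquiv (fun i j =>
    ((Linear.homCongr k (e j) (e i)).lTensor (X j ⟶ X i)).trans
      ((LinearEquiv.ofBijective _ (hbij i j)).trans (Linear.homCongr k (v j) (v i)))) b hb
        (fun i => ?_) fun i j l s t => ?_
  · have h : (Linear.homCongr k (e i) (e i)).lTensor (X i ⟶ X i) (𝟙 (X i) ⊗ₜ[k] 𝟙 (Y i)) =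
        𝟙 _ ⊗ₜ 𝟙 _ := by
      rw [LinearEquiv.lTensor_tmul]
      refine congrArg (_ ⊗ₜ[k] ·) ?_
      change ((e i).inv ≫ 𝟙 _) ≫ (e i).hom = 𝟙 _
      rw [Category.comp_id, Iso.inv_hom_id]
    refine (congrArg (Linear.homCongr k (v i) (v i)) ((congrArg (compareHom _ _ _) h).trans
      (compareHom_tensorTrans_one k (P i) (X i)))).trans ?_
    change ((v i).inv ≫ 𝟙 _) ≫ (v i).hom = 𝟙 _
    rw [Category.comp_id, Iso.inv_hom_id]
  · refine (congrArg (Linear.homCongr k (v l) (v i)) ((congrArg (compareHom _ _ _)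
      (compTensorMul_lTensor_homCongr (e i) (e j) (e l) s t)).trans
        (compareHom_tensorTrans_compTensorMul k _ _))).trans ?_
    change ((v l).inv ≫ compareHom _ _ _ _ ≫ compareHom _ _ _ _) ≫ (v i).hom =
      (((v l).inv ≫ compareHom _ _ _ _) ≫ (v j).hom) ≫ ((v j).inv ≫ compareHom _ _ _ _) ≫ (v i).hom
    simp only [Category.assoc, Iso.hom_inv_id_assoc]
    rfl

/-- A morphism to a shift is determined by its components, and each component lies in the image of a
tensor product that vanishes by `h₀`. -/
theorem exceptional_of_compareHom_bijective (hb : ∑ i, b.π i ≫ b.ι i = 𝟙 b.pt)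
    (v : ∀ i, (mapDerivedCategory₁ (tensorBifunctor k A B) (P i)).obj (X i) ≅ V i)
   
    (hbij : ∀ i j (r : ℤ),
      Function.Bijective (compareHom (tensorTrans (A := A) k (P j) (P i)) (X j) ((X i)⟦r⟧)))
    (h₀ : ∀ i j (r : ℤ), r ≠ 0 → Subsingleton ((X j ⟶ (X i)⟦r⟧) ⊗[k]
      (DerivedCategory.Q.obj (P j) ⟶ DerivedCategory.Q.obj (P i)))) (r : ℤ) (hr : r ≠ 0)
    (f : b.pt ⟶ b.pt⟦r⟧) : f = 0 := by
  refine Bicone.hom_ext_of_total b hb fun j => Bicone.hom_ext_of_total'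
    ((shiftFunctor _ r).mapBicone b) (Bicone.total_mapBicone _ b hb) fun i => ?_
  let w : (mapDerivedCategory₁ (tensorBifunctor k A B) (P i)).obj ((X i)⟦r⟧) ≅ (V i)⟦r⟧ :=
    ((mapDerivedCategory₁ (tensorBifunctor k A B) (P i)).commShiftIso r).app (X i) ≪≫
      (shiftFunctor _ r).mapIso (v i)
  have h (x : V j ⟶ (V i)⟦r⟧) : x = 0 := by
    have hx : (v j).hom ≫ x ≫ w.inv = 0 := by
      obtain ⟨y, hy⟩ := (hbij i j r).2 ((v j).hom ≫ x ≫ w.inv)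
      have := h₀ i j r hr
      rw [← hy, Subsingleton.elim y 0, map_zero]
    rw [← cancel_epi (v j).hom, ← cancel_mono w.inv, Category.assoc, hx, comp_zero, zero_comp]
  exact (h _).trans (h _).symm

omit [∀ (i : ι), (P i).IsKProjective] in
theorem isTilting_of_bicone (hb : ∑ i, b.π i ≫ b.ι i = 𝟙 b.pt)
    (v : ∀ i, (mapDerivedCategory₁ (tensorBifunctor k A B) (P i)).obj (X i) ≅ V i)
    [Module.Projective k B] {a a' : ι → ℤ}
    (hP : ∀ i, IsFGProjIcc (P i) (a i) (a' i))
    (hgen : ∀ (S : ObjectProperty (DerivedCategory (ModuleCat.{u} B))) [S.IsTriangulated]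
      [S.IsStableUnderRetracts], (∀ i, S (DerivedCategory.Q.obj (P i))) → S (unitObj B))
    (hX : ∀ i, IsTilting (X i))
    (hexc : ∀ (r : ℤ), r ≠ 0 → ∀ (f : b.pt ⟶ b.pt⟦r⟧), f = 0) : IsTilting b.pt where
  exceptional := hexc
  generates W := by
    have hmem : (ObjectProperty.singleton b.pt).triangEnvelope b.pt :=
      ObjectProperty.le_triangEnvelope _ _ ((ObjectProperty.singleton_iff _ _).2 rfl)
    have hV (i : ι) : (ObjectProperty.singleton b.pt).triangEnvelope (V i) :=
      ObjectProperty.prop_of_retract _ ⟨b.ι i, b.π i, bicone_ι_π_self b i⟩ hmem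
    -- First variable: the objects `X'` with `X' ⊗ P i` in the thick subcategory form a thick
    -- subcategory containing the tilting complex `X i`, hence `A`.
    have hPV (i : ι) : (ObjectProperty.singleton b.pt).triangEnvelope
        (DerivedCategory.Q.obj ((tensorLeft k (ModuleCat.of A A)).obj (P i))) := by
      set S := (ObjectProperty.singleton b.pt).triangEnvelope.inverseImage
        (mapDerivedCategory₁ (tensorBifunctor k A B) (P i))
      have : S.IsStableUnderRetracts :=
        ⟨fun r h => ObjectProperty.prop_of_retract
          (ObjectProperty.singleton b.pt).triangEnvelope (r.map _) h⟩
      have h : S (unitObj A) := (hX i).mem_of_isPerfect S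
        (ObjectProperty.prop_of_iso (ObjectProperty.singleton b.pt).triangEnvelope
          (v i).symm (hV i)) (isPerfect_singleFunctor _ 0)
      exact ObjectProperty.prop_of_iso _ (tensorSingleIso k (P i) (ModuleCat.of A A)) h
    constructor
    · refine (ObjectProperty.triangEnvelope_le_iff _ (Q := perfect _)).2 ?_ W
      rintro _ ⟨⟩
      exact mem_of_bicone _ b hb fun i => (perfect _).prop_of_iso (v i)
        (isPerfect_mapDerivedCategory₁ k (hP i) (hX i).isPerfect)
    · refine mem_of_isPerfect _ ?_
      -- Second variable: the perfect `Y` with `A ⊗ Y` in the thick subcategory include every `P i`,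
      -- hence `B`; finally `A ⊗ B` is the free module of rank one.
      have h := hgen (perfectInverseImage ((tensorBifunctor k A B).obj (ModuleCat.of A A))
        (ObjectProperty.singleton b.pt).triangEnvelope) fun i =>
          ⟨P i, a i, a' i, hP i, ⟨Iso.refl _⟩, hPV i⟩
      have h' := perfectInverseImage.prop_obj _ _ (isFGProjIcc_single (ModuleCat.of B B) 0) h
      refine ObjectProperty.prop_of_iso _ (DerivedCategory.Q.mapIso ?_) h'
      exact (HomologicalComplex.singleMapHomologicalComplex _ (.up ℤ) 0).app _ ≪≫
        (HomologicalComplex.single _ (.up ℤ) 0).mapIso (tensorObjUnitIso k (.refl A A) (.refl B B))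

end

theorem eq_zero_of_retract {C : Type*} [Category* C] [Preadditive C] [HasShift C ℤ]
    [∀ n : ℤ, (shiftFunctor C n).Additive] {X Y Z : C} (rX : Retract X Z) (rY : Retract Y Z) {n : ℤ}
    (h : ∀ f : Z ⟶ Z⟦n⟧, f = 0) (f : X ⟶ Y⟦n⟧) : f = 0 := by
  calc f = (rX.i ≫ rX.r) ≫ f ≫ (rY.i ≫ rY.r)⟦n⟧' := by simp
    _ = rX.i ≫ (rX.r ≫ f ≫ rY.i⟦n⟧') ≫ rY.r⟦n⟧' := by simp only [Functor.map_comp, Category.assoc]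
    _ = 0 := by rw [h (rX.r ≫ f ≫ rY.i⟦n⟧'), zero_comp, comp_zero]

theorem projective_hom_of_retract {k : Type*} [CommRing k] {C : Type*} [Category* C] [Preadditive C]
    [Linear k C] {X Y Z : C} (rX : Retract X Z) (rY : Retract Y Z)
    (h : Module.Projective k (Z ⟶ Z)) : Module.Projective k (X ⟶ Y) :=
  .of_split (M := Z ⟶ Z) (Linear.leftComp k Z rX.r ∘ₗ Linear.rightComp k X rY.i)
    (Linear.leftComp k Y rX.i ∘ₗ Linear.rightComp k Z rY.r) (LinearMap.ext fun f => by simp)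

theorem projective_X_of_retract (k : Type u) {B : Type u} [CommRing k] [Ring B] [Algebra k B]
    {K L : CochainComplex (ModuleCat.{u} B) ℤ} (r : Retract K L) (n : ℤ)
    (h : Module.Projective k (L.X n)) : Module.Projective k (K.X n) :=
  .of_split ((r.i.f n).hom.restrictScalars k) ((r.r.f n).hom.restrictScalars k)
    (LinearMap.ext fun x => LinearMap.congr_fun (congrArg (fun f => (f.f n).hom) r.retract) x)

end TensorTilting

open TensorTilting

theorem theorem1p1 {k A B : Type u} [CommRing k] [Ring A] [Algebra k A] [Ring B] [Algebra k B]
    [HasDerivedCategory.{w₁} (ModuleCat.{u} A)] [HasDerivedCategory.{w₂} (ModuleCat.{u} B)]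
    [HasDerivedCategory.{w₃} (ModuleCat.{u} (A ⊗[k] B))]
    (hB : Module.Projective k B) (n : ℕ)
    (U : Fin n → CochainComplex (ModuleCat.{u} B) ℤ)
    (hU_bounded : ∀ i, ∃ b : ℤ, (U i).IsStrictlyLE b)
    (hU_tilting : TensorTilting.IsTilting (DerivedCategory.Q.obj (⨁ U)))
    (hU_terms : ∀ r : ℤ, Module.Projective k ((⨁ U).X r))
    (hU_end : Module.Projective k (End (DerivedCategory.Q.obj (⨁ U))))
    (T : Fin n → CochainComplex (ModuleCat.{u} A) ℤ)
    (hT_tilting : ∀ i, TensorTilting.IsTilting (DerivedCategory.Q.obj (T i)))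
    (hTU : ∀ i j : Fin n,
      (∃ g : DerivedCategory.Q.obj (U i) ⟶ DerivedCategory.Q.obj (U j), g ≠ 0) →
      ∀ r : ℤ, r ≠ 0 →
        ∀ f : DerivedCategory.Q.obj (T i) ⟶ (DerivedCategory.Q.obj (T j))⟦r⟧, f = 0) :
    TensorTilting.IsTilting
      (DerivedCategory.Q.obj (⨁ fun i => TensorTilting.tensorComplex k (T i) (U i))) ∧
    ∃ e : End (DerivedCategory.Q.obj (⨁ fun i => TensorTilting.tensorComplex k (T i) (U i))) ≃ₐ[k]
        TensorTilting.CompTensorMatrix k (fun i => DerivedCategory.Q.obj (T i))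
          (fun i => DerivedCategory.Q.obj (U i)),
      ∀ i : Fin n,
        e (End.of (DerivedCategory.Q.map
          (biproduct.π (fun i => TensorTilting.tensorComplex k (T i) (U i)) i ≫
            biproduct.ι (fun i => TensorTilting.tensorComplex k (T i) (U i)) i))) =
          TensorTilting.CompTensorMatrix.diagUnit k _ _ i := by

  let R (i : Fin n) : Retract (U i) (⨁ U) := ⟨biproduct.ι U i, biproduct.π U i, by simp⟩
  let bV := DerivedCategory.Q.mapBicone (biproduct.bicone fun i => tensorComplex k (T i) (U i))
  have hbV : ∑ i, bV.π i ≫ bV.ι i = 𝟙 bV.pt := Bicone.total_mapBicone _ _ biproduct.total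
  choose c hc using hU_bounded
  have hperf (i : Fin n) : IsPerfect (DerivedCategory.Q.obj (U i)) :=
    (perfect B).prop_of_retract ((R i).map DerivedCategory.Q) hU_tilting.isPerfect
  choose a b P hP e using fun i => isPerfect_iff.1 (hperf i)
  replace e := fun i => (e i).some
  have (i : Fin n) := (hP i).isKProjective
  have (i : Fin n) : IsTensorFlat (tensorBifunctor k A B) (P i) := (hP i).isTensorFlat k
  let rP (i : Fin n) := (Retract.ofIso (e i).symm).trans ((R i).map DerivedCategory.Q)
  have hproj (i j : Fin n) :
      Module.Projective k (DerivedCategory.Q.obj (P i) ⟶ DerivedCategory.Q.obj (P j)) :=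
    projective_hom_of_retract (rP i) (rP j) hU_end
  have hX (i : Fin n) := (hT_tilting i).isPerfect
  have hbij (i j : Fin n) (r : ℤ) : Function.Bijective
      (compareHom (tensorTrans (A := A) k (P j) (P i)) (DerivedCategory.Q.obj (T j))
        ((DerivedCategory.Q.obj (T i))⟦r⟧)) :=
    compareHom_tensorTrans_bijective k (hP j) (hP i)
      (fun m hm => eq_zero_of_retract (rP j) (rP i) (hU_tilting.exceptional m hm)) (hX j)
      ((perfect A).le_shift r _ (hX i))
  have hbij₀ (i j : Fin n) : Function.Bijective
      (compareHom (tensorTrans (A := A) k (P j) (P i)) (DerivedCategory.Q.obj (T j))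
        (DerivedCategory.Q.obj (T i))) :=
    compareHom_tensorTrans_bijective k (hP j) (hP i)
      (fun m hm => eq_zero_of_retract (rP j) (rP i) (hU_tilting.exceptional m hm)) (hX j) (hX i)
  -- The isomorphism `P i ≅ U i` is represented by a chain map, and tensoring it with `T i` remains
  -- an isomorphism because both complexes are bounded above with `k`-projective terms.
  have hv (i : Fin n) : Nonempty ((mapDerivedCategory₁ (tensorBifunctor k A B) (P i)).obj
      (DerivedCategory.Q.obj (T i)) ≅ DerivedCategory.Q.obj (tensorComplex k (T i) (U i))) := by
    obtain ⟨f, hf⟩ := Q_map_surjective (P i) (U i) (e i).inv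
    have : IsIso (DerivedCategory.Q.map f) := hf ▸ inferInstance
    have := (hP i).le
    have := hc i
    have hPk (m : ℤ) : Module.Projective k ((P i).X m) := by
      have := (hP i).projective m
      exact projective_restrictScalars k ((P i).X m)
    have h := isIso_Q_map_tensor k (T i) f (b := b i) (c := c i) hPk
      fun m => projective_X_of_retract k (R i) m (hU_terms m)
    exact ⟨mapDerivedCategory₁ObjIso _ (P i) (T i) ≪≫ @asIso _ _ _ _ _ h⟩
  let v (i : Fin n) := (hv i).some
  -- Either `Hom(U j, U i)` is nonzero and the hypothesis kills `Hom(T j, T i[r])`, or the second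
  -- factor is zero.
  have h₀ (i j : Fin n) (r : ℤ) (hr : r ≠ 0) :
      Subsingleton ((DerivedCategory.Q.obj (T j) ⟶ (DerivedCategory.Q.obj (T i))⟦r⟧) ⊗[k]
        (DerivedCategory.Q.obj (P j) ⟶ DerivedCategory.Q.obj (P i))) := by
    by_cases h : ∃ g : DerivedCategory.Q.obj (U j) ⟶ DerivedCategory.Q.obj (U i), g ≠ 0
    · have : Subsingleton (DerivedCategory.Q.obj (T j) ⟶ (DerivedCategory.Q.obj (T i))⟦r⟧) :=
        subsingleton_of_forall_eq 0 (hTU j i h r hr)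
      exact subsingleton_tensorProduct
    · push Not at h
      have : Subsingleton (DerivedCategory.Q.obj (U j) ⟶ DerivedCategory.Q.obj (U i)) :=
        subsingleton_of_forall_eq 0 h
      have : Subsingleton (DerivedCategory.Q.obj (P j) ⟶ DerivedCategory.Q.obj (P i)) :=
        ((e j).symm.homCongr (e i).symm).subsingleton
      have := subsingleton_tensorProduct (k := k)
        (M := DerivedCategory.Q.obj (P j) ⟶ DerivedCategory.Q.obj (P i))
        (N := DerivedCategory.Q.obj (T j) ⟶ (DerivedCategory.Q.obj (T i))⟦r⟧)
      exact (TensorProduct.comm k _ _).toEquiv.subsingleton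
  have hgen (S : ObjectProperty (DerivedCategory (ModuleCat.{u} B))) [S.IsTriangulated]
      [S.IsStableUnderRetracts] (hS : ∀ i, S (DerivedCategory.Q.obj (P i))) : S (unitObj B) :=
    hU_tilting.mem_of_isPerfect S (mem_of_bicone S
      (DerivedCategory.Q.mapBicone (biproduct.bicone U))
      (Bicone.total_mapBicone _ _ biproduct.total) fun i => S.prop_of_iso (e i).symm (hS i))
      (isPerfect_singleFunctor _ 0)
  refine ⟨isTilting_of_bicone k P bV hbV v hP hgen hT_tilting
    (exceptional_of_compareHom_bijective k P bV hbV v hbij h₀), ?_⟩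
  obtain ⟨E, hE⟩ := exists_endAlgEquiv k P bV hbV v e hbij₀
  refine ⟨E, fun i => Eq.trans ?_ (hE i)⟩
  exact congrArg (fun f => E (End.of f)) (DerivedCategory.Q.map_comp _ _)
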